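/- **Setting.** Let $s\ge 1$ be an integer, let $K$ be a field of characteristic $0$ (for instance $\mathbb R$ or $\mathbb C$), let $a_{i,j}\in K$ ($i\ge 1$, $j\ge 0$) be arbitrary, and put $F_i(\rho)=\sum_{j\ge 0}a_{i,j}\rho^{j-1}$. Let $G(x,L)\in K[L][[x]]$ be the solution of the Dyson–Schwinger equation $$G(x,L)=1-\sum_{i\ge 1}x^i\,G(x,\partial_{-\rho})^{1-si}\,(e^{-L\rho}-1)F_i(\rho)\Big|_{\rho=0},\qquad \partial_{-\rho}=-\tfrac{\partial}{\partial\rho}.$$ For $k\ge 0$ its next-to${}^k$ leading log (N${}^k$LL) expansion is $H_k(z)=\sum_{i\ge 0}g_{i,i+k}z^i$, where $g_{i,j}$ is the coefficient of $L^ix^j$ in $G(x,L)-1$. **Chord diagrams.** A chord diagram $C$ is a set of pairs (chords) $(a_1,b_1),\dots,(a_n,b_n)$ with $a_i<b_i$ and $\{a_1,b_1,\dots,a_n,b_n\}=\{1,\dots,2n\}$. Two chords $(a,b),(a',b')$ intersect if $a<a'<b<b'$ or $a'<a<b'<b$; $C$ is connected if $n\ge 1$ and its intersection graph is connected. A chord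 $(a,b)$ is terminal if every chord $(c,d)$ intersecting it satisfies $c<a$. The intersection order of a connected diagram lists first the chord with the smallest left endpoint (the root), and then the connected components of the diagram without its root, ordered by their leftmost endpoints, each listed recursively in intersection order. Chord $c$ covers the interval $[p,p+1]$ ($1\le p<2n$) if $c$ is the last chord, in intersection order, with $a\le p<b$; $\omega(c)$ is the number of intervals covered by $c$, minus $1$. A decorated diagram carries in addition a positive integer $d(c)$ on each chord $c$; its size is $\|C\|=\sum_c d(c)$ and its weight is $w(C)=\prod_c\binom{d(c)s+\omega(c)-2}{\omega(c)}$, where $\binom{-1}{0}=1$. **Types.** Let $C$ be a decorated connected diagram and let $c_1,\dots,c_\ell$ be its terminal chords in intersection order, at positions $t_1<\dots<t_\ell$ in that order. The type of $C$ is $(\Delta,\mathcal G,\mathcal D)$, where $\Delta=d(c_1)$, $\mathcal G$ is the multiset of the pairs $(d(c_j),t_j-t_{j-1})$ for $2\le j\le \ell$, and $\mathcal D$ is the multiset of the decorations of the chords that are neither terminal nor of decoration $1$. Let $$F_{\Delta,\mathcal G,\mathcal D}(z)=\sum_{C\text{ of type }(\Delta,\mathcal G,\mathcal D)}w(C)\frac{z^{\|C\|}}{\|C\|!}$$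 be the weighted generating function of the decorated connected diagrams of type $(\Delta,\mathcal G,\mathcal D)$. For any triplet $(\Delta,\mathcal G,\mathcal D)$ where $\Delta$ is a positive integer, $\mathcal G$ is a finite multiset of pairs $(d,g)$ of positive integers and $\mathcal D$ is a finite multiset of integers greater than $1$, let $$t(\Delta,\mathcal G,\mathcal D)=\sum_{(d,g)\in\mathcal G}(d+g-1)+\sum_{d\in\mathcal D}(d-1)+\Delta-1$$ (sums and products over multisets are taken with multiplicity). **Theorem.** Let $k\ge 0$. There are finitely many such triplets with $t(\Delta,\mathcal G,\mathcal D)\le k$, and, if $a_{1,0}\neq 0$, then, as formal power series in $z$, $$H_k(z)=\kappa-\sum_{\substack{(\Delta,\mathcal G,\mathcal D)\\ t(\Delta,\mathcal G,\mathcal D)\le k}}\left(a_{1,0}^{k-\Delta}\,a_{\Delta,k-t(\Delta,\mathcal G,\mathcal D)}\prod_{d\in\mathcal D}\frac{a_{d,0}}{a_{1,0}^d}\prod_{(d,g)\in\mathcal G}\frac{a_{d,g}}{a_{1,0}^d}\right)\frac{\partial^kF_{\Delta,\mathcal G,\mathcal D}}{\partial z^k}(-a_{1,0}z),$$ where $\kappa\in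 K$ is the constant for which the right-hand side vanishes at $z=0$. The formula (with $\kappa$ determined in the same way) also holds without the assumption $a_{1,0}\ne 0$, if in each term the powers of $a_{1,0}$ displayed above, including those that come from the substitution $-a_{1,0}z$, are collected: the coefficient of $z^m$ in the term of $(\Delta,\mathcal G,\mathcal D)$ is then $$a_{\Delta,k-t(\Delta,\mathcal G,\mathcal D)}\prod_{d\in\mathcal D}a_{d,0}\prod_{(d,g)\in\mathcal G}a_{d,g}\cdot(-1)^m\,a_{1,0}^{\,m+k-\Delta-\sum_{d\in\mathcal D}d-\sum_{(d,g)\in\mathcal G}d}\,[z^m]\frac{\partial^kF_{\Delta,\mathcal G,\mathcal D}}{\partial z^k}(z),$$ where the exponent of $a_{1,0}$ is nonnegative whenever the last factor is nonzero. -/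

import Mathlib

open scoped Polynomial PowerSeries

noncomputable section

namespace ChordLog

/-! ### Chord diagrams -/

/-- A chord diagram: a collection of `n` ordered pairs `(a, b)`, `a < b`, whose endpoints are
exactly `1, …, 2n` (so, by counting, every point is an endpoint of exactly one chord). -/
@[ext] structure ChordDiagram where
  chords : Finset (ℕ × ℕ)
  fst_lt_snd : ∀ c ∈ chords, c.1 < c.2
  endpoints : chords.image Prod.fst ∪ chords.image Prod.snd = Finset.Icc 1 (2 * chords.card)

/-- Directed edge of the intersection graph: `a < a' < b < b'`. -/
def Crosses (c c' : ℕ × ℕ) : Prop := c.1 < c'.1 ∧ c'.1 < c.2 ∧ c.2 < c'.2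

/-- Two chords intersect: there is an edge between them in one direction or the other. -/
def Intersects (c c' : ℕ × ℕ) : Prop := Crosses c c' ∨ Crosses c' c

/-- `c` and `c'` are in the same connected component of the intersection graph of the set of
chords `S`: they are joined by a chain of successively intersecting chords of `S`. -/
def Linked (S : Finset (ℕ × ℕ)) (c c' : ℕ × ℕ) : Prop :=
  Relation.ReflTransGen (fun u v => u ∈ S ∧ v ∈ S ∧ Intersects u v) c c'

open Classical in
/-- The connected component of the chord `c` in a set of chords `S`. -/
def component (S : Finset (ℕ × ℕ)) (c : ℕ × ℕ) : Finset (ℕ × ℕ) := S.filter (Linked S c)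

/-- The chord with the smallest left endpoint (in a chord diagram all endpoints are distinct, so
there is only one). -/
def leftmost (S : Finset (ℕ × ℕ)) (h : S.Nonempty) : ℕ × ℕ :=
  (S.exists_min_image Prod.fst h).choose

lemma leftmost_mem (S : Finset (ℕ × ℕ)) (h : S.Nonempty) : leftmost S h ∈ S :=
  (S.exists_min_image Prod.fst h).choose_spec.1

lemma leftmost_mem_component (S : Finset (ℕ × ℕ)) (h : S.Nonempty) :
    leftmost S h ∈ component S (leftmost S h) := by
  classical
  exact Finset.mem_filter.2 ⟨leftmost_mem S h, Relation.ReflTransGen.refl⟩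

lemma component_subset (S : Finset (ℕ × ℕ)) (c : ℕ × ℕ) : component S c ⊆ S := by
  classical
  exact Finset.filter_subset _ _

/-- The list of the chords of `S` in intersection order. The connected components of `S` are listed
one after the other, ordered by their leftmost endpoint; in each component the root (its leftmost
chord) comes first, followed by the list, obtained in the same way, of what is left of the component
after the removal of its root. For a connected `S` there is only one component, and this is: the
root, then the components of `S` without its root, from left to right, each in intersection order. -/
def intersectionOrder (S : Finset (ℕ × ℕ)) : List (ℕ × ℕ) :=
  if h : S.Nonempty then
    leftmost S h ::
      (intersectionOrder ((component S (leftmost S h)).erase (leftmost S h)) ++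
        intersectionOrder (S \ component S (leftmost S h)))
  else []
termination_by S.card
decreasing_by
  · exact lt_of_lt_of_le (Finset.card_erase_lt_of_mem (leftmost_mem_component S h))
      (Finset.card_le_card (component_subset S _))
  · exact Finset.card_lt_card (Finset.sdiff_ssubset (component_subset S _)
      ⟨_, leftmost_mem_component S h⟩)

namespace ChordDiagram

/-- A chord diagram is connected if its intersection graph is connected (hence not empty). -/
def Connected (C : ChordDiagram) : Prop :=
  C.chords.Nonempty ∧ ∀ c ∈ C.chords, ∀ c' ∈ C.chords, Linked C.chords c c'

/-- A chord is terminal if every chord that intersects it has a smaller left endpoint. -/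
def IsTerminal (C : ChordDiagram) (c : ℕ × ℕ) : Prop :=
  ∀ c' ∈ C.chords, Intersects c c' → c'.1 < c.1

/-- The position (`1`, …, `|C|`) of a chord in the intersection order. -/
def position (C : ChordDiagram) (c : ℕ × ℕ) : ℕ := (intersectionOrder C.chords).idxOf c + 1

open Classical in
/-- The terminal chords, in intersection order. -/
def terminalChords (C : ChordDiagram) : List (ℕ × ℕ) :=
  (intersectionOrder C.chords).filter (fun c => C.IsTerminal c)

/-- The interval `[p, p + 1]` is below the chord `c`. -/
def Below (p : ℕ) (c : ℕ × ℕ) : Prop := c.1 ≤ p ∧ p < c.2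

open Classical in
/-- The intervals `[p, p + 1]`, `1 ≤ p < 2|C|`, covered by the chord `c`. If the chords are processed
in intersection order, each one relabelling all the intervals below it, then the final label of an
interval is the last chord that it is below. -/
def coveredIntervals (C : ChordDiagram) (c : ℕ × ℕ) : Finset ℕ :=
  (Finset.Ico 1 (2 * C.chords.card)).filter
    (fun p => Below p c ∧ ∀ c' ∈ C.chords, Below p c' → C.position c' ≤ C.position c)

/-- The covering number `ω(c)`: the number of intervals covered by `c`, minus one (every chord of a
connected diagram covers at least the interval that starts at its left endpoint). -/
def coveringNumber (C : ChordDiagram) (c : ℕ × ℕ) : ℕ := (C.coveredIntervals c).card - 1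

end ChordDiagram

/-- A triplet `(Δ, 𝒢, 𝒟)` of an integer, a multiset of pairs of integers and a multiset of
integers. -/
@[ext] structure DiagramType where
  delta : ℕ
  G : Multiset (ℕ × ℕ)
  D : Multiset ℕ

namespace DiagramType

/-- `Δ > 0`, all pairs `(d, g)` in `𝒢` have `d > 0` and `g > 0`, all elements of `𝒟` are `> 1`. -/
def Valid (T : DiagramType) : Prop :=
  0 < T.delta ∧ (∀ p ∈ T.G, 0 < p.1 ∧ 0 < p.2) ∧ ∀ d ∈ T.D, 1 < d

/-- `t(Δ, 𝒢, 𝒟) = ∑_{(d, g) ∈ 𝒢} (d + g - 1) + ∑_{d ∈ 𝒟} (d - 1) + Δ - 1`, with multiplicities.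
For a valid triplet no subtraction is truncated. -/
def t (T : DiagramType) : ℕ :=
  (T.G.map fun p => p.1 + p.2 - 1).sum + (T.D.map fun d => d - 1).sum + (T.delta - 1)

/-- The sum of all the decorations that occur in the triplet. -/
def decorationSum (T : DiagramType) : ℕ := T.delta + (T.G.map Prod.fst).sum + T.D.sum

end DiagramType

/-- A decorated chord diagram: every chord carries a positive integer. The decoration is given the
value `0` outside the set of chords, so that it is determined by its values on the chords. -/
@[ext] structure DecoratedDiagram extends ChordDiagram where
  dec : ℕ × ℕ → ℕ
  dec_pos : ∀ c ∈ chords, 0 < dec c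
  dec_eq_zero : ∀ c, c ∉ chords → dec c = 0

namespace DecoratedDiagram

/-- The size `‖C‖`: the sum of the decorations. -/
def size (C : DecoratedDiagram) : ℕ := ∑ c ∈ C.chords, C.dec c

/-- The weight `∏_c binom(d(c) s + ω(c) - 2, ω(c))`. The subtraction is truncated only if
`d(c) s = 1` and `ω(c) = 0`, and then the binomial coefficient is `1`, as is `binom(-1, 0)`. -/
def weight (s : ℕ) (C : DecoratedDiagram) : ℕ :=
  ∏ c ∈ C.chords, (C.dec c * s + C.coveringNumber c - 2).choose (C.coveringNumber c)

open Classical in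
/-- The type `(Δ, 𝒢, 𝒟)` of a decorated connected diagram: `Δ` is the decoration of the first
terminal chord; `𝒢` is the multiset of the pairs (decoration of the `j`-th terminal chord, gap
between the positions of the `(j-1)`-th and `j`-th terminal chords) for `j ≥ 2`; `𝒟` is the multiset
of the decorations of the chords that are neither terminal nor of decoration `1`. -/
def type (C : DecoratedDiagram) : DiagramType where
  delta := C.dec (C.terminalChords.headD (0, 0))
  G := ((C.terminalChords.zip C.terminalChords.tail).map
    fun q => (C.dec q.2, C.position q.2 - C.position q.1) : List (ℕ × ℕ))
  D := (C.chords.filter fun c => ¬ C.IsTerminal c ∧ C.dec c ≠ 1).val.map C.dec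

/-- There are finitely many decorated diagrams of a given size. -/
lemma finite_size (n : ℕ) : {C : DecoratedDiagram | C.size = n}.Finite := by
  classical
  set B : Finset (ℕ × ℕ) := Finset.Icc 1 (2 * n) ×ˢ Finset.Icc 1 (2 * n) with hB
  have key : ∀ C : DecoratedDiagram, C.size = n → C.chords ⊆ B ∧ ∀ c, C.dec c ≤ n := by
    intro C hC
    have hcard : C.chords.card ≤ n := by
      rw [← hC, size, Finset.card_eq_sum_ones]
      exact Finset.sum_le_sum fun c hc => C.dec_pos c hc
    refine ⟨fun c hc => ?_, fun c => ?_⟩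
    · have h1 : c.1 ∈ Finset.Icc 1 (2 * C.chords.card) := by
        rw [← C.endpoints]
        exact Finset.mem_union_left _ (Finset.mem_image_of_mem _ hc)
      have h2 : c.2 ∈ Finset.Icc 1 (2 * C.chords.card) := by
        rw [← C.endpoints]
        exact Finset.mem_union_right _ (Finset.mem_image_of_mem _ hc)
      simp only [Finset.mem_Icc] at h1 h2
      simp only [hB, Finset.mem_product, Finset.mem_Icc]
      omega
    · by_cases hc : c ∈ C.chords
      · rw [← hC, size]
        exact Finset.single_le_sum (f := C.dec) (fun _ _ => Nat.zero_le _) hc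
      · rw [C.dec_eq_zero c hc]
        exact Nat.zero_le _
  let φ : DecoratedDiagram → Finset (ℕ × ℕ) × (B → ℕ) := fun C => (C.chords, fun b => C.dec b)
  refine Set.Finite.of_finite_image (f := φ) ?_ ?_
  · refine Set.Finite.subset
      ((Finset.finite_toSet B.powerset).prod (Set.finite_Iic (fun _ : B => n))) ?_
    rintro _ ⟨C, hC, rfl⟩
    exact ⟨by simpa [φ] using (key C hC).1, fun b => (key C hC).2 b⟩
  · intro C hC C' hC' h
    have h1 : C.chords = C'.chords := congrArg Prod.fst h
    have h2 : (fun b : B => C.dec b) = fun b : B => C'.dec b := congrArg Prod.snd h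
    refine DecoratedDiagram.ext h1 (funext fun c => ?_)
    by_cases hc : c ∈ B
    · exact congrFun h2 ⟨c, hc⟩
    · rw [C.dec_eq_zero c fun h => hc ((key C hC).1 h),
        C'.dec_eq_zero c fun h => hc ((key C' hC').1 h)]

end DecoratedDiagram

/-! ### Generating functions and the Dyson-Schwinger equation -/

section

variable {K : Type*} [Field K]

variable (K) in
open Classical in
/-- The weighted generating function `∑_{C ∈ 𝒜} w(C) z^‖C‖ / ‖C‖!` of a family `𝒜`. -/
def weightedGF (s : ℕ) (𝒜 : Set DecoratedDiagram) : K⟦X⟧ :=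
  PowerSeries.mk fun n =>
    (∑ C ∈ (DecoratedDiagram.finite_size n).toFinset with C ∈ 𝒜, (C.weight s : K)) / n.factorial

variable (K) in
/-- `F_{Δ,𝒢,𝒟}`: the weighted generating function of the decorated connected diagrams of type
`(Δ, 𝒢, 𝒟)`. -/
def typeGF (s : ℕ) (T : DiagramType) : K⟦X⟧ :=
  weightedGF K s {C | C.Connected ∧ C.type = T}

/-- `(e^{-Lρ} - 1) F_k(ρ)` as a power series in `ρ` over `K[L]`, where
`F_k(ρ) = ∑_{i ≥ 0} a_{k,i} ρ^{i-1}`. It is written as the product of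
`(e^{-Lρ} - 1) / ρ = ∑_{m ≥ 0} (-L)^{m+1} / (m+1)! ρ^m` and `ρ F_k(ρ) = ∑_{i ≥ 0} a_{k,i} ρ^i`. -/
def kernel (a : ℕ → ℕ → K) (k : ℕ) : K[X]⟦X⟧ :=
  PowerSeries.mk (fun m => Polynomial.C ((m + 1).factorial : K)⁻¹ * (-Polynomial.X) ^ (m + 1)) *
    PowerSeries.mk (fun i => Polynomial.C (a k i))

/-- For a polynomial `P(L) = ∑_n c_n L^n`, the polynomial
`P(∂_{-ρ}) (e^{-Lρ} - 1) F_k(ρ) |_{ρ = 0} = ∑_n c_n (-∂/∂ρ)^n (e^{-Lρ} - 1) F_k(ρ) |_{ρ = 0}`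
in `L`. -/
def insertion (a : ℕ → ℕ → K) (k : ℕ) (P : K[X]) : K[X] :=
  P.sum fun n c => Polynomial.C c *
    PowerSeries.constantCoeff ((fun f : K[X]⟦X⟧ => -PowerSeries.derivative K[X] f)^[n] (kernel a k))

/-- `G(x, L)`, a power series in `x` over `K[L]`, solves the Dyson-Schwinger equation
`G(x, L) = 1 - ∑_{k ≥ 1} x^k G(x, ∂_{-ρ})^{1 - s k} (e^{-Lρ} - 1) F_k(ρ) |_{ρ = 0}`, with `s ≥ 1`.
The equation forces the coefficient of `x^0` in `G` to be `1`, so `PowerSeries.invOfUnit G 1` is the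
inverse of `G`, and `G^{1 - s k}` is its power with exponent `s k - 1 ≥ 0`. -/
def IsDysonSchwingerSolution (s : ℕ) (a : ℕ → ℕ → K) (G : K[X]⟦X⟧) : Prop :=
  G = 1 - PowerSeries.mk fun n => ∑ k ∈ Finset.Icc 1 n,
    insertion a k (PowerSeries.coeff (n - k) (PowerSeries.invOfUnit G 1 ^ (s * k - 1)))

/-- The next-to-`k` leading log expansion `H_k(z) = ∑_i g_{i,i+k} z^i`, where `g_{i,j}` is the
coefficient of `L^i x^j` in `G(x, L) - 1`. -/
def logExpansion (G : K[X]⟦X⟧) (k : ℕ) : K⟦X⟧ :=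
  PowerSeries.mk fun i => (PowerSeries.coeff (i + k) (G - 1)).coeff i

/-- The term of the triplet `(Δ, 𝒢, 𝒟)` (for `a_{1,0} ≠ 0`):
`a_{1,0}^{k-Δ} a_{Δ,k-t} ∏_{d ∈ 𝒟} (a_{d,0} / a_{1,0}^d) ∏_{(d,g) ∈ 𝒢} (a_{d,g} / a_{1,0}^d)`
times the `k`-th derivative of `F_{Δ,𝒢,𝒟}` at `-a_{1,0} z`. The exponent `k - Δ` may be `-1`. -/
def typeTerm (s : ℕ) (a : ℕ → ℕ → K) (k : ℕ) (T : DiagramType) : K⟦X⟧ :=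
  PowerSeries.C (a 1 0 ^ ((k : ℤ) - (T.delta : ℤ)) * a T.delta (k - T.t) *
      (T.D.map fun d => a d 0 / a 1 0 ^ d).prod *
      (T.G.map fun p => a p.1 p.2 / a 1 0 ^ p.1).prod) *
    PowerSeries.rescale (-a 1 0) ((PowerSeries.derivative K)^[k] (typeGF K s T))

/-- The same term with the powers of `a_{1,0}` collected: in the coefficient of `z^m` the total
exponent of `a_{1,0}` is `m + k` minus the sum of the decorations in the triplet, and it is
nonnegative whenever the coefficient of `z^m` in the `k`-th derivative of `F_{Δ,𝒢,𝒟}` is not zero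
(the size `m + k` of a diagram of this type is at least that sum). This makes sense even if
`a_{1,0} = 0`. -/
def collectedTypeTerm (s : ℕ) (a : ℕ → ℕ → K) (k : ℕ) (T : DiagramType) : K⟦X⟧ :=
  PowerSeries.mk fun m =>
    a T.delta (k - T.t) * (T.D.map fun d => a d 0).prod * (T.G.map fun p => a p.1 p.2).prod *
      ((-1) ^ m * a 1 0 ^ (m + k - T.decorationSum) *
        PowerSeries.coeff m ((PowerSeries.derivative K)^[k] (typeGF K s T)))

end

end ChordLog

end

noncomputable section

namespace ChordLog

/-! ### Links, components and the intersection order -/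

lemma Intersects.symm {c c' : ℕ × ℕ} (h : Intersects c c') : Intersects c' c := Or.symm h

lemma Linked.symm {S : Finset (ℕ × ℕ)} {c c' : ℕ × ℕ} (h : Linked S c c') : Linked S c' c := by
  induction h with
  | refl => exact Relation.ReflTransGen.refl
  | tail _ h ih => exact ih.head ⟨h.2.1, h.1, h.2.2.symm⟩

lemma Linked.mono {S T : Finset (ℕ × ℕ)} (hST : S ⊆ T) {c c' : ℕ × ℕ} (h : Linked S c c') :
    Linked T c c' := by
  induction h with
  | refl => exact Relation.ReflTransGen.refl
  | tail _ h ih => exact ih.tail ⟨hST h.1, hST h.2.1, h.2.2⟩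

/-- A property of chords that passes from a chord of `S` to the chords of `S` that intersect it
passes along links. -/
lemma Linked.induct {S : Finset (ℕ × ℕ)} {c c' : ℕ × ℕ} (h : Linked S c c')
    {P : ℕ × ℕ → Prop} (h0 : P c)
    (hstep : ∀ u ∈ S, ∀ v ∈ S, Intersects u v → P u → P v) : P c' := by
  induction h with
  | refl => exact h0
  | tail _ h ih => exact hstep _ h.1 _ h.2.1 h.2.2 ih

lemma mem_component {S : Finset (ℕ × ℕ)} {c c' : ℕ × ℕ} :
    c' ∈ component S c ↔ c' ∈ S ∧ Linked S c c' := by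
  classical
  simp [component]

/-- All the chords of `S` are linked to each other. -/
def IsLinkedSet (S : Finset (ℕ × ℕ)) : Prop := ∀ c ∈ S, ∀ c' ∈ S, Linked S c c'

lemma component_eq_self {S : Finset (ℕ × ℕ)} (h : IsLinkedSet S) {c : ℕ × ℕ} (hc : c ∈ S) :
    component S c = S := by
  ext c'
  rw [mem_component]
  exact ⟨fun h => h.1, fun h' => ⟨h', h c hc c' h'⟩⟩

lemma linked_component {S : Finset (ℕ × ℕ)} {c c' : ℕ × ℕ} (h : Linked S c c') :
    Linked (component S c) c c' := by
  induction h with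
  | refl => exact Relation.ReflTransGen.refl
  | @tail u v h1 h2 ih =>
    exact ih.tail ⟨mem_component.2 ⟨h2.1, h1⟩, mem_component.2 ⟨h2.2.1, h1.tail h2⟩, h2.2.2⟩

lemma isLinkedSet_component (S : Finset (ℕ × ℕ)) (c : ℕ × ℕ) :
    IsLinkedSet (component S c) := fun _ hu _ hv =>
  (linked_component (mem_component.1 hu).2).symm.trans (linked_component (mem_component.1 hv).2)

lemma leftmost_le (S : Finset (ℕ × ℕ)) (h : S.Nonempty) {c : ℕ × ℕ} (hc : c ∈ S) :
    (leftmost S h).1 ≤ c.1 :=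
  (S.exists_min_image Prod.fst h).choose_spec.2 c hc

lemma leftmost_eq {S : Finset (ℕ × ℕ)} (h : S.Nonempty) (inj : Set.InjOn Prod.fst (S : Set (ℕ × ℕ)))
    {c : ℕ × ℕ} (hc : c ∈ S) (hmin : ∀ c' ∈ S, c.1 ≤ c'.1) : leftmost S h = c :=
  inj (leftmost_mem S h) hc (le_antisymm (leftmost_le S h hc) (hmin _ (leftmost_mem S h)))

lemma intersectionOrder_of_nonempty {S : Finset (ℕ × ℕ)} (h : S.Nonempty) :
    intersectionOrder S = leftmost S h ::
      (intersectionOrder ((component S (leftmost S h)).erase (leftmost S h)) ++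
        intersectionOrder (S \ component S (leftmost S h))) := by
  rw [intersectionOrder, dif_pos h]

lemma intersectionOrder_empty : intersectionOrder ∅ = [] := by
  rw [intersectionOrder, dif_neg (by simp)]

lemma intersectionOrder_of_linked {S : Finset (ℕ × ℕ)} (h : S.Nonempty) (hS : IsLinkedSet S) :
    intersectionOrder S = leftmost S h :: intersectionOrder (S.erase (leftmost S h)) := by
  rw [intersectionOrder_of_nonempty h, component_eq_self hS (leftmost_mem S h), Finset.sdiff_self,
    intersectionOrder_empty, List.append_nil]

lemma intersectionOrder_eq_append {S : Finset (ℕ × ℕ)} (h : S.Nonempty)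
    (inj : Set.InjOn Prod.fst (S : Set (ℕ × ℕ))) :
    intersectionOrder S = intersectionOrder (component S (leftmost S h)) ++
      intersectionOrder (S \ component S (leftmost S h)) := by
  have hne : (component S (leftmost S h)).Nonempty := ⟨_, leftmost_mem_component S h⟩
  have hl : leftmost _ hne = leftmost S h :=
    leftmost_eq hne (inj.mono (by exact_mod_cast component_subset S _))
      (leftmost_mem_component S h) fun c' hc' => leftmost_le S h (component_subset S _ hc')
  rw [intersectionOrder_of_nonempty h, intersectionOrder_of_linked hne (isLinkedSet_component S _),
    hl, List.cons_append]

lemma perm_intersectionOrder (S : Finset (ℕ × ℕ)) : (intersectionOrder S).Perm S.toList := by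
  induction hn : S.card using Nat.strong_induction_on generalizing S with
  | _ n ih =>
    subst hn
    rcases S.eq_empty_or_nonempty with rfl | h
    · simp [intersectionOrder_empty]
    · rw [intersectionOrder_of_nonempty h]
      have hm := leftmost_mem_component S h
      have h1 := ih _ (lt_of_lt_of_le (Finset.card_erase_lt_of_mem hm)
        (Finset.card_le_card (component_subset S _))) _ rfl
      have h2 := ih _ (Finset.card_lt_card (Finset.sdiff_ssubset (component_subset S _)
        ⟨_, hm⟩)) _ rfl
      refine ((h1.append h2).cons _).trans ?_
      rw [← Multiset.coe_eq_coe, ← Multiset.cons_coe, ← Multiset.coe_add, Finset.coe_toList,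
        Finset.coe_toList, Finset.coe_toList, ← Multiset.cons_add]
      rw [Finset.erase_val, Multiset.cons_erase (by exact hm), Finset.sdiff_val]
      exact add_tsub_cancel_of_le (Finset.val_le_iff.2 (component_subset S _))

lemma mem_intersectionOrder {S : Finset (ℕ × ℕ)} {c : ℕ × ℕ} :
    c ∈ intersectionOrder S ↔ c ∈ S := by
  rw [(perm_intersectionOrder S).mem_iff, Finset.mem_toList]

lemma nodup_intersectionOrder (S : Finset (ℕ × ℕ)) : (intersectionOrder S).Nodup :=
  (perm_intersectionOrder S).nodup_iff.2 S.nodup_toList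

lemma length_intersectionOrder (S : Finset (ℕ × ℕ)) : (intersectionOrder S).length = S.card := by
  rw [(perm_intersectionOrder S).length_eq, Finset.length_toList]

/-! ### Relabelling the endpoints -/

/-- Relabelling of the endpoints of a chord. -/
def relabel (f : ℕ → ℕ) (c : ℕ × ℕ) : ℕ × ℕ := (f c.1, f c.2)

section relabel

variable {f : ℕ → ℕ} (hf : StrictMono f)
include hf

lemma relabel_injective : Function.Injective (relabel f) := fun c c' h => by
  simp only [relabel, Prod.mk.injEq] at h
  exact Prod.ext (hf.injective h.1) (hf.injective h.2)

lemma relabel_mem_image {S : Finset (ℕ × ℕ)} {c : ℕ × ℕ} :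
    relabel f c ∈ S.image (relabel f) ↔ c ∈ S :=
  (relabel_injective hf).mem_finset_image

lemma intersects_relabel {c c' : ℕ × ℕ} :
    Intersects (relabel f c) (relabel f c') ↔ Intersects c c' := by
  simp [Intersects, Crosses, relabel, hf.lt_iff_lt]

lemma exists_linked_of_linked_image {S : Finset (ℕ × ℕ)} {c y : ℕ × ℕ}
    (h : Linked (S.image (relabel f)) (relabel f c) y) : ∃ c', relabel f c' = y ∧ Linked S c c' := by
  induction h with
  | refl => exact ⟨c, rfl, Relation.ReflTransGen.refl⟩
  | @tail u v _ h ih =>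
    obtain ⟨c', rfl, hc'⟩ := ih
    obtain ⟨h1, h2, h3⟩ := h
    obtain ⟨w, hw, rfl⟩ := Finset.mem_image.1 h2
    exact ⟨w, rfl, hc'.tail ⟨(relabel_mem_image hf).1 h1, hw, (intersects_relabel hf).1 h3⟩⟩

lemma linked_relabel {S : Finset (ℕ × ℕ)} {c c' : ℕ × ℕ} :
    Linked (S.image (relabel f)) (relabel f c) (relabel f c') ↔ Linked S c c' := by
  refine ⟨fun h => ?_, fun h => ?_⟩
  · obtain ⟨w, hw, h⟩ := exists_linked_of_linked_image hf h
    rwa [relabel_injective hf hw] at h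
  · induction h with
    | refl => exact Relation.ReflTransGen.refl
    | tail _ h ih => exact ih.tail ⟨(relabel_mem_image hf).2 h.1,
        (relabel_mem_image hf).2 h.2.1, (intersects_relabel hf).2 h.2.2⟩

lemma isLinkedSet_relabel {S : Finset (ℕ × ℕ)} :
    IsLinkedSet (S.image (relabel f)) ↔ IsLinkedSet S := by
  simp only [IsLinkedSet, Finset.forall_mem_image, linked_relabel hf]

lemma component_relabel (S : Finset (ℕ × ℕ)) (c : ℕ × ℕ) :
    component (S.image (relabel f)) (relabel f c) = (component S c).image (relabel f) := by
  ext y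
  simp only [mem_component, Finset.mem_image]
  constructor
  · rintro ⟨⟨w, hw, rfl⟩, h⟩
    exact ⟨w, ⟨hw, (linked_relabel hf).1 h⟩, rfl⟩
  · rintro ⟨w, ⟨hw, h⟩, rfl⟩
    exact ⟨⟨w, hw, rfl⟩, (linked_relabel hf).2 h⟩

lemma injOn_fst_relabel {S : Finset (ℕ × ℕ)} (inj : Set.InjOn Prod.fst (S : Set (ℕ × ℕ))) :
    Set.InjOn Prod.fst ((S.image (relabel f) : Finset (ℕ × ℕ)) : Set (ℕ × ℕ)) := by
  intro x hx y hy h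
  obtain ⟨x, hx', rfl⟩ := Finset.mem_image.1 hx
  obtain ⟨y, hy', rfl⟩ := Finset.mem_image.1 hy
  rw [inj hx' hy' (hf.injective h)]

lemma leftmost_relabel {S : Finset (ℕ × ℕ)} (inj : Set.InjOn Prod.fst (S : Set (ℕ × ℕ)))
    (h : S.Nonempty) : leftmost (S.image (relabel f)) (h.image _) = relabel f (leftmost S h) := by
  refine leftmost_eq _ (injOn_fst_relabel hf inj) (Finset.mem_image_of_mem _ (leftmost_mem S h)) ?_
  intro c' hc'
  obtain ⟨w, hw, rfl⟩ := Finset.mem_image.1 hc'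
  exact hf.monotone (leftmost_le S h hw)

lemma intersectionOrder_relabel {S : Finset (ℕ × ℕ)}
    (inj : Set.InjOn Prod.fst (S : Set (ℕ × ℕ))) :
    intersectionOrder (S.image (relabel f)) = (intersectionOrder S).map (relabel f) := by
  induction hn : S.card using Nat.strong_induction_on generalizing S with
  | _ n ih =>
    subst hn
    rcases S.eq_empty_or_nonempty with rfl | h
    · simp [intersectionOrder_empty]
    · have hm := leftmost_mem_component S h
      rw [intersectionOrder_of_nonempty h, intersectionOrder_of_nonempty (h.image _),
        leftmost_relabel hf inj h, component_relabel hf,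
        ← Finset.image_erase (relabel_injective hf),
        ← Finset.image_sdiff _ _ (relabel_injective hf),
        ih _ (lt_of_lt_of_le (Finset.card_erase_lt_of_mem hm)
          (Finset.card_le_card (component_subset S _))) (S := (component S _).erase _) ?_ rfl,
        ih _ (Finset.card_lt_card (Finset.sdiff_ssubset (component_subset S _)
          ⟨_, hm⟩)) (S := S \ component S _) ?_ rfl]
      · simp
      · exact inj.mono (by exact_mod_cast Finset.sdiff_subset)
      · exact inj.mono (by exact_mod_cast (Finset.erase_subset _ _).trans (component_subset S _))

end relabel

/-! ### Endpoints -/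

/-- The set of the endpoints of the chords of `S`. -/
def pts (S : Finset (ℕ × ℕ)) : Finset ℕ := S.image Prod.fst ∪ S.image Prod.snd

lemma mem_pts {S : Finset (ℕ × ℕ)} {x : ℕ} : x ∈ pts S ↔ ∃ c ∈ S, c.1 = x ∨ c.2 = x := by
  simp only [pts, Finset.mem_union, Finset.mem_image]
  constructor
  · rintro (⟨c, hc, h⟩ | ⟨c, hc, h⟩)
    exacts [⟨c, hc, Or.inl h⟩, ⟨c, hc, Or.inr h⟩]
  · rintro ⟨c, hc, h | h⟩
    exacts [Or.inl ⟨c, hc, h⟩, Or.inr ⟨c, hc, h⟩]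

lemma fst_mem_pts {S : Finset (ℕ × ℕ)} {c : ℕ × ℕ} (hc : c ∈ S) : c.1 ∈ pts S :=
  mem_pts.2 ⟨c, hc, Or.inl rfl⟩

lemma snd_mem_pts {S : Finset (ℕ × ℕ)} {c : ℕ × ℕ} (hc : c ∈ S) : c.2 ∈ pts S :=
  mem_pts.2 ⟨c, hc, Or.inr rfl⟩

lemma pts_union (S T : Finset (ℕ × ℕ)) : pts (S ∪ T) = pts S ∪ pts T := by
  simp only [pts, Finset.image_union]
  ac_rfl

lemma pts_image_relabel (f : ℕ → ℕ) (S : Finset (ℕ × ℕ)) :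
    pts (S.image (relabel f)) = (pts S).image f := by
  simp only [pts, Finset.image_union, Finset.image_image]
  rfl

/-- The chords of `S` have distinct endpoints, in the right order. -/
structure Proper (S : Finset (ℕ × ℕ)) : Prop where
  lt : ∀ c ∈ S, c.1 < c.2
  fst_inj : ∀ c ∈ S, ∀ c' ∈ S, c.1 = c'.1 → c = c'
  snd_inj : ∀ c ∈ S, ∀ c' ∈ S, c.2 = c'.2 → c = c'
  fst_ne_snd : ∀ c ∈ S, ∀ c' ∈ S, c.1 ≠ c'.2

lemma Proper.subset {S T : Finset (ℕ × ℕ)} (h : Proper T) (hST : S ⊆ T) : Proper S where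
  lt c hc := h.lt c (hST hc)
  fst_inj c hc c' hc' := h.fst_inj c (hST hc) c' (hST hc')
  snd_inj c hc c' hc' := h.snd_inj c (hST hc) c' (hST hc')
  fst_ne_snd c hc c' hc' := h.fst_ne_snd c (hST hc) c' (hST hc')

lemma Proper.injOn_fst {S : Finset (ℕ × ℕ)} (h : Proper S) :
    Set.InjOn Prod.fst (S : Set (ℕ × ℕ)) := fun c hc c' hc' => h.fst_inj c hc c' hc'

lemma Proper.card_pts {S : Finset (ℕ × ℕ)} (h : Proper S) : (pts S).card = 2 * S.card := by
  rw [pts, Finset.card_union_of_disjoint, Finset.card_image_of_injOn h.injOn_fst,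
    Finset.card_image_of_injOn fun c hc c' hc' => h.snd_inj c hc c' hc', two_mul]
  rw [Finset.disjoint_left]
  intro x hx hx'
  obtain ⟨c, hc, rfl⟩ := Finset.mem_image.1 hx
  obtain ⟨c', hc', h'⟩ := Finset.mem_image.1 hx'
  exact h.fst_ne_snd c hc c' hc' h'.symm

/-- Chords of disjoint subsets of a proper set have no endpoint in common. -/
lemma Proper.disjoint_pts {S T U : Finset (ℕ × ℕ)} (h : Proper U) (hS : S ⊆ U) (hT : T ⊆ U)
    (hST : Disjoint S T) : Disjoint (pts S) (pts T) := by
  rw [Finset.disjoint_left] at hST ⊢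
  intro x hx hx'
  obtain ⟨c, hc, h1⟩ := mem_pts.1 hx
  obtain ⟨c', hc', h2⟩ := mem_pts.1 hx'
  have hcU := hS hc
  have hcU' := hT hc'
  have key : c = c' := by
    rcases h1 with h1 | h1 <;> rcases h2 with h2 | h2
    · exact h.fst_inj _ hcU _ hcU' (h1.trans h2.symm)
    · exact absurd (h1.trans h2.symm) (h.fst_ne_snd _ hcU _ hcU')
    · exact absurd (h2.trans h1.symm) (h.fst_ne_snd _ hcU' _ hcU)
    · exact h.snd_inj _ hcU _ hcU' (h1.trans h2.symm)
  exact hST hc (key ▸ hc')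

namespace ChordDiagram

variable (C : ChordDiagram)

lemma pts_chords : pts C.chords = Finset.Icc 1 (2 * C.chords.card) := C.endpoints

lemma proper : Proper C.chords := by
  have hcard : (pts C.chords).card = 2 * C.chords.card := by rw [C.pts_chords]; simp
  have h1 : (C.chords.image Prod.fst).card ≤ C.chords.card := Finset.card_image_le
  have h2 : (C.chords.image Prod.snd).card ≤ C.chords.card := Finset.card_image_le
  have h3 := Finset.card_union_add_card_inter (C.chords.image Prod.fst) (C.chords.image Prod.snd)
  rw [pts] at hcard
  have i1 : Set.InjOn Prod.fst (C.chords : Set (ℕ × ℕ)) := Finset.card_image_iff.1 (by omega)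
  have i2 : Set.InjOn Prod.snd (C.chords : Set (ℕ × ℕ)) := Finset.card_image_iff.1 (by omega)
  have i3 : C.chords.image Prod.fst ∩ C.chords.image Prod.snd = ∅ :=
    Finset.card_eq_zero.1 (by omega)
  refine ⟨C.fst_lt_snd, fun c hc c' hc' => i1 hc hc', fun c hc c' hc' => i2 hc hc',
    fun c hc c' hc' h => ?_⟩
  exact Finset.notMem_empty c.1 (i3 ▸ Finset.mem_inter.2 ⟨Finset.mem_image_of_mem _ hc,
    Finset.mem_image.2 ⟨c', hc', h.symm⟩⟩)

variable {C}

lemma one_le_fst {c : ℕ × ℕ} (hc : c ∈ C.chords) : 1 ≤ c.1 := by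
  have := fst_mem_pts hc
  rw [C.pts_chords, Finset.mem_Icc] at this
  exact this.1

lemma snd_le {c : ℕ × ℕ} (hc : c ∈ C.chords) : c.2 ≤ 2 * C.chords.card := by
  have := snd_mem_pts hc
  rw [C.pts_chords, Finset.mem_Icc] at this
  exact this.2

lemma exists_of_mem_Icc {x : ℕ} (h1 : 1 ≤ x) (h2 : x ≤ 2 * C.chords.card) :
    ∃ c ∈ C.chords, c.1 = x ∨ c.2 = x := by
  rw [← mem_pts, C.pts_chords, Finset.mem_Icc]
  exact ⟨h1, h2⟩

lemma leftmost_fst (h : C.chords.Nonempty) : (leftmost C.chords h).1 = 1 := by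
  have hc := h.card_pos
  obtain ⟨c, hc, h1⟩ := C.exists_of_mem_Icc (x := 1) le_rfl (by omega)
  have h2 := C.one_le_fst hc
  have h3 := C.fst_lt_snd c hc
  have h4 := leftmost_le _ h hc
  have h5 := C.one_le_fst (leftmost_mem _ h)
  omega

lemma eq_leftmost (h : C.chords.Nonempty) {c : ℕ × ℕ} (hc : c ∈ C.chords) (h1 : c.1 = 1) :
    c = leftmost C.chords h :=
  C.proper.fst_inj _ hc _ (leftmost_mem _ h) (by rw [h1, leftmost_fst])

lemma two_le_fst (h : C.chords.Nonempty) {c : ℕ × ℕ} (hc : c ∈ C.chords)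
    (hne : c ≠ leftmost C.chords h) : 2 ≤ c.1 := by
  have h1 := C.one_le_fst hc
  by_contra h2
  exact hne (C.eq_leftmost h hc (by omega))

lemma Connected.isLinkedSet (h : C.Connected) : IsLinkedSet C.chords := h.2

/-- In a connected diagram every interval is below some chord. -/
lemma Connected.exists_below (h : C.Connected) {q : ℕ} (h1 : 1 ≤ q) (h2 : q < 2 * C.chords.card) :
    ∃ c ∈ C.chords, Below q c := by
  by_contra! hcon
  obtain ⟨c, hc, hcx⟩ := C.exists_of_mem_Icc (x := 1) le_rfl (by omega)
  obtain ⟨c', hc', hcx'⟩ := C.exists_of_mem_Icc (x := 2 * C.chords.card) (by omega) le_rfl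
  have := (h.2 c hc c' hc').induct (P := fun u => u ∈ C.chords ∧ u.2 ≤ q) ?_ ?_
  · have h3 := C.snd_le hc'
    have h4 := C.fst_lt_snd _ hc'
    omega
  · have h3 := C.one_le_fst hc
    have h4 := C.fst_lt_snd _ hc
    have h5 := hcon c hc
    unfold Below at h5
    exact ⟨hc, by omega⟩
  · rintro u hu v hv huv ⟨-, hu'⟩
    have h5 := hcon v hv
    have h6 := C.fst_lt_snd _ hu
    unfold Below at h5
    refine ⟨hv, ?_⟩
    rcases huv with huv | huv <;> unfold Crosses at huv <;> omega

/-- In a connected diagram every interval except the first one is below some chord other than the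
root. -/
lemma Connected.exists_below_ne (h : C.Connected) {q : ℕ} (h1 : 2 ≤ q)
    (h2 : q < 2 * C.chords.card) : ∃ c ∈ C.chords, c ≠ leftmost C.chords h.1 ∧ Below q c := by
  by_contra! hcon
  set r := leftmost C.chords h.1 with hr
  have hrm : r ∈ C.chords := leftmost_mem _ _
  have hr1 : r.1 = 1 := leftmost_fst _
  unfold Below at hcon
  have hlt := C.fst_lt_snd
  rcases le_or_gt r.2 q with hb | hb
  · obtain ⟨c, hc, hcx⟩ := C.exists_of_mem_Icc (x := 2 * C.chords.card) (by omega) le_rfl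
    have := (h.2 c hc r hrm).induct (P := fun u => q < u.1) ?_ ?_
    · omega
    · have h3 := C.snd_le hc
      have h4 := hlt c hc
      have h5 : c ≠ r := by rintro rfl; omega
      have h6 := hcon c hc h5
      omega
    · intro u hu v hv huv hu'
      have h5 : v ≠ r := by
        rintro rfl
        have h6 := hlt u hu
        rcases huv with huv | huv <;> unfold Crosses at huv <;> omega
      have h6 := hcon v hv h5
      rcases huv with huv | huv <;> unfold Crosses at huv <;> omega
  · obtain ⟨c, hc, hcx⟩ := C.exists_of_mem_Icc (x := 2) (by omega) (by omega)
    have := (h.2 c hc r hrm).induct (P := fun u => u ≠ r ∧ u.2 ≤ q) ?_ ?_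
    · exact this.1 rfl
    · have h4 := hlt c hc
      have h5 : c ≠ r := by rintro rfl; omega
      have h6 := hcon c hc h5
      have h7 := C.two_le_fst h.1 hc h5
      exact ⟨h5, by omega⟩
    · rintro u hu v hv huv ⟨hu1, hu'⟩
      have h7 := C.two_le_fst h.1 hu hu1
      have h5 : v ≠ r := by
        rintro rfl
        rcases huv with huv | huv <;> unfold Crosses at huv <;> omega
      have h6 := hcon v hv h5
      have h8 := hlt u hu
      refine ⟨h5, ?_⟩
      rcases huv with huv | huv <;> unfold Crosses at huv <;> omega

end ChordDiagram

/-! ### Insertion of a diagram into an interval of another one -/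

/-- The relabelling of the endpoints of the outer diagram: its first point stays, the others are
moved into the `p`-th interval of the inner diagram. -/
def outerMap (p q : ℕ) : ℕ := if q ≤ 1 then q else q + p

/-- The relabelling of the endpoints of the inner diagram, when all but the first point of an outer
diagram with `m` chords are inserted into its `p`-th interval. -/
def innerMap (p m q : ℕ) : ℕ := if q ≤ p then q + 1 else q + 2 * m

lemma strictMono_outerMap (p : ℕ) : StrictMono (outerMap p) := by
  intro x y h
  unfold outerMap
  split_ifs <;> omega

lemma strictMono_innerMap (p : ℕ) {m : ℕ} (hm : 0 < m) : StrictMono (innerMap p m) := by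
  intro x y h
  unfold innerMap
  split_ifs <;> omega

/-- `C` is obtained from the connected diagrams `C₁` and `C₂` by putting the first point of `C₁`
before `C₂` and the other points of `C₁` in the `p`-th interval of `C₂`. -/
structure IsInsertion (C C₁ C₂ : ChordDiagram) (p : ℕ) : Prop where
  outer : C₁.Connected
  inner : C₂.Connected
  one_le : 1 ≤ p
  lt : p < 2 * C₂.chords.card
  chords_eq : C.chords = C₁.chords.image (relabel (outerMap p)) ∪
    C₂.chords.image (relabel (innerMap p C₁.chords.card))

lemma image_outerMap {p m : ℕ} (hm : 0 < m) : (Finset.Icc 1 (2 * m)).image (outerMap p) =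
    insert 1 (Finset.Icc (p + 2) (p + 2 * m)) := by
  ext x
  simp only [Finset.mem_image, Finset.mem_Icc, Finset.mem_insert]
  constructor
  · rintro ⟨q, hq, rfl⟩
    unfold outerMap
    split_ifs <;> omega
  · rintro (rfl | hx)
    · exact ⟨1, by omega, rfl⟩
    · exact ⟨x - p, by omega, by unfold outerMap; split_ifs <;> omega⟩

lemma image_innerMap {p m n : ℕ} (h2 : p < 2 * n) :
    (Finset.Icc 1 (2 * n)).image (innerMap p m) =
    Finset.Icc 2 (p + 1) ∪ Finset.Icc (p + 2 * m + 1) (2 * n + 2 * m) := by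
  ext x
  simp only [Finset.mem_image, Finset.mem_Icc, Finset.mem_union]
  constructor
  · rintro ⟨q, hq, rfl⟩
    unfold innerMap
    split_ifs <;> omega
  · rintro (hx | hx)
    · exact ⟨x - 1, by omega, by unfold innerMap; split_ifs <;> omega⟩
    · exact ⟨x - 2 * m, by omega, by unfold innerMap; split_ifs <;> omega⟩

lemma disjoint_image_maps {p m n : ℕ} (hm : 0 < m) (h2 : p < 2 * n) :
    Disjoint ((Finset.Icc 1 (2 * m)).image (outerMap p))
      ((Finset.Icc 1 (2 * n)).image (innerMap p m)) := by
  rw [image_outerMap hm, image_innerMap h2, Finset.disjoint_left]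
  intro x hx hx'
  simp only [Finset.mem_Icc, Finset.mem_insert, Finset.mem_union] at hx hx'
  omega

lemma disjoint_of_disjoint_pts {S T : Finset (ℕ × ℕ)} (h : Disjoint (pts S) (pts T)) :
    Disjoint S T := by
  rw [Finset.disjoint_left] at h ⊢
  exact fun c hc hc' => h (fst_mem_pts hc) (fst_mem_pts hc')

lemma disjoint_relabel (C₁ C₂ : ChordDiagram) {p : ℕ} (h1 : C₁.chords.Nonempty)
    (h2 : p < 2 * C₂.chords.card) :
    Disjoint (C₁.chords.image (relabel (outerMap p)))
      (C₂.chords.image (relabel (innerMap p C₁.chords.card))) := by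
  apply disjoint_of_disjoint_pts
  rw [pts_image_relabel, pts_image_relabel, C₁.pts_chords, C₂.pts_chords]
  exact disjoint_image_maps h1.card_pos h2

lemma exists_isInsertion {C₁ C₂ : ChordDiagram} (h1 : C₁.Connected) (h2 : C₂.Connected) {p : ℕ}
    (hp : 1 ≤ p) (hp' : p < 2 * C₂.chords.card) : ∃ C, IsInsertion C C₁ C₂ p := by
  have hm := h1.1.card_pos
  have s1 := strictMono_outerMap p
  have s2 := strictMono_innerMap p hm
  refine ⟨⟨C₁.chords.image (relabel (outerMap p)) ∪
    C₂.chords.image (relabel (innerMap p C₁.chords.card)), ?_, ?_⟩, h1, h2, hp, hp', rfl⟩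
  · intro c hc
    rcases Finset.mem_union.1 hc with hc | hc <;> obtain ⟨c, hc', rfl⟩ := Finset.mem_image.1 hc
    · exact s1 (C₁.fst_lt_snd c hc')
    · exact s2 (C₂.fst_lt_snd c hc')
  · change pts _ = _
    rw [pts_union, pts_image_relabel, pts_image_relabel, C₁.pts_chords, C₂.pts_chords,
      Finset.card_union_of_disjoint (disjoint_relabel C₁ C₂ h1.1 hp'),
      Finset.card_image_of_injective _ (relabel_injective s1),
      Finset.card_image_of_injective _ (relabel_injective s2),
      image_outerMap hm, image_innerMap hp']
    ext x
    simp only [Finset.mem_Icc, Finset.mem_insert, Finset.mem_union]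
    omega

namespace IsInsertion

variable {C C₁ C₂ : ChordDiagram} {p : ℕ}

section

variable (h : IsInsertion C C₁ C₂ p)
include h

lemma inner_strictMono : StrictMono (innerMap p C₁.chords.card) :=
  strictMono_innerMap p h.outer.1.card_pos

lemma card_eq : C.chords.card = C₁.chords.card + C₂.chords.card := by
  rw [h.chords_eq, Finset.card_union_of_disjoint (disjoint_relabel C₁ C₂ h.outer.1 h.lt),
    Finset.card_image_of_injective _ (relabel_injective (strictMono_outerMap p)),
    Finset.card_image_of_injective _ (relabel_injective h.inner_strictMono)]

lemma mem_iff {c : ℕ × ℕ} : c ∈ C.chords ↔ (∃ c₁ ∈ C₁.chords, relabel (outerMap p) c₁ = c) ∨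
    ∃ c₂ ∈ C₂.chords, relabel (innerMap p C₁.chords.card) c₂ = c := by
  rw [h.chords_eq, Finset.mem_union, Finset.mem_image, Finset.mem_image]

lemma outer_mem {c : ℕ × ℕ} (hc : c ∈ C₁.chords) : relabel (outerMap p) c ∈ C.chords :=
  h.mem_iff.2 (Or.inl ⟨c, hc, rfl⟩)

lemma inner_mem {c : ℕ × ℕ} (hc : c ∈ C₂.chords) :
    relabel (innerMap p C₁.chords.card) c ∈ C.chords :=
  h.mem_iff.2 (Or.inr ⟨c, hc, rfl⟩)

lemma outer_ne_inner {c c' : ℕ × ℕ} (hc : c ∈ C₁.chords) (hc' : c' ∈ C₂.chords) :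
    relabel (outerMap p) c ≠ relabel (innerMap p C₁.chords.card) c' := fun he =>
  Finset.disjoint_left.1 (disjoint_relabel C₁ C₂ h.outer.1 h.lt)
    (Finset.mem_image_of_mem _ hc) (he ▸ Finset.mem_image_of_mem _ hc')

lemma nonempty : C.chords.Nonempty := 
  ⟨_, h.outer_mem h.outer.1.choose_spec⟩

end

end IsInsertion

namespace IsInsertion

variable {C C₁ C₂ : ChordDiagram} {p : ℕ} (h : IsInsertion C C₁ C₂ p)

include h

/-- The root of the outer diagram. -/
def root : ℕ × ℕ := leftmost C₁.chords h.outer.1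

lemma root_mem : h.root ∈ C₁.chords := leftmost_mem _ _

lemma root_fst : h.root.1 = 1 := ChordDiagram.leftmost_fst _

lemma relabel_root : relabel (outerMap p) h.root = (1, h.root.2 + p) := by
  have h1 := h.root_fst
  have h2 := C₁.fst_lt_snd _ h.root_mem
  unfold relabel outerMap
  rw [if_pos (by omega), if_neg (by omega), h1]

lemma relabel_outer {c : ℕ × ℕ} (hc : c ∈ C₁.chords) (hne : c ≠ h.root) :
    relabel (outerMap p) c = (c.1 + p, c.2 + p) := by
  have h1 := C₁.two_le_fst h.outer.1 hc hne
  have h2 := C₁.fst_lt_snd _ hc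
  unfold relabel outerMap
  rw [if_neg (by omega), if_neg (by omega)]

lemma not_intersects {c c' : ℕ × ℕ} (hc : c ∈ C₁.chords) (hne : c ≠ h.root) :
    ¬ Intersects (relabel (outerMap p) c) (relabel (innerMap p C₁.chords.card) c') := by
  have h1 := C₁.two_le_fst h.outer.1 hc hne
  have h2 := C₁.fst_lt_snd _ hc
  have h3 := C₁.snd_le hc
  rw [h.relabel_outer hc hne]
  simp only [Intersects, Crosses, relabel, innerMap]
  split_ifs <;> omega

lemma intersects_root {c : ℕ × ℕ} (hc : c ∈ C₂.chords) (hb : ChordDiagram.Below p c) :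
    Intersects (relabel (outerMap p) h.root) (relabel (innerMap p C₁.chords.card) c) := by
  have h1 := C₁.fst_lt_snd _ h.root_mem
  have h2 := h.root_fst
  have h3 := C₁.snd_le h.root_mem
  have h4 := C₂.one_le_fst hc
  rw [h.relabel_root]
  unfold ChordDiagram.Below at hb
  simp only [Intersects, Crosses, relabel, innerMap]
  rw [if_pos (by omega), if_neg (by omega)]
  omega

lemma connected : C.Connected := by
  refine ⟨h.nonempty, ?_⟩
  have hO : ∀ c ∈ C₁.chords,
      Linked C.chords (relabel (outerMap p) h.root) (relabel (outerMap p) c) := fun c hc =>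
    ((linked_relabel (strictMono_outerMap p)).2 (h.outer.2 _ h.root_mem c hc)).mono
      (by rw [h.chords_eq]; exact Finset.subset_union_left)
  obtain ⟨w, hw, hwb⟩ := h.inner.exists_below h.one_le h.lt
  have hI : ∀ c ∈ C₂.chords, Linked C.chords (relabel (outerMap p) h.root)
      (relabel (innerMap p C₁.chords.card) c) := fun c hc =>
    (((linked_relabel h.inner_strictMono).2 (h.inner.2 w hw c hc)).mono
      (by rw [h.chords_eq]; exact Finset.subset_union_right)).head
      ⟨h.outer_mem h.root_mem, h.inner_mem hw, h.intersects_root hw hwb⟩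
  have hall : ∀ c ∈ C.chords, Linked C.chords (relabel (outerMap p) h.root) c := by
    intro c hc
    rcases h.mem_iff.1 hc with ⟨c, hc', rfl⟩ | ⟨c, hc', rfl⟩
    exacts [hO c hc', hI c hc']
  exact fun c hc c' hc' => (hall c hc).symm.trans (hall c' hc')

lemma leftmost_eq_root (hne : C.chords.Nonempty) :
    leftmost C.chords hne = relabel (outerMap p) h.root :=
  (C.eq_leftmost hne (h.outer_mem h.root_mem) (by rw [h.relabel_root])).symm

lemma erase_root : C.chords.erase (relabel (outerMap p) h.root) =
    (C₁.chords.erase h.root).image (relabel (outerMap p)) ∪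
      C₂.chords.image (relabel (innerMap p C₁.chords.card)) := by
  rw [h.chords_eq, Finset.erase_union_distrib,
    Finset.image_erase (relabel_injective (strictMono_outerMap p)),
    Finset.erase_eq_of_notMem (s := C₂.chords.image _)]
  intro hc
  obtain ⟨c, hc, he⟩ := Finset.mem_image.1 hc
  exact h.outer_ne_inner h.root_mem hc he.symm

lemma leftmost_erase_root (hne : (C.chords.erase (relabel (outerMap p) h.root)).Nonempty) :
    leftmost _ hne = relabel (innerMap p C₁.chords.card) (leftmost _ h.inner.1) := by
  apply leftmost_eq
  · exact C.proper.injOn_fst.mono (by exact_mod_cast Finset.erase_subset _ _)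
  · rw [h.erase_root]
    exact Finset.mem_union_right _ (Finset.mem_image_of_mem _ (leftmost_mem _ _))
  · intro c hc
    have h1 := C.two_le_fst h.nonempty (Finset.mem_of_mem_erase hc)
      (by rw [h.leftmost_eq_root]; exact Finset.ne_of_mem_erase hc)
    have h2 := C₂.leftmost_fst h.inner.1
    have h3 := h.one_le
    simp only [relabel, h2, innerMap]
    rw [if_pos h3]
    exact h1

lemma component_erase_root (hne : (C.chords.erase (relabel (outerMap p) h.root)).Nonempty) :
    component (C.chords.erase (relabel (outerMap p) h.root)) (leftmost _ hne) = C₂.chords.image (relabel (innerMap p C₁.chords.card)) := by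
  rw [h.leftmost_erase_root]
  ext c
  rw [mem_component]
  constructor
  · rintro ⟨-, hl⟩
    refine hl.induct (P := fun u => u ∈ C₂.chords.image (relabel (innerMap p C₁.chords.card)))
      (Finset.mem_image_of_mem _ (leftmost_mem _ _)) ?_
    intro u _ v hv huv hu
    obtain ⟨u, _, rfl⟩ := Finset.mem_image.1 hu
    rw [h.erase_root] at hv
    rcases Finset.mem_union.1 hv with hv | hv
    · obtain ⟨v, hv', rfl⟩ := Finset.mem_image.1 hv
      exact absurd huv.symm (h.not_intersects (Finset.mem_of_mem_erase hv')
        (Finset.ne_of_mem_erase hv'))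
    · exact hv
  · intro hc
    have hsub : C₂.chords.image (relabel (innerMap p C₁.chords.card)) ⊆
        C.chords.erase (relabel (outerMap p) h.root) := by
      rw [h.erase_root]
      exact Finset.subset_union_right
    refine ⟨hsub hc, ?_⟩
    obtain ⟨c, hc', rfl⟩ := Finset.mem_image.1 hc
    exact ((linked_relabel h.inner_strictMono).2 (h.inner.2 _ (leftmost_mem _ _) c hc')).mono hsub

lemma nonempty_erase_root : (C.chords.erase (relabel (outerMap p) h.root)).Nonempty := by
  rw [h.erase_root]
  exact (h.inner.1.image _).inr

lemma intersectionOrder_outer :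
    intersectionOrder C₁.chords = h.root :: intersectionOrder (C₁.chords.erase h.root) :=
  intersectionOrder_of_linked _ h.outer.isLinkedSet

lemma intersectionOrder_eq : intersectionOrder C.chords = relabel (outerMap p) h.root ::
    ((intersectionOrder C₂.chords).map (relabel (innerMap p C₁.chords.card)) ++
      (intersectionOrder (C₁.chords.erase h.root)).map (relabel (outerMap p))) := by
  rw [intersectionOrder_of_linked h.nonempty h.connected.isLinkedSet, h.leftmost_eq_root,
    intersectionOrder_eq_append h.nonempty_erase_root
      (C.proper.injOn_fst.mono (by exact_mod_cast Finset.erase_subset _ _)),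
    h.component_erase_root, intersectionOrder_relabel h.inner_strictMono C₂.proper.injOn_fst]
  congr 2
  rw [← intersectionOrder_relabel (strictMono_outerMap p)
    (C₁.proper.injOn_fst.mono (by exact_mod_cast Finset.erase_subset _ _)), h.erase_root,
    Finset.union_sdiff_cancel_right]
  refine (disjoint_relabel C₁ C₂ h.outer.1 h.lt).mono_left ?_
  exact Finset.image_subset_image (Finset.erase_subset _ _)

lemma not_isTerminal_root : ¬ C.IsTerminal (relabel (outerMap p) h.root) := by
  obtain ⟨w, hw, hwb⟩ := h.inner.exists_below h.one_le h.lt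
  intro hT
  have h1 := hT _ (h.inner_mem hw) (h.intersects_root hw hwb)
  have h2 := C.one_le_fst (h.inner_mem hw)
  rw [h.relabel_root] at h1
  simp only at h1
  omega

lemma isTerminal_inner {c : ℕ × ℕ} (hc : c ∈ C₂.chords) :
    C.IsTerminal (relabel (innerMap p C₁.chords.card) c) ↔ C₂.IsTerminal c := by
  constructor
  · intro hT c' hc' hi
    exact h.inner_strictMono.lt_iff_lt.1 (hT _ (h.inner_mem hc')
      ((intersects_relabel h.inner_strictMono).2 hi))
  · intro hT c' hc' hi
    rcases h.mem_iff.1 hc' with ⟨c', hc1, rfl⟩ | ⟨c', hc1, rfl⟩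
    · by_cases hr : c' = h.root
      · subst hr
        have h4 := C.two_le_fst h.nonempty (h.inner_mem hc)
          (by rw [h.leftmost_eq_root]; exact (h.outer_ne_inner h.root_mem hc).symm)
        rw [h.relabel_root]
        exact h4
      · exact absurd hi.symm (h.not_intersects hc1 hr)
    · exact h.inner_strictMono (hT _ hc1 ((intersects_relabel h.inner_strictMono).1 hi))

lemma isTerminal_outer {c : ℕ × ℕ} (hc : c ∈ C₁.chords) (hne : c ≠ h.root) :
    C.IsTerminal (relabel (outerMap p) c) ↔ C₁.IsTerminal c := by
  have hs := strictMono_outerMap p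
  constructor
  · intro hT c' hc' hi
    exact hs.lt_iff_lt.1 (hT _ (h.outer_mem hc') ((intersects_relabel hs).2 hi))
  · intro hT c' hc' hi
    rcases h.mem_iff.1 hc' with ⟨c', hc1, rfl⟩ | ⟨c', hc1, rfl⟩
    · exact hs (hT _ hc1 ((intersects_relabel hs).1 hi))
    · exact absurd hi (h.not_intersects hc hne)

/-- The endpoints of the part of an insertion that comes from the inner diagram. -/
lemma pts_inner : pts (C₂.chords.image (relabel (innerMap p C₁.chords.card))) =
    Finset.Icc 2 (p + 1) ∪ Finset.Icc (p + 2 * C₁.chords.card + 1) (2 * C.chords.card) := by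
  rw [pts_image_relabel, C₂.pts_chords, image_innerMap h.lt, h.card_eq, mul_add, add_comm (2 * _)]

omit h in
lemma _root_.ChordLog.ChordDiagram.ext_of_image {C C' : ChordDiagram} {f : ℕ → ℕ}
    (hf : StrictMono f) (h : C.chords.image (relabel f) = C'.chords.image (relabel f)) : C = C' :=
  ChordDiagram.ext (Finset.image_injective (relabel_injective hf) h)

/-- The data of an insertion are determined by its result. -/
lemma unique {C₁' C₂' : ChordDiagram} {p' : ℕ} (h' : IsInsertion C C₁' C₂' p') :
    C₁ = C₁' ∧ C₂ = C₂' ∧ p = p' := by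
  have hroot : relabel (outerMap p) h.root = relabel (outerMap p') h'.root := by
    rw [← h.leftmost_eq_root h.nonempty, ← h'.leftmost_eq_root h.nonempty]
  have hI : C₂.chords.image (relabel (innerMap p C₁.chords.card)) =
      C₂'.chords.image (relabel (innerMap p' C₁'.chords.card)) := by
    rw [← h.component_erase_root h.nonempty_erase_root,
      ← h'.component_erase_root h'.nonempty_erase_root]
    simp only [hroot]
  have hn2 : C₂.chords.card = C₂'.chords.card := by
    rw [← Finset.card_image_of_injective _ (relabel_injective h.inner_strictMono), hI,
      Finset.card_image_of_injective _ (relabel_injective h'.inner_strictMono)]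
  have hn1 : C₁.chords.card = C₁'.chords.card := by
    have := h.card_eq
    have := h'.card_eq
    omega
  have hp : p = p' := by
    have h1 := h.pts_inner
    rw [hI, h'.pts_inner, ← hn1] at h1
    have hpos := h.outer.1.card_pos
    have e1 := Finset.ext_iff.1 h1 (p + 2)
    have e2 := Finset.ext_iff.1 h1 (p' + 2)
    simp only [Finset.mem_union, Finset.mem_Icc] at e1 e2
    omega
  subst hp
  have hO : C₁.chords.image (relabel (outerMap p)) = C₁'.chords.image (relabel (outerMap p)) := by
    have e1 := Finset.union_sdiff_cancel_right (disjoint_relabel C₁ C₂ h.outer.1 h.lt)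
    have e2 := Finset.union_sdiff_cancel_right (disjoint_relabel C₁' C₂' h'.outer.1 h'.lt)
    rw [← h.chords_eq] at e1
    rw [← h'.chords_eq] at e2
    rw [← e1, ← e2, hI]
  rw [← hn1] at hI
  exact ⟨ChordDiagram.ext_of_image (strictMono_outerMap p) hO,
    ChordDiagram.ext_of_image h.inner_strictMono hI, rfl⟩

end IsInsertion

/-! ### Every connected diagram with at least two chords is an insertion -/

lemma exists_relabel_eq {S : Finset (ℕ × ℕ)} (hS : Proper S) {f : ℕ → ℕ} (hf : StrictMono f)
    (hpts : pts S = (Finset.Icc 1 (2 * S.card)).image f) :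
    ∃ C : ChordDiagram, C.chords.image (relabel f) = S := by
  have hsub : (S : Set (ℕ × ℕ)) ⊆ relabel f '' Set.univ := by
    intro c hc
    have h1 := fst_mem_pts hc
    have h2 := snd_mem_pts hc
    rw [hpts] at h1 h2
    obtain ⟨x, _, hx⟩ := Finset.mem_image.1 h1
    obtain ⟨y, _, hy⟩ := Finset.mem_image.1 h2
    exact ⟨(x, y), trivial, by simp [relabel, hx, hy]⟩
  obtain ⟨T, -, rfl⟩ := Finset.subset_set_image_iff.1 hsub
  refine ⟨⟨T, fun c hc => ?_, ?_⟩, rfl⟩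
  · exact hf.lt_iff_lt.1 (hS.lt _ (Finset.mem_image_of_mem _ hc))
  · rw [pts_image_relabel, Finset.card_image_of_injective _ (relabel_injective hf)] at hpts
    exact Finset.image_injective hf.injective hpts

lemma ChordDiagram.Connected.exists_isInsertion {C : ChordDiagram} (hC : C.Connected)
    (hcard : 2 ≤ C.chords.card) : ∃ C₁ C₂ p, IsInsertion C C₁ C₂ p := by
  set r := leftmost C.chords hC.1 with hr
  have hrm : r ∈ C.chords := leftmost_mem _ _
  have hr1 : r.1 = 1 := leftmost_fst _
  have hr2 := C.fst_lt_snd r hrm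
  set S := C.chords.erase r with hS
  have hScard : S.card = C.chords.card - 1 := Finset.card_erase_of_mem hrm
  have hSne : S.Nonempty := Finset.card_pos.1 (by omega)
  set l := leftmost S hSne with hl
  have hlS : l ∈ S := leftmost_mem _ _
  set D := component S l with hD
  have hlD : l ∈ D := leftmost_mem_component S hSne
  have hDS : D ⊆ S := component_subset S l
  have hDC : D ⊆ C.chords := hDS.trans (Finset.erase_subset _ _)
  have hrD : r ∉ D := fun hc => Finset.notMem_erase r _ (hDS hc)
  set E := C.chords \ D with hE
  have hEC : E ⊆ C.chords := Finset.sdiff_subset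
  have hrE : r ∈ E := Finset.mem_sdiff.2 ⟨hrm, hrD⟩
  have hlt := C.fst_lt_snd
  have hDclosed : ∀ u ∈ D, ∀ v ∈ C.chords, v ≠ r → Intersects u v → v ∈ D := by
    intro u hu v hv hvr huv
    rw [hD, mem_component] at hu ⊢
    have hvS : v ∈ S := Finset.mem_erase.2 ⟨hvr, hv⟩
    exact ⟨hvS, hu.2.tail ⟨hu.1, hvS, huv⟩⟩
  -- a chord of the inner component crosses the root
  obtain ⟨w, hwD, hw1, hw2⟩ : ∃ w ∈ D, w.1 < r.2 ∧ r.2 < w.2 := by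
    by_contra! hcon
    refine hrD ((hC.2 l (hDC hlD) r hrm).induct (P := fun u => u ∈ D) hlD ?_)
    intro u _ v hv huv hu
    refine hDclosed u hu v hv ?_ huv
    rintro rfl
    have h1 := hcon u hu
    have h2 := C.two_le_fst hC.1 (hDC hu) (fun h => hrD (hr.trans h.symm ▸ hu))
    have h3 := hlt u (hDC hu)
    rcases huv with huv | huv <;> unfold Crosses at huv <;> omega
  have hlmin : ∀ c ∈ S, l.1 ≤ c.1 := fun c hc => leftmost_le S hSne hc
  have hS2 : ∀ c ∈ S, 2 ≤ c.1 := fun c hc =>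
    C.two_le_fst hC.1 (Finset.mem_of_mem_erase hc) (Finset.ne_of_mem_erase hc)
  have hl2 : l.1 = 2 := by
    obtain ⟨c, hc, hcx⟩ := C.exists_of_mem_Icc (x := 2) (by omega) (by omega)
    have h1 := hS2 w (hDS hwD)
    have hcr : c ≠ r := by rintro rfl; omega
    have hcS : c ∈ S := Finset.mem_erase.2 ⟨hcr, hc⟩
    have h2 := hlmin c hcS
    have h3 := hS2 l hlS
    have h4 := hlt c hc
    have h5 := hS2 c hcS
    omega
  -- a chord outside the component does not go over its endpoints
  have hout : ∀ e ∈ E, e ≠ r → ∀ u ∈ D, (u.1 < e.1 ∨ e.2 < u.1) ∧ (u.2 < e.1 ∨ e.2 < u.2) := by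
    intro e he her u hu
    have heC := hEC he
    have heD : e ∉ D := (Finset.mem_sdiff.1 he).2
    have heS : e ∈ S := Finset.mem_erase.2 ⟨her, heC⟩
    have hni : ∀ v ∈ D, ¬ Intersects v e := fun v hv hi => heD (hDclosed v hv e heC her hi)
    have hne : ∀ v ∈ D, v.1 ≠ e.1 ∧ v.2 ≠ e.2 := fun v hv =>
      ⟨fun h => heD (C.proper.fst_inj v (hDC hv) e heC h ▸ hv),
        fun h => heD (C.proper.snd_inj v (hDC hv) e heC h ▸ hv)⟩
    have hne' : ∀ v ∈ D, v.1 ≠ e.2 ∧ v.2 ≠ e.1 := fun v hv =>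
      ⟨C.proper.fst_ne_snd v (hDC hv) e heC, (C.proper.fst_ne_snd e heC v (hDC hv)).symm⟩
    have hlink := (mem_component.1 hu).2
    have hkey := (hlink.induct (P := fun v => v ∈ D ∧ ¬ (e.1 < v.1 ∧ v.2 < e.2)) ?_ ?_)
    · have h1 := hni u hu
      have h2 := hne u hu
      have h3 := hne' u hu
      have h4 := hlt u (hDC hu)
      have h5 := hlt e heC
      unfold Intersects Crosses at h1
      omega
    · have h1 := hni l hlD
      have h2 := hne l hlD
      have h3 := hlmin e heS
      exact ⟨hlD, by omega⟩
    · rintro x hx y hy hxy ⟨hxD, hx'⟩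
      have hyD : y ∈ D := hDclosed x hxD y (Finset.mem_of_mem_erase hy)
        (Finset.ne_of_mem_erase hy) hxy
      refine ⟨hyD, fun hcon => ?_⟩
      have h1 := hni x hxD
      have h2 := hne x hxD
      have h3 := hne' x hxD
      have h4 := hlt x (hDC hxD)
      unfold Intersects Crosses at h1 hxy
      omega
  -- endpoints of the component do not separate the other endpoints after the first
  have hsep : ∀ d ∈ pts D, ∀ e ∈ E, e ≠ r → (d < r.2 → d < e.1) ∧ (r.2 < d → e.2 < d) := by
    intro d hd e he her
    obtain ⟨u, hu, hud⟩ := mem_pts.1 hd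
    have hoe : ∀ f ∈ E, f ≠ r → d < f.1 ∨ f.2 < d := by
      intro f hf hfr
      have := hout f hf hfr u hu
      omega
    have hEstep : ∀ x ∈ E, x ≠ r → ∀ y ∈ C.chords, y ≠ r → Intersects x y → y ∈ E := by
      intro x hx hxr y hy hyr hxy
      refine Finset.mem_sdiff.2 ⟨hy, fun hyD => ?_⟩
      exact (Finset.mem_sdiff.1 hx).2 (hDclosed y hyD x (hEC hx) hxr hxy.symm)
    constructor
    · intro hdr
      by_contra hcon
      refine ((hC.2 e (hEC he) r hrm).induct
        (P := fun x => x ∈ E ∧ x ≠ r ∧ x.2 < d) ?_ ?_).2.1 rfl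
      · exact ⟨he, her, by have := hoe e he her; omega⟩
      · rintro x hx y hy hxy ⟨hxE, hxr, hxd⟩
        have h2 := hS2 x (Finset.mem_erase.2 ⟨hxr, hx⟩)
        have hyr : y ≠ r := by
          rintro rfl
          have h1 := hlt x hx
          rcases hxy with hxy | hxy <;> unfold Crosses at hxy <;> omega
        have hyE := hEstep x hxE hxr y hy hyr hxy
        refine ⟨hyE, hyr, ?_⟩
        have h3 := hoe y hyE hyr
        rcases hxy with hxy | hxy <;> unfold Crosses at hxy <;> omega
    · intro hdr
      by_contra hcon
      refine ((hC.2 e (hEC he) r hrm).induct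
        (P := fun x => x ∈ E ∧ x ≠ r ∧ d < x.1) ?_ ?_).2.1 rfl
      · exact ⟨he, her, by have := hoe e he her; omega⟩
      · rintro x hx y hy hxy ⟨hxE, hxr, hxd⟩
        have hyr : y ≠ r := by
          rintro rfl
          have h1 := hlt x hx
          rcases hxy with hxy | hxy <;> unfold Crosses at hxy <;> omega
        have hyE := hEstep x hxE hxr y hy hyr hxy
        refine ⟨hyE, hyr, ?_⟩
        have h3 := hoe y hyE hyr
        rcases hxy with hxy | hxy <;> unfold Crosses at hxy <;> omega
  -- the points next to the right end of the root in the component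
  have hDE : D ∪ E = C.chords := Finset.union_sdiff_of_subset hDC
  have hdisj : Disjoint (pts D) (pts E) :=
    C.proper.disjoint_pts hDC hEC Finset.disjoint_sdiff
  have hunion : ∀ x, x ∈ pts D ∨ x ∈ pts E ↔ 1 ≤ x ∧ x ≤ 2 * C.chords.card := by
    intro x
    rw [← Finset.mem_union, ← pts_union, hDE, C.pts_chords, Finset.mem_Icc]
  rw [Finset.disjoint_left] at hdisj
  obtain ⟨P, hP, hPmax⟩ := ((pts D).filter (· < r.2)).exists_max_image id
    ⟨w.1, Finset.mem_filter.2 ⟨fst_mem_pts hwD, hw1⟩⟩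
  obtain ⟨Q, hQ, hQmin⟩ := ((pts D).filter (r.2 < ·)).exists_min_image id
    ⟨w.2, Finset.mem_filter.2 ⟨snd_mem_pts hwD, hw2⟩⟩
  rw [Finset.mem_filter] at hP hQ
  obtain ⟨hPD, hPr⟩ := hP
  obtain ⟨hQD, hQr⟩ := hQ
  have hPmax' : ∀ x ∈ pts D, x < r.2 → x ≤ P := fun x hx hx' =>
    hPmax x (Finset.mem_filter.2 ⟨hx, hx'⟩)
  have hQmin' : ∀ x ∈ pts D, r.2 < x → Q ≤ x := fun x hx hx' =>
    hQmin x (Finset.mem_filter.2 ⟨hx, hx'⟩)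
  have hEpts : ∀ x ∈ pts E, x = 1 ∨ (P < x ∧ x < Q) := by
    intro x hx
    obtain ⟨e, he, hex⟩ := mem_pts.1 hx
    by_cases her : e = r
    · subst her
      omega
    · have h1 := (hsep P hPD e he her).1 hPr
      have h2 := (hsep Q hQD e he her).2 hQr
      have h3 := hlt e (hEC he)
      omega
  have h1E : 1 ∈ pts E := hr1 ▸ fst_mem_pts hrE
  have hrE2 : r.2 ∈ pts E := snd_mem_pts hrE
  have h2D : 2 ∈ pts D := hl2 ▸ fst_mem_pts hlD
  have hP2 : 2 ≤ P := hPmax' 2 h2D (by have := hS2 w (hDS hwD); omega)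
  have hQle : Q ≤ 2 * C.chords.card := ((hunion Q).1 (Or.inl hQD)).2
  have hptsE : pts E = insert 1 (Finset.Icc (P + 1) (Q - 1)) := by
    ext x
    simp only [Finset.mem_insert, Finset.mem_Icc]
    constructor
    · intro hx
      have := hEpts x hx
      omega
    · rintro (rfl | hx)
      · exact h1E
      · refine ((hunion x).2 (by omega)).resolve_left fun hxD => ?_
        rcases lt_trichotomy x r.2 with h | h | h
        · have := hPmax' x hxD h
          omega
        · exact hdisj hxD (h ▸ hrE2)
        · have := hQmin' x hxD h
          omega
  have hptsD : pts D = Finset.Icc 2 P ∪ Finset.Icc Q (2 * C.chords.card) := by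
    ext x
    simp only [Finset.mem_union, Finset.mem_Icc]
    constructor
    · intro hx
      have h1 := (hunion x).1 (Or.inl hx)
      have h2 : x ≠ 1 := by rintro rfl; exact hdisj hx h1E
      have h3 : x ≠ r.2 := fun h => hdisj hx (h ▸ hrE2)
      rcases lt_or_gt_of_ne h3 with h | h
      · have := hPmax' x hx h
        omega
      · have := hQmin' x hx h
        omega
    · intro hx
      refine ((hunion x).2 (by omega)).resolve_right fun hxE => ?_
      have := hEpts x hxE
      omega
  have hcardE : 2 * E.card = 1 + (Q - 1 - P) := by
    rw [← (C.proper.subset hEC).card_pts, hptsE, Finset.card_insert_of_notMem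
      (by simp only [Finset.mem_Icc]; omega), Nat.card_Icc]
    omega
  have hEpos : 0 < E.card := Finset.card_pos.2 ⟨r, hrE⟩
  have hcardsum : D.card + E.card = C.chords.card := by
    rw [← hDE, Finset.card_union_of_disjoint Finset.disjoint_sdiff]
  have hDpos : 0 < D.card := Finset.card_pos.2 ⟨l, hlD⟩
  obtain ⟨C₁, hC₁⟩ := exists_relabel_eq (C.proper.subset hEC) (strictMono_outerMap (P - 1)) (by
    rw [image_outerMap hEpos, hptsE]
    congr 2 <;> omega)
  obtain ⟨C₂, hC₂⟩ := exists_relabel_eq (C.proper.subset hDC)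
    (strictMono_innerMap (P - 1) hEpos) (by
    rw [image_innerMap (by omega), hptsD]
    congr 2 <;> omega)
  have hc1 : C₁.chords.card = E.card := by
    rw [← hC₁, Finset.card_image_of_injective _ (relabel_injective (strictMono_outerMap _))]
  have hc2 : C₂.chords.card = D.card := by
    rw [← hC₂, Finset.card_image_of_injective _ (relabel_injective (strictMono_innerMap _ hEpos))]
  refine ⟨C₁, C₂, P - 1, ⟨?_, ?_⟩, ⟨?_, ?_⟩, by omega, by omega, ?_⟩
  · exact Finset.card_pos.1 (by omega)
  · change IsLinkedSet _
    rw [← isLinkedSet_relabel (strictMono_outerMap (P - 1)), hC₁]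
    have hall : ∀ e ∈ E, Linked E e r := by
      intro e he
      have hlink := hC.2 e (hEC he) r hrm
      -- follow the chain up to its first visit of the root
      have : Linked E e r ∨ (r ∈ E ∧ r ≠ r ∧ Linked E e r) := by
        refine hlink.induct (P := fun x => Linked E e r ∨ (x ∈ E ∧ x ≠ r ∧ Linked E e x)) ?_ ?_
        · by_cases her : e = r
          · exact Or.inl (her ▸ Relation.ReflTransGen.refl)
          · exact Or.inr ⟨he, her, Relation.ReflTransGen.refl⟩
        · rintro x hx y hy hxy (h | ⟨hxE, hxr, hxl⟩)
          · exact Or.inl h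
          · have hyE : y ∈ E := by
              refine Finset.mem_sdiff.2 ⟨hy, fun hyD => ?_⟩
              exact (Finset.mem_sdiff.1 hxE).2 (hDclosed y hyD x hx hxr hxy.symm)
            have hyl : Linked E e y := hxl.tail ⟨hxE, hyE, hxy⟩
            by_cases hyr : y = r
            · exact Or.inl (hyr ▸ hyl)
            · exact Or.inr ⟨hyE, hyr, hyl⟩
      rcases this with h | h
      exacts [h, h.2.2]
    exact fun u hu v hv => (hall u hu).trans (hall v hv).symm
  · exact Finset.card_pos.1 (by omega)
  · change IsLinkedSet _
    rw [← isLinkedSet_relabel (strictMono_innerMap (P - 1) hEpos), hC₂]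
    exact isLinkedSet_component S l
  · rw [hc1, hC₁, hC₂, Finset.union_comm, hDE]

/-! ### Covering numbers -/

lemma idxOf_map_of_injective {α β : Type*} [BEq α] [LawfulBEq α] [BEq β]
    [LawfulBEq β] {f : α → β}
    (hf : Function.Injective f) (l : List α) (x : α) : (l.map f).idxOf (f x) = l.idxOf x := by
  induction l with
  | nil => rfl
  | cons y l ih =>
    rw [List.map_cons]
    by_cases h : y = x
    · subst h
      rw [List.idxOf_cons_self, List.idxOf_cons_self]
    · rw [List.idxOf_cons_ne _ h, List.idxOf_cons_ne _ (fun h' => h (hf h')), ih]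

namespace ChordDiagram

/-- The chord `c` is the last chord of `C` above the `q`-th interval. -/
def Covers (C : ChordDiagram) (q : ℕ) (c : ℕ × ℕ) : Prop :=
  Below q c ∧ ∀ c' ∈ C.chords, Below q c' → C.position c' ≤ C.position c

variable {C : ChordDiagram}

lemma mem_coveredIntervals {c : ℕ × ℕ} {q : ℕ} :
    q ∈ C.coveredIntervals c ↔ (1 ≤ q ∧ q < 2 * C.chords.card) ∧ C.Covers q c := by
  classical
  simp [coveredIntervals, Covers, and_assoc]

lemma position_inj {c c' : ℕ × ℕ} (hc : c ∈ C.chords) (h : C.position c = C.position c') :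
    c = c' := by
  rw [position, position, Nat.succ_inj] at h
  exact (List.idxOf_inj (mem_intersectionOrder.2 hc)).1 h

lemma Covers.unique {c c' : ℕ × ℕ} {q : ℕ} (hc : c ∈ C.chords) (hc' : c' ∈ C.chords)
    (h : C.Covers q c) (h' : C.Covers q c') : c = c' :=
  position_inj hc (le_antisymm (h'.2 c hc h.1) (h.2 c' hc' h'.1))

lemma Connected.exists_covers (hC : C.Connected) {q : ℕ} (h1 : 1 ≤ q)
    (h2 : q < 2 * C.chords.card) : ∃ c ∈ C.chords, C.Covers q c := by
  classical
  obtain ⟨c, hc, hcb⟩ := hC.exists_below h1 h2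
  obtain ⟨m, hm, hmax⟩ := (C.chords.filter (Below q)).exists_max_image C.position
    ⟨c, Finset.mem_filter.2 ⟨hc, hcb⟩⟩
  rw [Finset.mem_filter] at hm
  exact ⟨m, hm.1, hm.2, fun c' hc' hb => hmax c' (Finset.mem_filter.2 ⟨hc', hb⟩)⟩

/-- A diagram with one chord. -/
lemma eq_of_card_eq_one (h : C.chords.card = 1) : C.chords = {(1, 2)} := by
  obtain ⟨c, hc⟩ := Finset.card_eq_one.1 h
  have hm : c ∈ C.chords := hc ▸ Finset.mem_singleton_self c
  have h1 := one_le_fst hm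
  have h2 := snd_le hm
  have h3 := C.fst_lt_snd c hm
  rw [hc, Finset.singleton_inj]
  exact Prod.ext (by simp only; omega) (by simp only; omega)

lemma coveredIntervals_of_card_eq_one (h : C.chords.card = 1) :
    C.coveredIntervals (1, 2) = {1} := by
  ext q
  rw [mem_coveredIntervals, h, Finset.mem_singleton]
  constructor
  · rintro ⟨hq, -⟩
    omega
  · rintro rfl
    refine ⟨by omega, ⟨le_rfl, by norm_num⟩, ?_⟩
    intro c' hc' _
    rw [eq_of_card_eq_one h, Finset.mem_singleton] at hc'
    rw [hc']

end ChordDiagram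

namespace IsInsertion

open ChordDiagram

variable {C C₁ C₂ : ChordDiagram} {p : ℕ} (h : IsInsertion C C₁ C₂ p)
include h

lemma position_root : C.position (relabel (outerMap p) h.root) = 1 := by
  rw [position, h.intersectionOrder_eq, List.idxOf_cons_self]

lemma position_outer_root : C₁.position h.root = 1 := by
  rw [position, h.intersectionOrder_outer, List.idxOf_cons_self]

lemma position_inner {c : ℕ × ℕ} (hc : c ∈ C₂.chords) :
    C.position (relabel (innerMap p C₁.chords.card) c) = C₂.position c + 1 := by
  rw [position, position, h.intersectionOrder_eq,
    List.idxOf_cons_ne _ (h.outer_ne_inner h.root_mem hc),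
    List.idxOf_append_of_mem (List.mem_map_of_mem (mem_intersectionOrder.2 hc)),
    idxOf_map_of_injective (relabel_injective h.inner_strictMono)]

lemma position_outer {c : ℕ × ℕ} (hc : c ∈ C₁.chords) (hne : c ≠ h.root) :
    C.position (relabel (outerMap p) c) = C₁.position c + C₂.chords.card := by
  have hinj := relabel_injective (strictMono_outerMap p)
  rw [position, position, h.intersectionOrder_eq, h.intersectionOrder_outer,
    List.idxOf_cons_ne _ (fun he => hne (hinj he).symm), List.idxOf_cons_ne _ (Ne.symm hne),
    List.idxOf_append_of_notMem, idxOf_map_of_injective hinj, List.length_map,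
    length_intersectionOrder]
  · omega
  · intro hm
    obtain ⟨c', hc', he⟩ := List.mem_map.1 hm
    exact h.outer_ne_inner hc (mem_intersectionOrder.1 hc') he.symm

lemma position_inner_le {c : ℕ × ℕ} (hc : c ∈ C₂.chords) :
    C.position (relabel (innerMap p C₁.chords.card) c) ≤ C₂.chords.card + 1 := by
  rw [h.position_inner hc, position, ← length_intersectionOrder]
  have := List.idxOf_lt_length_iff.2 (mem_intersectionOrder.2 hc)
  omega

lemma lt_position_outer {c : ℕ × ℕ} (hc : c ∈ C₁.chords) (hne : c ≠ h.root) :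
    C₂.chords.card + 1 < C.position (relabel (outerMap p) c) := by
  rw [h.position_outer hc hne]
  have h1 : C₁.position c ≠ 1 := fun he =>
    hne (position_inj hc (he.trans h.position_outer_root.symm))
  have h2 : 1 ≤ C₁.position c := by unfold position; omega
  omega

lemma position_outer_le_iff {c c' : ℕ × ℕ} (hc : c ∈ C₁.chords) (hc' : c' ∈ C₁.chords) :
    C.position (relabel (outerMap p) c) ≤ C.position (relabel (outerMap p) c') ↔
      C₁.position c ≤ C₁.position c' := by
  have h1 : ∀ x, 1 ≤ C₁.position x := fun x => by unfold position; omega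
  have r1 := h.position_root
  have r2 := h.position_outer_root
  have h3 := h1 c
  have h4 := h1 c'
  by_cases hr : c = h.root <;> by_cases hr' : c' = h.root
  · rw [hr, hr']
    simp
  · have h5 := h.position_outer hc' hr'
    rw [hr]
    omega
  · have h5 := h.lt_position_outer hc hr
    have h6 : C₁.position c ≠ 1 := fun he =>
      hr (position_inj hc (he.trans h.position_outer_root.symm))
    rw [hr']
    omega
  · rw [h.position_outer hc hr, h.position_outer hc' hr']
    omega

/-- Intervals of the insertion that are below the chords of the inner diagram only (and possibly
the root). -/
lemma covers_inner_iff {x q : ℕ} (h1 : ∀ c ∈ C₂.chords,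
      (Below x (relabel (innerMap p C₁.chords.card) c) ↔ Below q c))
    (h2 : ∀ c ∈ C₁.chords, c ≠ h.root → ¬ Below x (relabel (outerMap p) c))
    {c : ℕ × ℕ} (hc : c ∈ C₂.chords) :
    C.Covers x (relabel (innerMap p C₁.chords.card) c) ↔ C₂.Covers q c := by
  unfold Covers
  rw [h1 c hc]
  refine and_congr_right fun _ => ⟨fun hx c' hc' hb => ?_, fun hx c' hc' hb => ?_⟩
  · have := hx _ (h.inner_mem hc') ((h1 c' hc').2 hb)
    rw [h.position_inner hc, h.position_inner hc'] at this
    omega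
  · rcases h.mem_iff.1 hc' with ⟨c', hc1, rfl⟩ | ⟨c', hc1, rfl⟩
    · by_cases hr : c' = h.root
      · rw [hr, h.position_root, h.position_inner hc]
        omega
      · exact absurd hb (h2 c' hc1 hr)
    · rw [h.position_inner hc, h.position_inner hc1]
      have := hx c' hc1 ((h1 c' hc1).1 hb)
      omega

lemma not_covers_outer {x q : ℕ} (h1 : ∀ c ∈ C₂.chords,
      (Below x (relabel (innerMap p C₁.chords.card) c) ↔ Below q c))
    (h2 : ∀ c ∈ C₁.chords, c ≠ h.root → ¬ Below x (relabel (outerMap p) c))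
    (hq : 1 ≤ q) (hq' : q < 2 * C₂.chords.card) {c : ℕ × ℕ} (hc : c ∈ C₁.chords) :
    ¬ C.Covers x (relabel (outerMap p) c) := by
  intro hx
  by_cases hr : c = h.root
  · obtain ⟨w, hw, hwb⟩ := h.inner.exists_below hq hq'
    have h3 := hx.2 _ (h.inner_mem hw) ((h1 w hw).2 hwb)
    rw [hr, h.position_root, h.position_inner hw, position] at h3
    omega
  · exact h2 c hc hr hx.1

omit h in
lemma below_inner {c : ℕ × ℕ} {m : ℕ} (hm : 0 < m) (q : ℕ) :
    Below (innerMap p m q) (relabel (innerMap p m) c) ↔ Below q c := by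
  have hs := strictMono_innerMap p hm
  simp only [Below, relabel, hs.le_iff_le, hs.lt_iff_lt]

omit h in
lemma below_inner_last {c : ℕ × ℕ} {m : ℕ} (hm : 0 < m) :
    Below (p + 2 * m) (relabel (innerMap p m) c) ↔ Below p c := by
  simp only [Below, relabel, innerMap]
  split_ifs <;> omega

lemma not_below_outer {x : ℕ} (hx : x ≤ p + 1 ∨ p + 2 * C₁.chords.card ≤ x) :
    ∀ c ∈ C₁.chords, c ≠ h.root → ¬ Below x (relabel (outerMap p) c) := by
  intro c hc hne
  have h1 := C₁.two_le_fst h.outer.1 hc hne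
  have h3 := C₁.snd_le hc
  rw [h.relabel_outer hc hne]
  simp only [Below]
  omega

omit h in
lemma innerMap_bound (m q : ℕ) : innerMap p m q ≤ p + 1 ∨ p + 2 * m ≤ innerMap p m q := by
  unfold innerMap
  split_ifs <;> omega

lemma covers_outer_iff {q : ℕ} (hq : 2 ≤ q) (hq' : q < 2 * C₁.chords.card) {c : ℕ × ℕ}
    (hc : c ∈ C₁.chords) :
    C.Covers (outerMap p q) (relabel (outerMap p) c) ↔ C₁.Covers q c := by
  have hs := strictMono_outerMap p
  have hb : ∀ c, Below (outerMap p q) (relabel (outerMap p) c) ↔ Below q c := fun c => by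
    simp only [Below, relabel, hs.le_iff_le, hs.lt_iff_lt]
  unfold Covers
  rw [hb]
  refine and_congr_right fun _ => ⟨fun hx c' hc' hb' => ?_, fun hx c' hc' hb' => ?_⟩
  · exact (h.position_outer_le_iff hc' hc).1 (hx _ (h.outer_mem hc') ((hb c').2 hb'))
  · rcases h.mem_iff.1 hc' with ⟨c', hc1, rfl⟩ | ⟨c', hc1, rfl⟩
    · exact (h.position_outer_le_iff hc1 hc).2 (hx c' hc1 ((hb c').1 hb'))
    · obtain ⟨w, hw, hwr, hwb⟩ := h.outer.exists_below_ne hq hq'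
      have h1 := (h.position_outer_le_iff hw hc).2 (hx w hw hwb)
      have h2 := h.lt_position_outer hw hwr
      have h3 := h.position_inner_le hc1
      omega

lemma not_covers_inner {q : ℕ} (hq : 2 ≤ q) (hq' : q < 2 * C₁.chords.card) {c : ℕ × ℕ}
    (hc : c ∈ C₂.chords) :
    ¬ C.Covers (outerMap p q) (relabel (innerMap p C₁.chords.card) c) := by
  intro hx
  have hs := strictMono_outerMap p
  obtain ⟨w, hw, hwr, hwb⟩ := h.outer.exists_below_ne hq hq'
  have h1 := hx.2 _ (h.outer_mem hw) (by
    simpa only [Below, relabel, hs.le_iff_le, hs.lt_iff_lt] using hwb)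
  have h2 := h.lt_position_outer hw hwr
  have h3 := h.position_inner_le hc
  omega

lemma not_below_one {c : ℕ × ℕ} (hc : c ∈ C.chords) (hne : c ≠ relabel (outerMap p) h.root) :
    ¬ Below 1 c := by
  have := C.two_le_fst h.nonempty hc (by rwa [h.leftmost_eq_root])
  unfold Below
  omega

lemma covers_one_iff {c : ℕ × ℕ} (hc : c ∈ C₁.chords) :
    C.Covers 1 (relabel (outerMap p) c) ↔ C₁.Covers 1 c := by
  have hinj := relabel_injective (strictMono_outerMap p)
  have h1 := h.root_fst
  have h2 := C₁.fst_lt_snd _ h.root_mem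
  have hb : ∀ c' ∈ C₁.chords, Below 1 c' → c' = h.root := by
    intro c' hc' hb
    by_contra hr
    have := C₁.two_le_fst h.outer.1 hc' hr
    unfold Below at hb
    omega
  by_cases hr : c = h.root
  · subst hr
    refine iff_of_true ⟨?_, ?_⟩ ⟨?_, ?_⟩
    · rw [h.relabel_root]
      simp only [Below]
      omega
    · intro c' hc' hb'
      by_contra hlt
      exact h.not_below_one hc' (by rintro rfl; exact hlt le_rfl) hb'
    · unfold Below
      omega
    · intro c' hc' hb'
      rw [hb c' hc' hb']
  · refine iff_of_false (fun hx => ?_) (fun hx => hr (hb c hc hx.1))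
    exact h.not_below_one (h.outer_mem hc) (fun he => hr (hinj he)) hx.1

lemma coveredIntervals_outer {c : ℕ × ℕ} (hc : c ∈ C₁.chords) :
    C.coveredIntervals (relabel (outerMap p) c) =
      (C₁.coveredIntervals c).image (outerMap p) := by
  have hm := h.outer.1.card_pos
  have hn := h.inner.1.card_pos
  have hlt := h.lt
  have hp := h.one_le
  ext x
  rw [mem_coveredIntervals, Finset.mem_image, h.card_eq]
  constructor
  · rintro ⟨hx, hcov⟩
    by_cases h1 : x = 1
    · subst h1
      exact ⟨1, mem_coveredIntervals.2 ⟨by omega, (h.covers_one_iff hc).1 hcov⟩, rfl⟩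
    by_cases h2 : p + 2 ≤ x ∧ x < p + 2 * C₁.chords.card
    · have hxq : outerMap p (x - p) = x := by unfold outerMap; split_ifs <;> omega
      refine ⟨x - p, mem_coveredIntervals.2 ⟨by omega, ?_⟩, hxq⟩
      rw [← h.covers_outer_iff (by omega) (by omega) hc, hxq]
      exact hcov
    by_cases h3 : x = p + 2 * C₁.chords.card
    · subst h3
      exact absurd hcov (h.not_covers_outer (fun c _ => below_inner_last hm)
        (h.not_below_outer (Or.inr le_rfl)) hp hlt hc)
    · exfalso
      obtain ⟨q, hq1, hq2, rfl⟩ : ∃ q, 1 ≤ q ∧ q < 2 * C₂.chords.card ∧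
          innerMap p C₁.chords.card q = x := by
        by_cases h4 : x ≤ p + 1
        · exact ⟨x - 1, by omega, by omega, by unfold innerMap; split_ifs <;> omega⟩
        · exact ⟨x - 2 * C₁.chords.card, by omega, by omega,
            by unfold innerMap; split_ifs <;> omega⟩
      exact absurd hcov (h.not_covers_outer (fun c _ => below_inner hm q)
        (h.not_below_outer (innerMap_bound _ q)) hq1 hq2 hc)
  · rintro ⟨q, hq, rfl⟩
    obtain ⟨hq, hcov⟩ := mem_coveredIntervals.1 hq
    have hb : 1 ≤ outerMap p q ∧
        outerMap p q < 2 * (C₁.chords.card + C₂.chords.card) := by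
      unfold outerMap
      split_ifs <;> omega
    refine ⟨hb, ?_⟩
    by_cases h1 : q = 1
    · subst h1
      exact (h.covers_one_iff hc).2 hcov
    · exact (h.covers_outer_iff (by omega) (by omega) hc).2 hcov

open Classical in
lemma coveredIntervals_inner {c : ℕ × ℕ} (hc : c ∈ C₂.chords) :
    C.coveredIntervals (relabel (innerMap p C₁.chords.card) c) =
      (C₂.coveredIntervals c).image (innerMap p C₁.chords.card) ∪
        if p ∈ C₂.coveredIntervals c then {p + 2 * C₁.chords.card} else ∅ := by
  have hm := h.outer.1.card_pos
  have hn := h.inner.1.card_pos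
  have hlt := h.lt
  have hp := h.one_le
  have hlast : C.Covers (p + 2 * C₁.chords.card) (relabel (innerMap p C₁.chords.card) c) ↔
      C₂.Covers p c := h.covers_inner_iff (fun c _ => below_inner_last hm)
        (h.not_below_outer (Or.inr le_rfl)) hc
  have hin : ∀ q, C.Covers (innerMap p C₁.chords.card q)
      (relabel (innerMap p C₁.chords.card) c) ↔ C₂.Covers q c := fun q =>
    h.covers_inner_iff (fun c _ => below_inner hm q) (h.not_below_outer (innerMap_bound _ q)) hc
  ext x
  rw [mem_coveredIntervals, Finset.mem_union, Finset.mem_image, h.card_eq]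
  constructor
  · rintro ⟨hx, hcov⟩
    by_cases h1 : x = 1
    · subst h1
      exact absurd hcov.1 (h.not_below_one (h.inner_mem hc) (h.outer_ne_inner h.root_mem hc).symm)
    by_cases h2 : p + 2 ≤ x ∧ x < p + 2 * C₁.chords.card
    · have hxq : outerMap p (x - p) = x := by unfold outerMap; split_ifs <;> omega
      rw [← hxq] at hcov
      exact absurd hcov (h.not_covers_inner (by omega) (by omega) hc)
    by_cases h3 : x = p + 2 * C₁.chords.card
    · subst h3
      right
      rw [if_pos (mem_coveredIntervals.2 ⟨⟨hp, hlt⟩, hlast.1 hcov⟩)]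
      exact Finset.mem_singleton_self _
    · left
      obtain ⟨q, hq1, hq2, rfl⟩ : ∃ q, 1 ≤ q ∧ q < 2 * C₂.chords.card ∧
          innerMap p C₁.chords.card q = x := by
        by_cases h4 : x ≤ p + 1
        · exact ⟨x - 1, by omega, by omega, by unfold innerMap; split_ifs <;> omega⟩
        · exact ⟨x - 2 * C₁.chords.card, by omega, by omega,
            by unfold innerMap; split_ifs <;> omega⟩
      exact ⟨q, mem_coveredIntervals.2 ⟨⟨hq1, hq2⟩, (hin q).1 hcov⟩, rfl⟩
  · rintro (⟨q, hq, rfl⟩ | hx)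
    · obtain ⟨hq, hcov⟩ := mem_coveredIntervals.1 hq
      refine ⟨?_, (hin q).2 hcov⟩
      unfold innerMap
      split_ifs <;> omega
    · split_ifs at hx with hpc
      · rw [Finset.mem_singleton.1 hx]
        exact ⟨by omega, hlast.2 (mem_coveredIntervals.1 hpc).2⟩
      · exact absurd hx (Finset.notMem_empty _)

lemma card_coveredIntervals_outer {c : ℕ × ℕ} (hc : c ∈ C₁.chords) :
    (C.coveredIntervals (relabel (outerMap p) c)).card = (C₁.coveredIntervals c).card := by
  rw [h.coveredIntervals_outer hc,
    Finset.card_image_of_injective _ (strictMono_outerMap p).injective]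

open Classical in
lemma card_coveredIntervals_inner {c : ℕ × ℕ} (hc : c ∈ C₂.chords) :
    (C.coveredIntervals (relabel (innerMap p C₁.chords.card) c)).card =
      (C₂.coveredIntervals c).card + if p ∈ C₂.coveredIntervals c then 1 else 0 := by
  have hm := h.outer.1.card_pos
  rw [h.coveredIntervals_inner hc, Finset.card_union_of_disjoint,
    Finset.card_image_of_injective _ h.inner_strictMono.injective]
  · split_ifs <;> simp
  · rw [Finset.disjoint_left]
    intro x hx hx'
    obtain ⟨q, -, rfl⟩ := Finset.mem_image.1 hx
    split_ifs at hx'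
    · rw [Finset.mem_singleton] at hx'
      unfold innerMap at hx'
      split_ifs at hx' <;> omega
    · exact absurd hx' (Finset.notMem_empty _)

end IsInsertion

/-- Induction on connected diagrams by insertion. -/
lemma ChordDiagram.Connected.induction {P : ChordDiagram → Prop}
    (one : ∀ C : ChordDiagram, C.chords.card = 1 → P C)
    (ins : ∀ C C₁ C₂ p, IsInsertion C C₁ C₂ p → P C₁ → P C₂ → P C)
    {C : ChordDiagram} (hC : C.Connected) : P C := by
  induction hn : C.chords.card using Nat.strong_induction_on generalizing C with
  | _ n ih =>
    subst hn
    have hpos := hC.1.card_pos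
    by_cases h1 : C.chords.card = 1
    · exact one C h1
    · obtain ⟨C₁, C₂, p, h⟩ := hC.exists_isInsertion (by omega)
      have h2 := h.card_eq
      have h3 := h.outer.1.card_pos
      have h4 := h.inner.1.card_pos
      exact ins C C₁ C₂ p h (ih _ (by omega) h.outer rfl) (ih _ (by omega) h.inner rfl)

namespace ChordDiagram

variable {C : ChordDiagram}

lemma Connected.card_coveredIntervals_pos (hC : C.Connected) :
    ∀ c ∈ C.chords, 0 < (C.coveredIntervals c).card := by
  refine hC.induction (P := fun C => ∀ c ∈ C.chords, 0 < (C.coveredIntervals c).card) ?_ ?_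
  · intro C h c hc
    rw [eq_of_card_eq_one h, Finset.mem_singleton] at hc
    rw [hc, coveredIntervals_of_card_eq_one h]
    simp
  · intro C C₁ C₂ p h ih1 ih2 c hc
    rcases h.mem_iff.1 hc with ⟨c, hc', rfl⟩ | ⟨c, hc', rfl⟩
    · rw [h.card_coveredIntervals_outer hc']
      exact ih1 c hc'
    · rw [h.card_coveredIntervals_inner hc']
      exact Nat.add_pos_left (ih2 c hc') _

lemma Connected.card_coveredIntervals (hC : C.Connected) {c : ℕ × ℕ} (hc : c ∈ C.chords) :
    (C.coveredIntervals c).card = C.coveringNumber c + 1 := by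
  have := hC.card_coveredIntervals_pos c hc
  unfold coveringNumber
  omega

lemma Connected.biUnion_coveredIntervals (hC : C.Connected) :
    C.chords.biUnion C.coveredIntervals = Finset.Ico 1 (2 * C.chords.card) := by
  ext q
  rw [Finset.mem_biUnion, Finset.mem_Ico]
  constructor
  · rintro ⟨c, -, hq⟩
    exact (mem_coveredIntervals.1 hq).1
  · rintro ⟨h1, h2⟩
    obtain ⟨c, hc, hcov⟩ := hC.exists_covers h1 h2
    exact ⟨c, hc, mem_coveredIntervals.2 ⟨⟨h1, h2⟩, hcov⟩⟩

lemma pairwiseDisjoint_coveredIntervals :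
    (C.chords : Set (ℕ × ℕ)).PairwiseDisjoint C.coveredIntervals := by
  intro c hc c' hc' hne
  rw [Function.onFun, Finset.disjoint_left]
  intro q hq hq'
  exact hne ((mem_coveredIntervals.1 hq).2.unique hc hc' (mem_coveredIntervals.1 hq').2)

lemma Connected.sum_coveringNumber (hC : C.Connected) :
    ∑ c ∈ C.chords, C.coveringNumber c + 1 = C.chords.card := by
  have h1 := congrArg Finset.card hC.biUnion_coveredIntervals
  rw [Finset.card_biUnion pairwiseDisjoint_coveredIntervals, Nat.card_Ico,
    Finset.sum_congr rfl fun c hc => hC.card_coveredIntervals hc, Finset.sum_add_distrib,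
    Finset.sum_const, smul_eq_mul, mul_one] at h1
  have := hC.1.card_pos
  omega

end ChordDiagram

/-! ### Weights -/

/-- The weight of a chord with decoration `d` and covering number `w`. -/
def chordWeight (s d w : ℕ) : ℕ := (d * s + w - 2).choose w

lemma succ_mul_chordWeight_succ {s d : ℕ} (h : 1 ≤ d * s) (w : ℕ) :
    (w + 1) * chordWeight s d (w + 1) = (d * s - 1 + w) * chordWeight s d w := by
  unfold chordWeight
  rcases Nat.eq_or_lt_of_le h with h | h
  · rw [← h]
    rcases w with _ | w
    · simp
    · rw [Nat.choose_eq_zero_of_lt (by omega), Nat.choose_eq_zero_of_lt (by omega)]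
      simp
  · have e1 : d * s + (w + 1) - 2 = (d * s + w - 2) + 1 := by omega
    rw [e1, mul_comm, ← Nat.add_one_mul_choose_eq]
    congr 1
    omega

open Classical in
/-- The total weight of the insertions into a diagram, up to the weight of the outer diagram. -/
lemma ChordDiagram.Connected.sum_prod_chordWeight {C : ChordDiagram} (hC : C.Connected) {s : ℕ}
    (hs : 1 ≤ s) {d : ℕ × ℕ → ℕ} (hd : ∀ c ∈ C.chords, 0 < d c) :
    (∑ p ∈ Finset.Ico 1 (2 * C.chords.card), ∏ c ∈ C.chords, chordWeight s (d c)
        (C.coveringNumber c + if p ∈ C.coveredIntervals c then 1 else 0)) +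
      ∏ c ∈ C.chords, chordWeight s (d c) (C.coveringNumber c) =
    s * (∑ c ∈ C.chords, d c) * ∏ c ∈ C.chords, chordWeight s (d c) (C.coveringNumber c) := by
  rw [← hC.biUnion_coveredIntervals, Finset.sum_biUnion pairwiseDisjoint_coveredIntervals]
  have key : ∀ c ∈ C.chords, ∑ p ∈ C.coveredIntervals c, ∏ c' ∈ C.chords,
      chordWeight s (d c') (C.coveringNumber c' + if p ∈ C.coveredIntervals c' then 1 else 0) =
      (d c * s - 1 + C.coveringNumber c) *
        ∏ c ∈ C.chords, chordWeight s (d c) (C.coveringNumber c) := by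
    intro c hc
    have h1 : ∀ p ∈ C.coveredIntervals c, ∏ c' ∈ C.chords,
        chordWeight s (d c') (C.coveringNumber c' + if p ∈ C.coveredIntervals c' then 1 else 0) =
        chordWeight s (d c) (C.coveringNumber c + 1) *
          ∏ c ∈ C.chords.erase c, chordWeight s (d c) (C.coveringNumber c) := by
      intro p hp
      rw [← Finset.mul_prod_erase _ _ hc, if_pos hp]
      congr 1
      refine Finset.prod_congr rfl fun c' hc' => ?_
      rw [if_neg, add_zero]
      exact fun hp' => (Finset.disjoint_left.1 (pairwiseDisjoint_coveredIntervals
        (Finset.mem_of_mem_erase hc') hc (Finset.ne_of_mem_erase hc'))) hp' hp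
    rw [Finset.sum_congr rfl h1, Finset.sum_const, hC.card_coveredIntervals hc, smul_eq_mul,
      ← mul_assoc, succ_mul_chordWeight_succ (Nat.mul_pos (hd c hc) hs), mul_assoc,
      Finset.mul_prod_erase _ (fun c => chordWeight s (d c) (C.coveringNumber c)) hc]
  rw [Finset.sum_congr rfl key, ← Finset.sum_mul, ← Nat.succ_mul]
  congr 1
  have h2 : ∑ c ∈ C.chords, (d c * s - 1 + C.coveringNumber c) + C.chords.card =
      s * (∑ c ∈ C.chords, d c) + ∑ c ∈ C.chords, C.coveringNumber c := by
    rw [Finset.card_eq_sum_ones, ← Finset.sum_add_distrib, Finset.mul_sum,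
      ← Finset.sum_add_distrib]
    refine Finset.sum_congr rfl fun c hc => ?_
    have h3 : 0 < d c * s := Nat.mul_pos (hd c hc) hs
    rw [mul_comm s]
    omega
  have h4 := hC.sum_coveringNumber
  omega

/-! ### Words of decorated diagrams -/

section words

variable {K : Type*} [CommSemiring K] (a : ℕ → ℕ → K)

/-- The product of the coefficients attached to the letters (terminality and decoration) of a word,
where `g` is the distance from the last terminal letter to the first letter. -/
def amplitude : ℕ → List (Bool × ℕ) → K
  | _, [] => 1
  | g, (false, d) :: w => a d 0 * amplitude (g + 1) w
  | g, (true, d) :: w => a d g * amplitude 1 w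

/-- The same product without the factor of the first terminal letter. -/
def headAmplitude : List (Bool × ℕ) → K
  | [] => 1
  | (false, d) :: w => a d 0 * headAmplitude w
  | (true, _) :: w => amplitude a 1 w

/-- The decoration of the first terminal letter. -/
def headDec : List (Bool × ℕ) → ℕ
  | [] => 0
  | (false, _) :: w => headDec w
  | (true, d) :: _ => d

/-- The number of letters before the first terminal letter. -/
def headIdx : List (Bool × ℕ) → ℕ
  | [] => 0
  | (false, _) :: w => headIdx w + 1
  | (true, _) :: _ => 0

/-- The last letter is terminal. -/
def EndsTerminal (w : List (Bool × ℕ)) : Prop := ∃ w' d, w = w' ++ [(true, d)]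

lemma not_endsTerminal_nil : ¬ EndsTerminal [] := by
  rintro ⟨w', d, h⟩
  simp at h

lemma endsTerminal_cons {x : Bool × ℕ} {w : List (Bool × ℕ)} :
    EndsTerminal (x :: w) ↔ (w = [] ∧ x.1 = true) ∨ EndsTerminal w := by
  constructor
  · rintro ⟨w', d, h⟩
    rcases w' with _ | ⟨y, w'⟩
    · simp only [List.nil_append, List.cons.injEq] at h
      exact Or.inl ⟨h.2, by rw [h.1]⟩
    · simp only [List.cons_append, List.cons.injEq] at h
      exact Or.inr ⟨w', d, h.2⟩
  · rintro (⟨rfl, h⟩ | ⟨w', d, rfl⟩)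
    · exact ⟨[], x.2, by rw [← h]; rfl⟩
    · exact ⟨x :: w', d, rfl⟩

lemma amplitude_append {w : List (Bool × ℕ)} (h : EndsTerminal w) (w' : List (Bool × ℕ)) (g : ℕ) :
    amplitude a g (w ++ w') = amplitude a g w * amplitude a 1 w' := by
  induction w generalizing g with
  | nil => exact absurd h not_endsTerminal_nil
  | cons x w ih =>
    obtain ⟨b, d⟩ := x
    rcases endsTerminal_cons.1 h with ⟨rfl, hb⟩ | hw
    · subst hb
      simp [amplitude]
    · cases b
      · simp only [List.cons_append, amplitude, ih hw, mul_assoc]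
      · simp only [List.cons_append, amplitude, ih hw, mul_assoc]

lemma headAmplitude_append {w : List (Bool × ℕ)} (h : EndsTerminal w) (w' : List (Bool × ℕ)) :
    headAmplitude a (w ++ w') = headAmplitude a w * amplitude a 1 w' := by
  induction w with
  | nil => exact absurd h not_endsTerminal_nil
  | cons x w ih =>
    obtain ⟨b, d⟩ := x
    rcases endsTerminal_cons.1 h with ⟨rfl, hb⟩ | hw
    · subst hb
      simp [amplitude, headAmplitude]
    · cases b
      · simp only [List.cons_append, headAmplitude, ih hw, mul_assoc]
      · simp only [List.cons_append, headAmplitude, amplitude_append a hw]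

lemma headDec_append {w : List (Bool × ℕ)} (h : EndsTerminal w) (w' : List (Bool × ℕ)) :
    headDec (w ++ w') = headDec w := by
  induction w with
  | nil => exact absurd h not_endsTerminal_nil
  | cons x w ih =>
    obtain ⟨b, d⟩ := x
    rcases endsTerminal_cons.1 h with ⟨rfl, hb⟩ | hw
    · subst hb
      simp [headDec]
    · cases b
      · simp only [List.cons_append, headDec, ih hw]
      · simp only [List.cons_append, headDec]

lemma headIdx_append {w : List (Bool × ℕ)} (h : EndsTerminal w) (w' : List (Bool × ℕ)) :
    headIdx (w ++ w') = headIdx w := by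
  induction w with
  | nil => exact absurd h not_endsTerminal_nil
  | cons x w ih =>
    obtain ⟨b, d⟩ := x
    rcases endsTerminal_cons.1 h with ⟨rfl, hb⟩ | hw
    · subst hb
      simp [headIdx]
    · cases b
      · simp only [List.cons_append, headIdx, ih hw]
      · simp only [List.cons_append, headIdx]

lemma amplitude_eq {w : List (Bool × ℕ)} (h : EndsTerminal w) (g : ℕ) :
    amplitude a g w = headAmplitude a w * a (headDec w) (headIdx w + g) := by
  induction w generalizing g with
  | nil => exact absurd h not_endsTerminal_nil
  | cons x w ih =>
    obtain ⟨b, d⟩ := x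
    rcases endsTerminal_cons.1 h with ⟨rfl, hb⟩ | hw
    · subst hb
      simp [amplitude, headAmplitude, headDec, headIdx]
    · cases b
      · simp only [amplitude, headAmplitude, headDec, headIdx, ih hw]
        rw [mul_assoc, add_assoc, add_comm 1 g]
      · simp only [amplitude, headAmplitude, headDec, headIdx]
        rw [mul_comm, zero_add]

lemma amplitude_zero_cons (b : Bool) (d : ℕ) (w : List (Bool × ℕ)) :
    amplitude a 0 ((b, d) :: w) = a d 0 * amplitude a 1 w := by
  cases b <;> rfl

end words

lemma intersectionOrder_of_card_eq_one {C : ChordDiagram} (h : C.chords.card = 1) :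
    intersectionOrder C.chords = [(1, 2)] := by
  rw [ChordDiagram.eq_of_card_eq_one h]
  have := perm_intersectionOrder {((1 : ℕ), (2 : ℕ))}
  rwa [Finset.toList_singleton, List.perm_singleton] at this

lemma ChordDiagram.isTerminal_of_card_eq_one {C : ChordDiagram} (h : C.chords.card = 1) :
    C.IsTerminal (1, 2) := by
  intro c' hc' hi
  rw [ChordDiagram.eq_of_card_eq_one h, Finset.mem_singleton] at hc'
  subst hc'
  simp [Intersects, Crosses] at hi

lemma ChordDiagram.Connected.exists_last {C : ChordDiagram} (hC : C.Connected) :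
    ∃ l c, intersectionOrder C.chords = l ++ [c] ∧ C.IsTerminal c := by
  refine hC.induction
    (P := fun C => ∃ l c, intersectionOrder C.chords = l ++ [c] ∧ C.IsTerminal c) ?_ ?_
  · intro C h
    exact ⟨[], _, intersectionOrder_of_card_eq_one h, isTerminal_of_card_eq_one h⟩
  · rintro C C₁ C₂ p h ⟨l₁, c₁, h1, t1⟩ ⟨l₂, c₂, h2, t2⟩
    have hn := nodup_intersectionOrder C₁.chords
    have hmem : ∀ c ∈ intersectionOrder C₁.chords, c ∈ C₁.chords := fun c =>
      mem_intersectionOrder.1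
    have hc2 : c₂ ∈ C₂.chords := mem_intersectionOrder.1 (by rw [h2]; simp)
    rcases l₁ with _ | ⟨x, l₁⟩
    · rw [h.intersectionOrder_outer] at h1
      simp only [List.nil_append, List.cons.injEq] at h1
      refine ⟨relabel (outerMap p) h.root :: l₂.map (relabel (innerMap p C₁.chords.card)),
        relabel (innerMap p C₁.chords.card) c₂, ?_, (h.isTerminal_inner hc2).2 t2⟩
      rw [h.intersectionOrder_eq, h1.2, h2]
      simp
    · rw [h1] at hn hmem
      rw [h.intersectionOrder_outer] at h1
      simp only [List.cons_append, List.cons.injEq] at h1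
      have hne : c₁ ≠ h.root := by
        rintro rfl
        rw [List.cons_append, List.nodup_cons, h1.1] at hn
        exact hn.1 (by simp)
      refine ⟨relabel (outerMap p) h.root ::
        ((intersectionOrder C₂.chords).map (relabel (innerMap p C₁.chords.card)) ++
          l₁.map (relabel (outerMap p))), relabel (outerMap p) c₁, ?_,
        (h.isTerminal_outer (hmem c₁ (by simp)) hne).2 t1⟩
      rw [h.intersectionOrder_eq, h1.2]
      simp

namespace DecoratedDiagram

open Classical in
/-- The list of the terminality and the decoration of the chords, in intersection order. -/
def word (C : DecoratedDiagram) : List (Bool × ℕ) :=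
  (intersectionOrder C.chords).map fun c => (decide (C.IsTerminal c), C.dec c)

lemma endsTerminal_word {C : DecoratedDiagram} (hC : C.Connected) : EndsTerminal C.word := by
  classical
  obtain ⟨l, c, h, ht⟩ := hC.exists_last
  refine ⟨l.map fun c => (decide (C.IsTerminal c), C.dec c), C.dec c, ?_⟩
  rw [word, h, List.map_append, List.map_singleton, decide_eq_true ht]

lemma word_of_card_eq_one {C : DecoratedDiagram} (h : C.chords.card = 1) :
    C.word = [(true, C.dec (1, 2))] := by
  classical
  rw [word, intersectionOrder_of_card_eq_one h, List.map_singleton,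
    decide_eq_true (ChordDiagram.isTerminal_of_card_eq_one h)]

lemma size_of_card_eq_one {C : DecoratedDiagram} (h : C.chords.card = 1) :
    C.size = C.dec (1, 2) := by
  rw [size, ChordDiagram.eq_of_card_eq_one h, Finset.sum_singleton]

lemma weight_eq (s : ℕ) (C : DecoratedDiagram) :
    C.weight s = ∏ c ∈ C.chords, chordWeight s (C.dec c) (C.coveringNumber c) := rfl

lemma weight_of_card_eq_one (s : ℕ) {C : DecoratedDiagram} (h : C.chords.card = 1) :
    C.weight s = 1 := by
  rw [weight, ChordDiagram.eq_of_card_eq_one h, Finset.prod_singleton,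
    ChordDiagram.coveringNumber, ChordDiagram.coveredIntervals_of_card_eq_one h]
  simp

end DecoratedDiagram

/-- Insertion of decorated diagrams: every chord keeps its decoration. -/
structure IsDecInsertion (C C₁ C₂ : DecoratedDiagram) (p : ℕ) : Prop where
  ins : IsInsertion C.toChordDiagram C₁.toChordDiagram C₂.toChordDiagram p
  dec_outer : ∀ c ∈ C₁.chords, C.dec (relabel (outerMap p) c) = C₁.dec c
  dec_inner : ∀ c ∈ C₂.chords, C.dec (relabel (innerMap p C₁.chords.card) c) = C₂.dec c

open Classical in
lemma exists_isDecInsertion {C₁ C₂ : DecoratedDiagram} (h1 : C₁.Connected) (h2 : C₂.Connected)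
    {p : ℕ} (hp : 1 ≤ p) (hp' : p < 2 * C₂.chords.card) : ∃ C, IsDecInsertion C C₁ C₂ p := by
  obtain ⟨C, h⟩ := exists_isInsertion h1 h2 hp hp'
  have i1 := relabel_injective (strictMono_outerMap p)
  have i2 := relabel_injective h.inner_strictMono
  let d : ℕ × ℕ → ℕ := fun c =>
    if c ∈ C₁.chords.image (relabel (outerMap p)) then
      Function.extend (relabel (outerMap p)) C₁.dec 0 c
    else if c ∈ C₂.chords.image (relabel (innerMap p C₁.chords.card)) then
      Function.extend (relabel (innerMap p C₁.chords.card)) C₂.dec 0 c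
    else 0
  have d1 : ∀ c ∈ C₁.chords, d (relabel (outerMap p) c) = C₁.dec c := by
    intro c hc
    simp only [d]
    rw [if_pos (Finset.mem_image_of_mem _ hc), i1.extend_apply]
  have d2 : ∀ c ∈ C₂.chords, d (relabel (innerMap p C₁.chords.card) c) = C₂.dec c := by
    intro c hc
    simp only [d]
    rw [if_neg, if_pos (Finset.mem_image_of_mem _ hc), i2.extend_apply]
    intro hc'
    obtain ⟨c', hc', he⟩ := Finset.mem_image.1 hc'
    exact h.outer_ne_inner hc' hc he
  refine ⟨⟨C, d, ?_, ?_⟩, h, d1, d2⟩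
  · intro c hc
    rcases h.mem_iff.1 hc with ⟨c, hc', rfl⟩ | ⟨c, hc', rfl⟩
    · rw [d1 c hc']
      exact C₁.dec_pos c hc'
    · rw [d2 c hc']
      exact C₂.dec_pos c hc'
  · intro c hc
    rw [h.chords_eq, Finset.mem_union, not_or] at hc
    simp only [d, if_neg hc.1, if_neg hc.2]

open Classical in
/-- The restriction of a decoration to a diagram that is mapped into the decorated one. -/
lemma exists_decoration {C : DecoratedDiagram} {C' : ChordDiagram} {f : ℕ → ℕ}
    (h : ∀ c ∈ C'.chords, relabel f c ∈ C.chords) : ∃ D : DecoratedDiagram,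
      D.toChordDiagram = C' ∧ ∀ c ∈ C'.chords, C.dec (relabel f c) = D.dec c :=
  ⟨⟨C', fun c => if c ∈ C'.chords then C.dec (relabel f c) else 0,
    fun c hc => by simpa only [if_pos hc] using C.dec_pos _ (h c hc), fun c hc => if_neg hc⟩, rfl,
    fun c hc => (if_pos hc).symm⟩

lemma exists_eq_isDecInsertion {C : DecoratedDiagram} (hC : C.Connected)
    (hcard : 2 ≤ C.chords.card) : ∃ C₁ C₂ p, IsDecInsertion C C₁ C₂ p := by
  obtain ⟨C₁, C₂, p, h⟩ := hC.exists_isInsertion hcard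
  obtain ⟨D₁, rfl, h1⟩ := exists_decoration fun c hc => h.outer_mem (c := c) hc
  obtain ⟨D₂, rfl, h2⟩ := exists_decoration fun c hc => h.inner_mem (c := c) hc
  exact ⟨D₁, D₂, p, h, h1, h2⟩

namespace IsDecInsertion

lemma _root_.ChordLog.DecoratedDiagram.ext_of_dec {C C' : DecoratedDiagram}
    (h : C.toChordDiagram = C'.toChordDiagram) (hd : ∀ c ∈ C.chords, C.dec c = C'.dec c) :
    C = C' := by
  refine DecoratedDiagram.ext (congrArg _ h) (funext fun c => ?_)
  by_cases hc : c ∈ C.chords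
  · exact hd c hc
  · rw [C.dec_eq_zero c hc, C'.dec_eq_zero c (by rwa [← h])]

variable {C C₁ C₂ : DecoratedDiagram} {p : ℕ} (h : IsDecInsertion C C₁ C₂ p)
include h

lemma unique {C₁' C₂' : DecoratedDiagram} {p' : ℕ} (h' : IsDecInsertion C C₁' C₂' p') :
    C₁ = C₁' ∧ C₂ = C₂' ∧ p = p' := by
  obtain ⟨e1, e2, rfl⟩ := h.ins.unique h'.ins
  refine ⟨DecoratedDiagram.ext_of_dec e1 fun c hc => ?_,
    DecoratedDiagram.ext_of_dec e2 fun c hc => ?_, rfl⟩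
  · rw [← h.dec_outer c hc, h'.dec_outer c (by rwa [← e1])]
  · rw [← h.dec_inner c hc, e1, h'.dec_inner c (by rwa [← e2])]

lemma ext_result {C' : DecoratedDiagram} (h' : IsDecInsertion C' C₁ C₂ p) : C = C' := by
  refine DecoratedDiagram.ext_of_dec
    (ChordDiagram.ext (by rw [h.ins.chords_eq, h'.ins.chords_eq])) fun c hc => ?_
  rcases h.ins.mem_iff.1 hc with ⟨c, hc', rfl⟩ | ⟨c, hc', rfl⟩
  · rw [h.dec_outer c hc', h'.dec_outer c hc']
  · rw [h.dec_inner c hc', h'.dec_inner c hc']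

@[to_additive]
lemma prod_chords {M : Type*} [CommMonoid M] (f : ℕ × ℕ → M) : ∏ c ∈ C.chords, f c =
    (∏ c ∈ C₁.chords, f (relabel (outerMap p) c)) *
      ∏ c ∈ C₂.chords, f (relabel (innerMap p C₁.chords.card) c) := by
  rw [h.ins.chords_eq, Finset.prod_union (disjoint_relabel _ _ h.ins.outer.1 h.ins.lt),
    Finset.prod_image (relabel_injective (strictMono_outerMap p)).injOn,
    Finset.prod_image (relabel_injective h.ins.inner_strictMono).injOn]

lemma size_eq : C.size = C₁.size + C₂.size := by
  rw [DecoratedDiagram.size, h.sum_chords, Finset.sum_congr rfl h.dec_outer,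
    Finset.sum_congr rfl h.dec_inner]
  rfl

open Classical in
lemma weight_eq (s : ℕ) : C.weight s = C₁.weight s * ∏ c ∈ C₂.chords,
    chordWeight s (C₂.dec c) (C₂.coveringNumber c + if p ∈ C₂.coveredIntervals c then 1 else 0) := by
  rw [DecoratedDiagram.weight_eq, h.prod_chords, DecoratedDiagram.weight_eq]
  congr 1
  · refine Finset.prod_congr rfl fun c hc => ?_
    rw [h.dec_outer c hc, ChordDiagram.coveringNumber, h.ins.card_coveredIntervals_outer hc]
    rfl
  · refine Finset.prod_congr rfl fun c hc => ?_
    rw [h.dec_inner c hc, ChordDiagram.coveringNumber, h.ins.card_coveredIntervals_inner hc,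
      h.ins.inner.card_coveredIntervals hc, add_right_comm, Nat.add_sub_cancel]

lemma word_outer : ∃ b, C₁.word = (b, C₁.dec h.ins.root) :: C₁.word.tail := by
  rw [DecoratedDiagram.word, h.ins.intersectionOrder_outer, List.map_cons]
  exact ⟨_, rfl⟩

lemma word_eq : C.word = (false, C₁.dec h.ins.root) :: (C₂.word ++ C₁.word.tail) := by
  classical
  rw [DecoratedDiagram.word, h.ins.intersectionOrder_eq, List.map_cons, List.map_append,
    List.map_map, List.map_map, decide_eq_false h.ins.not_isTerminal_root,
    h.dec_outer _ h.ins.root_mem, DecoratedDiagram.word, DecoratedDiagram.word,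
    h.ins.intersectionOrder_outer, List.map_cons, List.tail_cons]
  congr 2
  · refine List.map_congr_left fun c hc => ?_
    have hc' := mem_intersectionOrder.1 hc
    simp only [Function.comp_apply, h.dec_inner c hc', h.ins.isTerminal_inner hc']
  · refine List.map_congr_left fun c hc => ?_
    have hc' := mem_intersectionOrder.1 hc
    simp only [Function.comp_apply, h.dec_outer c (Finset.mem_of_mem_erase hc'),
      h.ins.isTerminal_outer (Finset.mem_of_mem_erase hc') (Finset.ne_of_mem_erase hc')]

lemma headAmplitude_eq {K : Type*} [CommSemiring K] (a : ℕ → ℕ → K) :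
    headAmplitude a C.word = amplitude a 0 C₁.word * headAmplitude a C₂.word := by
  obtain ⟨b, hb⟩ := h.word_outer
  rw [h.word_eq, headAmplitude, headAmplitude_append a
    (DecoratedDiagram.endsTerminal_word h.ins.inner), hb, amplitude_zero_cons, List.tail_cons]
  ring

lemma headDec_eq : headDec C.word = headDec C₂.word := by
  rw [h.word_eq, headDec, headDec_append (DecoratedDiagram.endsTerminal_word h.ins.inner)]

lemma headIdx_eq : headIdx C.word = headIdx C₂.word + 1 := by
  rw [h.word_eq, headIdx, headIdx_append (DecoratedDiagram.endsTerminal_word h.ins.inner)]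

end IsDecInsertion

/-! ### The recursion for the weighted sums -/

open Classical in
/-- The connected decorated diagrams of size `n`. -/
def connectedDiagrams (n : ℕ) : Finset DecoratedDiagram :=
  (DecoratedDiagram.finite_size n).toFinset.filter fun C => C.Connected

lemma mem_connectedDiagrams {n : ℕ} {C : DecoratedDiagram} :
    C ∈ connectedDiagrams n ↔ C.size = n ∧ C.Connected := by
  classical
  simp [connectedDiagrams]

open Classical in
lemma sum_prod_chordWeight_inner {C : DecoratedDiagram} (hC : C.Connected) {s : ℕ} (hs : 1 ≤ s) :
    (∑ p ∈ Finset.Ico 1 (2 * C.chords.card), ∏ c ∈ C.chords, chordWeight s (C.dec c)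
        (C.coveringNumber c + if p ∈ C.coveredIntervals c then 1 else 0)) + C.weight s =
      s * C.size * C.weight s :=
  hC.sum_prod_chordWeight hs C.dec_pos

open Classical in
/-- The decomposition of the connected diagrams with at least two chords into insertions, for
weighted sums. -/
lemma sum_insertions {K M : Type*} [Field K] [AddCommGroup M] [Module K M] {s : ℕ} (hs : 1 ≤ s)
    (a : ℕ → ℕ → K) (φ : ℕ → ℕ → M) (n : ℕ) :
    ∑ C ∈ connectedDiagrams n with 2 ≤ C.chords.card,
      ((C.weight s : K) * headAmplitude a C.word) • φ (headDec C.word) (headIdx C.word) =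
    ∑ q ∈ Finset.HasAntidiagonal.antidiagonal n,
      ((∑ C ∈ connectedDiagrams q.1, (C.weight s : K) * amplitude a 0 C.word) *
        ((s : K) * q.2 - 1)) • ∑ C ∈ connectedDiagrams q.2,
          ((C.weight s : K) * headAmplitude a C.word) •
            φ (headDec C.word) (headIdx C.word + 1) := by
  have key : ∀ q ∈ Finset.HasAntidiagonal.antidiagonal n,
      ((∑ C ∈ connectedDiagrams q.1, (C.weight s : K) * amplitude a 0 C.word) *
        ((s : K) * q.2 - 1)) • (∑ C ∈ connectedDiagrams q.2,
          ((C.weight s : K) * headAmplitude a C.word) •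
            φ (headDec C.word) (headIdx C.word + 1)) =
      ∑ x ∈ (connectedDiagrams q.1 ×ˢ connectedDiagrams q.2).sigma
        (fun y => Finset.Ico 1 (2 * y.2.chords.card)),
        ((x.1.1.weight s : K) * ((∏ c ∈ x.1.2.chords, chordWeight s (x.1.2.dec c)
          (x.1.2.coveringNumber c + if x.2 ∈ x.1.2.coveredIntervals c then 1 else 0) : ℕ) : K) *
          (amplitude a 0 x.1.1.word * headAmplitude a x.1.2.word)) •
          φ (headDec x.1.2.word) (headIdx x.1.2.word + 1) := by
    intro q _
    rw [Finset.sum_sigma, Finset.sum_product, Finset.sum_mul, Finset.sum_smul]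
    refine Finset.sum_congr rfl fun C₁ _ => ?_
    rw [Finset.smul_sum]
    refine Finset.sum_congr rfl fun C₂ h2 => ?_
    obtain ⟨h2s, h2c⟩ := mem_connectedDiagrams.1 h2
    have hw := congrArg (Nat.cast : ℕ → K) (sum_prod_chordWeight_inner h2c hs)
    simp only [Nat.cast_add, Nat.cast_mul, Nat.cast_sum, h2s] at hw
    dsimp only
    rw [← Finset.sum_smul, ← Finset.sum_mul, ← Finset.mul_sum, eq_sub_of_add_eq hw, smul_smul]
    congr 1
    ring
  rw [Finset.sum_congr rfl key, Finset.sum_sigma']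
  symm
  have hex : ∀ x ∈ (Finset.HasAntidiagonal.antidiagonal n).sigma (fun q =>
      (connectedDiagrams q.1 ×ˢ connectedDiagrams q.2).sigma
        (fun y => Finset.Ico 1 (2 * y.2.chords.card))),
      ∃ C, IsDecInsertion C x.2.1.1 x.2.1.2 x.2.2 := by
    rintro ⟨q, ⟨⟨C₁, C₂⟩, p⟩⟩ hx
    simp only [Finset.mem_sigma, Finset.mem_product, Finset.mem_Ico, mem_connectedDiagrams] at hx
    exact exists_isDecInsertion hx.2.1.1.2 hx.2.1.2.2 hx.2.2.1 hx.2.2.2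
  choose f hf using hex
  refine Finset.sum_bij f ?_ ?_ ?_ ?_
  · intro x hx
    have h := hf x hx
    obtain ⟨q, ⟨⟨C₁, C₂⟩, p⟩⟩ := x
    simp only [Finset.mem_sigma, Finset.mem_product, Finset.HasAntidiagonal.mem_antidiagonal,
      mem_connectedDiagrams] at hx
    refine Finset.mem_filter.2 ⟨mem_connectedDiagrams.2 ⟨?_, h.ins.connected⟩, ?_⟩
    · rw [h.size_eq, hx.2.1.1.1, hx.2.1.2.1, hx.1]
    · have h1 := h.ins.outer.1.card_pos
      have h2 := h.ins.inner.1.card_pos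
      rw [h.ins.card_eq]
      omega
  · intro x hx y hy hxy
    have h := hf x hx
    have h' := hf y hy
    rw [← hxy] at h'
    have hu := h.unique h'
    obtain ⟨⟨q1, q2⟩, ⟨⟨C₁, C₂⟩, p⟩⟩ := x
    obtain ⟨⟨r1, r2⟩, ⟨⟨D₁, D₂⟩, p'⟩⟩ := y
    simp only [Finset.mem_sigma, Finset.mem_product, Finset.HasAntidiagonal.mem_antidiagonal,
      mem_connectedDiagrams] at hx hy hu
    obtain ⟨rfl, rfl, rfl⟩ := hu
    obtain ⟨-, ⟨⟨rfl, -⟩, ⟨rfl, -⟩⟩, -⟩ := hx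
    obtain ⟨-, ⟨⟨rfl, -⟩, ⟨rfl, -⟩⟩, -⟩ := hy
    rfl
  · intro C hC
    obtain ⟨hC, hcard⟩ := Finset.mem_filter.1 hC
    obtain ⟨hsize, hconn⟩ := mem_connectedDiagrams.1 hC
    obtain ⟨C₁, C₂, p, h⟩ := exists_eq_isDecInsertion hconn hcard
    have hmem : (⟨(C₁.size, C₂.size), ⟨(C₁, C₂), p⟩⟩ :
        (_ : ℕ × ℕ) × (_ : DecoratedDiagram × DecoratedDiagram) × ℕ) ∈
        (Finset.HasAntidiagonal.antidiagonal n).sigma (fun q =>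
          (connectedDiagrams q.1 ×ˢ connectedDiagrams q.2).sigma
            (fun y => Finset.Ico 1 (2 * y.2.chords.card))) := by
      simp only [Finset.mem_sigma, Finset.mem_product, Finset.HasAntidiagonal.mem_antidiagonal,
        mem_connectedDiagrams, Finset.mem_Ico]
      exact ⟨by rw [← h.size_eq, hsize], ⟨⟨trivial, h.ins.outer⟩, ⟨trivial, h.ins.inner⟩⟩,
        h.ins.one_le, h.ins.lt⟩
    exact ⟨_, hmem, (hf _ hmem).ext_result h⟩
  · intro x hx
    have h := hf x hx
    rw [h.weight_eq, h.headAmplitude_eq, h.headDec_eq, h.headIdx_eq, Nat.cast_mul]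

/-- For every `n > 0` there is exactly one diagram of size `n` with one chord. -/
lemma sum_card_eq_one {M : Type*} [AddCommMonoid M] {n : ℕ} (hn : 0 < n)
    (f : DecoratedDiagram → M) (x : M)
    (hf : ∀ C : DecoratedDiagram, C.chords.card = 1 → C.size = n → f C = x) :
    ∑ C ∈ connectedDiagrams n with ¬ 2 ≤ C.chords.card, f C = x := by
  classical
  let C₀ : DecoratedDiagram :=
    { chords := {(1, 2)}
      fst_lt_snd := by simp
      endpoints := by
        ext q
        simp only [Finset.image_singleton, Finset.mem_union, Finset.mem_singleton,
          Finset.card_singleton, Finset.mem_Icc]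
        omega
      dec := fun c => if c = (1, 2) then n else 0
      dec_pos := by simp [hn]
      dec_eq_zero := fun c hc => if_neg fun h => hc (Finset.mem_singleton.2 h) }
  have hcard : C₀.chords.card = 1 := rfl
  have hsize : C₀.size = n := by
    rw [DecoratedDiagram.size_of_card_eq_one hcard]
    rfl
  have hconn : C₀.Connected := by
    refine ⟨⟨_, Finset.mem_singleton_self _⟩, ?_⟩
    intro c hc c' hc'
    rw [Finset.mem_singleton.1 hc, Finset.mem_singleton.1 hc']
    exact Relation.ReflTransGen.refl
  have : (connectedDiagrams n).filter (fun C => ¬ 2 ≤ C.chords.card) = {C₀} := by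
    ext C
    rw [Finset.mem_filter, mem_connectedDiagrams, Finset.mem_singleton]
    constructor
    · rintro ⟨⟨hs, hC⟩, h2⟩
      have h1 : C.chords.card = 1 := by
        have := hC.1.card_pos
        omega
      have hch := ChordDiagram.eq_of_card_eq_one h1
      refine DecoratedDiagram.ext_of_dec (ChordDiagram.ext hch) fun c hc => ?_
      rw [hch, Finset.mem_singleton] at hc
      rw [hc, ← DecoratedDiagram.size_of_card_eq_one h1, hs,
        ← DecoratedDiagram.size_of_card_eq_one hcard, hsize]
    · rintro rfl
      exact ⟨⟨hsize, hconn⟩, by omega⟩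
  rw [this, Finset.sum_singleton, hf C₀ hcard hsize]

section analysis

variable {K : Type*} [Field K]

/-! ### Divided powers of `-L` and the insertion operators -/

variable (K) in
/-- The divided power `(-L)^n / n!`. -/
def dividedPower (n : ℕ) : K[X] := Polynomial.monomial n ((-1) ^ n * (n.factorial : K)⁻¹)

lemma dividedPower_eq (n : ℕ) :
    dividedPower K n = Polynomial.C (n.factorial : K)⁻¹ * (-Polynomial.X) ^ n := by
  rw [dividedPower, neg_pow, ← Polynomial.C_mul_X_pow_eq_monomial]
  simp only [map_mul, map_pow, map_neg, map_one]
  ring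

lemma coeff_dividedPower (n i : ℕ) :
    (dividedPower K n).coeff i = if n = i then (-1) ^ n * (n.factorial : K)⁻¹ else 0 :=
  Polynomial.coeff_monomial

lemma coeff_kernel (a : ℕ → ℕ → K) (k n : ℕ) :
    PowerSeries.coeff n (kernel a k) = ∑ q ∈ Finset.HasAntidiagonal.antidiagonal n,
      a k q.2 • dividedPower K (q.1 + 1) := by
  rw [kernel, PowerSeries.coeff_mul]
  refine Finset.sum_congr rfl fun q _ => ?_
  rw [PowerSeries.coeff_mk, PowerSeries.coeff_mk, dividedPower_eq, Polynomial.smul_eq_C_mul,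
    mul_comm]

lemma factorial_mul_coeff_iterate {R : Type*} [CommRing R] (f : R⟦X⟧) (n m : ℕ) :
    (m.factorial : R) * PowerSeries.coeff m
      ((fun f : R⟦X⟧ => -PowerSeries.derivative R f)^[n] f) =
    (-1) ^ n * ((m + n).factorial : R) * PowerSeries.coeff (m + n) f := by
  induction n generalizing m with
  | zero => simp
  | succ n ih =>
    rw [Function.iterate_succ_apply', map_neg, PowerSeries.coeff_derivative]
    have h := ih (m + 1)
    rw [Nat.factorial_succ, Nat.cast_mul, Nat.cast_add, Nat.cast_one,
      show m + 1 + n = m + (n + 1) by omega] at h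
    rw [pow_succ]
    linear_combination -h

lemma insertion_add (a : ℕ → ℕ → K) (k : ℕ) (P Q : K[X]) :
    insertion a k (P + Q) = insertion a k P + insertion a k Q := by
  refine Polynomial.sum_add_index P Q _ (fun i => by simp) fun i b c => ?_
  rw [Polynomial.C_add, add_mul]

lemma insertion_smul (a : ℕ → ℕ → K) (k : ℕ) (c : K) (P : K[X]) :
    insertion a k (c • P) = c • insertion a k P := by
  rw [insertion, Polynomial.sum_smul_index P c _ (fun i => by simp), insertion, Polynomial.sum,
    Polynomial.sum, Finset.smul_sum]
  refine Finset.sum_congr rfl fun i _ => ?_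
  rw [Polynomial.C_mul, mul_assoc, Polynomial.smul_eq_C_mul]

/-- The insertion operator as a linear map. -/
def insertionMap (a : ℕ → ℕ → K) (k : ℕ) : K[X] →ₗ[K] K[X] where
  toFun := insertion a k
  map_add' := insertion_add a k
  map_smul' := insertion_smul a k

lemma insertion_dividedPower [CharZero K] (a : ℕ → ℕ → K) (k n : ℕ) :
    insertion a k (dividedPower K n) = PowerSeries.coeff n (kernel a k) := by
  have h := factorial_mul_coeff_iterate (kernel a k) n 0
  rw [Nat.factorial_zero, Nat.cast_one, one_mul, zero_add,
    PowerSeries.coeff_zero_eq_constantCoeff_apply] at h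
  have hn : (n.factorial : K) ≠ 0 := Nat.cast_ne_zero.2 n.factorial_ne_zero
  rw [insertion, dividedPower, Polynomial.sum_monomial_index _ _ (by simp), h, ← mul_assoc]
  convert one_mul _ using 2
  have h1 : ((n.factorial : ℕ) : K[X]) = Polynomial.C (n.factorial : K) := by simp
  have h2 : ((-1 : K[X])) ^ n = Polynomial.C ((-1) ^ n) := by simp
  rw [h1, h2, ← Polynomial.C_mul, ← Polynomial.C_mul, ← Polynomial.C_1]
  congr 1
  have h3 : (-1 : K) ^ n * (-1) ^ n = 1 := by rw [← mul_pow]; simp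
  field_simp
  linear_combination h3

variable (K) in
/-- The derivation `-d/dL`. -/
def negDeriv : Derivation K K[X] K[X] := -Polynomial.derivative'

lemma negDeriv_apply (P : K[X]) : negDeriv K P = -Polynomial.derivative P := rfl

lemma negDeriv_dividedPower_zero : negDeriv K (dividedPower K 0) = 0 := by
  rw [negDeriv_apply, dividedPower, Polynomial.derivative_monomial]
  simp

lemma negDeriv_dividedPower_succ [CharZero K] (n : ℕ) :
    negDeriv K (dividedPower K (n + 1)) = dividedPower K n := by
  rw [negDeriv_apply, dividedPower, Polynomial.derivative_monomial, ← map_neg, dividedPower,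
    Nat.add_sub_cancel]
  congr 1
  have hn : (n.factorial : K) ≠ 0 := Nat.cast_ne_zero.2 n.factorial_ne_zero
  have hn' : ((n + 1 : ℕ) : K) ≠ 0 := Nat.cast_ne_zero.2 n.succ_ne_zero
  rw [Nat.factorial_succ, Nat.cast_mul]
  field_simp
  ring

lemma negDeriv_insertion_zero [CharZero K] (a : ℕ → ℕ → K) (k : ℕ) :
    negDeriv K (insertion a k (dividedPower K 0)) = a k 0 • 1 := by
  rw [insertion_dividedPower, coeff_kernel]
  have h0 : dividedPower K 0 = 1 := by rw [dividedPower]; simp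
  simp [negDeriv_dividedPower_succ, h0]

lemma negDeriv_insertion_succ [CharZero K] (a : ℕ → ℕ → K) (k n : ℕ) :
    negDeriv K (insertion a k (dividedPower K (n + 1))) =
      a k (n + 1) • 1 + insertion a k (dividedPower K n) := by
  have h0 : dividedPower K 0 = 1 := by rw [dividedPower]; simp
  rw [insertion_dividedPower, insertion_dividedPower, coeff_kernel, coeff_kernel, map_sum,
    Finset.Nat.antidiagonal_succ, Finset.sum_cons, Finset.sum_map]
  simp [negDeriv_dividedPower_succ, h0]

lemma coeff_zero_insertion (a : ℕ → ℕ → K) [CharZero K] (k n : ℕ) :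
    (insertion a k (dividedPower K n)).coeff 0 = 0 := by
  rw [insertion_dividedPower, coeff_kernel, Polynomial.finsetSum_coeff]
  exact Finset.sum_eq_zero fun q _ => by
    rw [Polynomial.coeff_smul, coeff_dividedPower, if_neg (by omega), smul_zero]

/-! ### Derivations of power series over polynomials -/

variable (K) in
/-- The derivation `-∂/∂L` of power series over `K[L]`. -/
def coeffDeriv : K[X]⟦X⟧ →+ K[X]⟦X⟧ where
  toFun f := PowerSeries.mk fun n => negDeriv K (PowerSeries.coeff n f)
  map_zero' := by ext; simp
  map_add' f g := by ext; simp

@[simp]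
lemma coeff_coeffDeriv (f : K[X]⟦X⟧) (n : ℕ) :
    PowerSeries.coeff n (coeffDeriv K f) = negDeriv K (PowerSeries.coeff n f) := by
  rw [coeffDeriv, AddMonoidHom.coe_mk, ZeroHom.coe_mk, PowerSeries.coeff_mk]

lemma coeffDeriv_mul (f g : K[X]⟦X⟧) :
    coeffDeriv K (f * g) = f * coeffDeriv K g + g * coeffDeriv K f := by
  ext1 n
  simp only [coeff_coeffDeriv, smul_eq_mul, map_add, PowerSeries.coeff_mul, map_sum,
    Derivation.leibniz, Finset.sum_add_distrib]
  congr 1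
  rw [← Finset.Nat.sum_antidiagonal_swap]
  rfl

lemma coeffDeriv_one : coeffDeriv K 1 = 0 := by
  ext1 n
  rw [coeff_coeffDeriv, PowerSeries.coeff_one, map_zero]
  split_ifs
  · exact Derivation.map_one_eq_zero _
  · exact map_zero _

section euler

variable {R : Type*} [CommRing R]

/-- The Euler derivation `x d/dx`. -/
def euler (f : R⟦X⟧) : R⟦X⟧ := PowerSeries.X * PowerSeries.derivative R f

lemma euler_sub (f g : R⟦X⟧) : euler (f - g) = euler f - euler g := by
  rw [euler, map_sub, mul_sub]
  rfl

lemma euler_mul (f g : R⟦X⟧) : euler (f * g) = f * euler g + g * euler f := by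
  rw [euler, Derivation.leibniz, smul_eq_mul, smul_eq_mul, euler, euler]
  ring

lemma euler_one : euler (1 : R⟦X⟧) = 0 := by
  rw [euler, Derivation.map_one_eq_zero, mul_zero]

@[simp]
lemma coeff_euler (f : R⟦X⟧) (n : ℕ) :
    PowerSeries.coeff n (euler f) = n * PowerSeries.coeff n f := by
  rw [euler]
  rcases n with _ | n
  · simp
  · rw [PowerSeries.coeff_succ_X_mul, PowerSeries.coeff_derivative]
    push_cast
    ring

end euler

lemma map_pow_of_leibniz {A : Type*} [CommRing A] {δ : A → A} (h1 : δ 1 = 0)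
    (hmul : ∀ x y, δ (x * y) = x * δ y + y * δ x) {x c : A} (h : δ x = c * x)
    (m : ℕ) : δ (x ^ m) = m * c * x ^ m := by
  induction m with
  | zero => simp [h1]
  | succ m ih =>
    rw [pow_succ, hmul, ih, h]
    push_cast
    ring

/-- A solution of the renormalization group equation that vanishes at `L = 0` is zero. -/
lemma eq_zero_of_coeffDeriv_eq [CharZero K] {f γ : K[X]⟦X⟧} {c s : K[X]}
    (hγ : PowerSeries.coeff 0 γ = 0)
    (h : coeffDeriv K f = γ * (PowerSeries.C s * euler f + PowerSeries.C c * f))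
    (h0 : ∀ n, (PowerSeries.coeff n f).coeff 0 = 0) : f = 0 := by
  ext1 n
  rw [map_zero]
  induction n using Nat.strong_induction_on with
  | _ n ih =>
    have h1 := congrArg (PowerSeries.coeff n) h
    rw [coeff_coeffDeriv, PowerSeries.coeff_mul, Finset.sum_eq_zero] at h1
    · rw [negDeriv_apply, neg_eq_zero] at h1
      rw [Polynomial.eq_C_of_derivative_eq_zero h1, h0, Polynomial.C_0]
    · intro q hq
      rw [Finset.HasAntidiagonal.mem_antidiagonal] at hq
      rcases Nat.eq_zero_or_pos q.1 with h2 | h2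
      · rw [h2, hγ, zero_mul]
      · simp [ih q.2 (by omega)]

/-! ### The solution of the Dyson-Schwinger equation -/

/-- The coefficients of the series of the connected diagrams whose first terminal chord has
decoration `k`. -/
def headCoeff (s : ℕ) (a : ℕ → ℕ → K) (k n : ℕ) : K[X] :=
  ∑ C ∈ connectedDiagrams n, ((C.weight s : K) * headAmplitude a C.word) •
    if headDec C.word = k then dividedPower K (headIdx C.word) else 0

/-- The coefficients of `1 - G` in terms of diagrams. -/
def chordCoeff (s : ℕ) (a : ℕ → ℕ → K) (n : ℕ) : K[X] :=
  ∑ C ∈ connectedDiagrams n, ((C.weight s : K) * headAmplitude a C.word) •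
    insertion a (headDec C.word) (dividedPower K (headIdx C.word))

/-- The coefficients of the anomalous dimension in terms of diagrams. -/
def anomalousCoeff (s : ℕ) (a : ℕ → ℕ → K) (n : ℕ) : K :=
  ∑ C ∈ connectedDiagrams n, (C.weight s : K) * amplitude a 0 C.word

/-- The solution of the Dyson-Schwinger equation as a series indexed by diagrams. -/
def chordSolution (s : ℕ) (a : ℕ → ℕ → K) : K[X]⟦X⟧ := 1 - PowerSeries.mk (chordCoeff s a)

lemma connectedDiagrams_zero : connectedDiagrams 0 = ∅ := by
  refine Finset.eq_empty_of_forall_notMem fun C hC => ?_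
  obtain ⟨h1, h2⟩ := mem_connectedDiagrams.1 hC
  obtain ⟨c, hc⟩ := h2.1
  rw [DecoratedDiagram.size, Finset.sum_eq_zero_iff] at h1
  have := C.dec_pos c hc
  rw [h1 c hc] at this
  exact lt_irrefl _ this

lemma DecoratedDiagram.word_of_card {C : DecoratedDiagram} (h : C.chords.card = 1) {n : ℕ}
    (hn : C.size = n) : C.word = [(true, n)] := by
  rw [word_of_card_eq_one h, ← size_of_card_eq_one h, hn]

lemma exists_headIdx_eq_succ {n : ℕ} {C : DecoratedDiagram} (h : C ∈ connectedDiagrams n)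
    (h2 : 2 ≤ C.chords.card) : ∃ i, headIdx C.word = i + 1 := by
  obtain ⟨C₁, C₂, p, hi⟩ := exists_eq_isDecInsertion (mem_connectedDiagrams.1 h).2 h2
  exact ⟨_, hi.headIdx_eq⟩

lemma sum_connectedDiagrams_split {M : Type*} [AddCommMonoid M] {n : ℕ}
    (f : DecoratedDiagram → M) : ∑ C ∈ connectedDiagrams n, f C =
      ∑ C ∈ connectedDiagrams n with 2 ≤ C.chords.card, f C +
        ∑ C ∈ connectedDiagrams n with ¬ 2 ≤ C.chords.card, f C :=
  (Finset.sum_filter_add_sum_filter_not _ _ _).symm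

lemma negDeriv_headCoeff [CharZero K] {s : ℕ} (hs : 1 ≤ s) (a : ℕ → ℕ → K) (k n : ℕ) :
    negDeriv K (headCoeff s a k n) = ∑ q ∈ Finset.HasAntidiagonal.antidiagonal n,
      (anomalousCoeff s a q.1 * ((s : K) * q.2 - 1)) • headCoeff s a k q.2 := by
  have h := sum_insertions hs a (fun d i =>
    negDeriv K (if d = k then dividedPower K i else 0)) n
  have e : ∀ d i, negDeriv K (if d = k then dividedPower K (i + 1) else 0) =
      if d = k then dividedPower K i else 0 := fun d i => by
    split_ifs
    · exact negDeriv_dividedPower_succ i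
    · exact map_zero _
  simp only [e] at h
  unfold headCoeff anomalousCoeff
  rw [← h, map_sum, sum_connectedDiagrams_split]
  simp only [Derivation.map_smul]
  rw [add_eq_left]
  refine Finset.sum_eq_zero fun C hC => ?_
  obtain ⟨hC, h2⟩ := Finset.mem_filter.1 hC
  obtain ⟨h3, h4⟩ := mem_connectedDiagrams.1 hC
  have h5 := h4.1.card_pos
  rw [DecoratedDiagram.word_of_card (by omega) h3, headDec, headIdx]
  split_ifs
  · rw [negDeriv_dividedPower_zero, smul_zero]
  · rw [map_zero, smul_zero]

lemma negDeriv_chordCoeff [CharZero K] {s : ℕ} (hs : 1 ≤ s) (a : ℕ → ℕ → K) (n : ℕ) :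
    negDeriv K (chordCoeff s a n) = anomalousCoeff s a n • 1 +
      ∑ q ∈ Finset.HasAntidiagonal.antidiagonal n,
        (anomalousCoeff s a q.1 * ((s : K) * q.2 - 1)) • chordCoeff s a q.2 := by
  have h := sum_insertions hs a (fun d i =>
    Nat.casesOn (motive := fun _ => K[X]) i 0 fun i => insertion a d (dividedPower K i)) n
  unfold chordCoeff anomalousCoeff
  rw [← h, map_sum, Finset.sum_smul, sum_connectedDiagrams_split,
    sum_connectedDiagrams_split (fun C => ((C.weight s : K) * amplitude a 0 C.word) • (1 : K[X])),
    add_right_comm, ← Finset.sum_add_distrib]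
  congr 1
  · refine Finset.sum_congr rfl fun C hC => ?_
    obtain ⟨hC, h2⟩ := Finset.mem_filter.1 hC
    obtain ⟨i, hi⟩ := exists_headIdx_eq_succ hC h2
    rw [Derivation.map_smul, amplitude_eq a
      (DecoratedDiagram.endsTerminal_word (mem_connectedDiagrams.1 hC).2), hi,
      negDeriv_insertion_succ, smul_add, smul_smul, mul_assoc, add_zero]
  · refine Finset.sum_congr rfl fun C hC => ?_
    obtain ⟨hC, h2⟩ := Finset.mem_filter.1 hC
    obtain ⟨h3, h4⟩ := mem_connectedDiagrams.1 hC
    have h5 := h4.1.card_pos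
    rw [DecoratedDiagram.word_of_card (by omega) h3, headDec, headIdx, Derivation.map_smul,
      negDeriv_insertion_zero, smul_smul]
    simp [amplitude, headAmplitude]

variable (s : ℕ) (a : ℕ → ℕ → K)

/-- The anomalous dimension in terms of diagrams. -/
def anomalousDim : K[X]⟦X⟧ := PowerSeries.mk fun n => Polynomial.C (anomalousCoeff s a n)

lemma coeff_zero_anomalousDim : PowerSeries.coeff 0 (anomalousDim s a) = 0 := by
  rw [anomalousDim, PowerSeries.coeff_mk, anomalousCoeff, connectedDiagrams_zero,
    Finset.sum_empty, map_zero]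

variable {s}

lemma coeffDeriv_headSeries [CharZero K] (hs : 1 ≤ s) (k : ℕ) :
    coeffDeriv K (PowerSeries.mk (headCoeff s a k)) = anomalousDim s a *
      ((s : K[X]⟦X⟧) * euler (PowerSeries.mk (headCoeff s a k)) -
        PowerSeries.mk (headCoeff s a k)) := by
  ext1 n
  rw [coeff_coeffDeriv, PowerSeries.coeff_mk, negDeriv_headCoeff hs, PowerSeries.coeff_mul]
  refine Finset.sum_congr rfl fun q _ => ?_
  rw [anomalousDim, map_sub, ← map_natCast (PowerSeries.C (R := K[X])), PowerSeries.coeff_C_mul,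
    coeff_euler, PowerSeries.coeff_mk, PowerSeries.coeff_mk, Polynomial.smul_eq_C_mul]
  simp only [map_mul, map_sub, map_natCast, map_one]
  ring

lemma coeffDeriv_chordSolution [CharZero K] (hs : 1 ≤ s) :
    coeffDeriv K (chordSolution s a) = anomalousDim s a *
      ((s : K[X]⟦X⟧) * euler (chordSolution s a) - chordSolution s a) := by
  have h : coeffDeriv K (PowerSeries.mk (chordCoeff s a)) = anomalousDim s a +
      anomalousDim s a * ((s : K[X]⟦X⟧) * euler (PowerSeries.mk (chordCoeff s a)) -
        PowerSeries.mk (chordCoeff s a)) := by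
    ext1 n
    rw [coeff_coeffDeriv, PowerSeries.coeff_mk, negDeriv_chordCoeff hs, map_add,
      PowerSeries.coeff_mul]
    congr 1
    · rw [anomalousDim, PowerSeries.coeff_mk, Polynomial.smul_eq_C_mul, mul_one]
    · refine Finset.sum_congr rfl fun q _ => ?_
      rw [anomalousDim, map_sub, ← map_natCast (PowerSeries.C (R := K[X])),
        PowerSeries.coeff_C_mul, coeff_euler, PowerSeries.coeff_mk, PowerSeries.coeff_mk,
        Polynomial.smul_eq_C_mul]
      simp only [map_mul, map_sub, map_natCast, map_one]
      ring
  rw [chordSolution, map_sub, h, coeffDeriv_one, euler_sub, euler_one]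
  ring

lemma map_eval_chordSolution [CharZero K] :
    PowerSeries.map Polynomial.constantCoeff (chordSolution s a) = 1 := by
  rw [chordSolution, map_sub, map_one, sub_eq_self]
  ext n
  rw [PowerSeries.coeff_map, PowerSeries.coeff_mk, map_zero, chordCoeff, map_sum]
  refine Finset.sum_eq_zero fun C _ => ?_
  rw [Polynomial.constantCoeff_apply, Polynomial.coeff_smul, coeff_zero_insertion, smul_zero]

lemma map_eval_headSeries {k : ℕ} (hk : 1 ≤ k) :
    PowerSeries.map Polynomial.constantCoeff (PowerSeries.mk (headCoeff s a k)) =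
      PowerSeries.X ^ k := by
  ext n
  rw [PowerSeries.coeff_map, PowerSeries.coeff_mk, PowerSeries.coeff_X_pow, headCoeff]
  rcases Nat.eq_zero_or_pos n with rfl | hn
  · rw [connectedDiagrams_zero, Finset.sum_empty, map_zero, if_neg (by omega)]
  rw [sum_connectedDiagrams_split, map_add, map_sum, map_sum, Finset.sum_eq_zero, zero_add]
  · refine sum_card_eq_one hn _ _ fun C h1 h2 => ?_
    rw [DecoratedDiagram.word_of_card h1 h2, DecoratedDiagram.weight_of_card_eq_one s h1]
    have hd : headDec [(true, n)] = n := rfl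
    by_cases h : n = k
    · rw [if_pos h, if_pos (hd.trans h)]
      simp [coeff_dividedPower, headIdx, headAmplitude, amplitude]
    · rw [if_neg h, if_neg (hd ▸ h)]
      simp
  · intro C hC
    obtain ⟨hC, h2⟩ := Finset.mem_filter.1 hC
    obtain ⟨i, hi⟩ := exists_headIdx_eq_succ hC h2
    rw [hi]
    split_ifs <;> simp [coeff_dividedPower]

lemma headSeries_mul_pow [CharZero K] (hs : 1 ≤ s) {k : ℕ} (hk : 1 ≤ k) :
    PowerSeries.mk (headCoeff s a k) * chordSolution s a ^ (s * k - 1) = PowerSeries.X ^ k := by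
  rw [← sub_eq_zero]
  obtain ⟨δ, hδ⟩ : ∃ δ : K[X]⟦X⟧ → K[X]⟦X⟧, ∀ f, δ f =
      coeffDeriv K f - anomalousDim s a * (s : K[X]⟦X⟧) * euler f := ⟨_, fun _ => rfl⟩
  have hone : δ 1 = 0 := by rw [hδ, coeffDeriv_one, euler_one, mul_zero, sub_zero]
  have hmul : ∀ x y, δ (x * y) = x * δ y + y * δ x := fun x y => by
    rw [hδ, hδ, hδ, coeffDeriv_mul, euler_mul]
    ring
  have h1 : δ (PowerSeries.mk (headCoeff s a k)) =
      -anomalousDim s a * PowerSeries.mk (headCoeff s a k) := by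
    rw [hδ, coeffDeriv_headSeries a hs]
    ring
  have h2 : δ (chordSolution s a) = -anomalousDim s a * chordSolution s a := by
    rw [hδ, coeffDeriv_chordSolution a hs]
    ring
  have h3 : δ (PowerSeries.X ^ k) =
      -(anomalousDim s a * (s : K[X]⟦X⟧) * (k : K[X]⟦X⟧)) * PowerSeries.X ^ k := by
    have hX : δ PowerSeries.X = -(anomalousDim s a * (s : K[X]⟦X⟧)) * PowerSeries.X := by
      have e1 : coeffDeriv K PowerSeries.X = 0 := by
        ext1 n
        rw [coeff_coeffDeriv, PowerSeries.coeff_X, map_zero]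
        split_ifs
        · exact Derivation.map_one_eq_zero _
        · exact map_zero _
      have e2 : euler (PowerSeries.X : K[X]⟦X⟧) = PowerSeries.X := by
        ext1 n
        rw [coeff_euler, PowerSeries.coeff_X]
        split_ifs with h <;> simp [h]
      rw [hδ, e1, e2]
      ring
    rw [map_pow_of_leibniz hone hmul hX]
    ring
  have hcast : ((s * k - 1 : ℕ) : K[X]⟦X⟧) + 1 = s * k := by
    have : 0 < s * k := Nat.mul_pos hs hk
    rw [← Nat.cast_mul, ← Nat.cast_add_one, Nat.sub_add_cancel this]
  have h4 := map_pow_of_leibniz hone hmul h2 (s * k - 1)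
  refine eq_zero_of_coeffDeriv_eq (γ := anomalousDim s a) (s := (s : K[X]))
    (c := -((s * k : ℕ) : K[X])) (coeff_zero_anomalousDim s a) ?_ ?_
  · have h5 : δ (PowerSeries.mk (headCoeff s a k) * chordSolution s a ^ (s * k - 1) -
        PowerSeries.X ^ k) = -(anomalousDim s a * (s : K[X]⟦X⟧) * (k : K[X]⟦X⟧)) *
        (PowerSeries.mk (headCoeff s a k) * chordSolution s a ^ (s * k - 1) -
        PowerSeries.X ^ k) := by
      have hsub : ∀ x y, δ (x - y) = δ x - δ y := fun x y => by
        rw [hδ, hδ, hδ, map_sub, euler_sub]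
        ring
      rw [hsub, hmul, h1, h3, h4]
      linear_combination (-anomalousDim s a * PowerSeries.mk (headCoeff s a k) *
        chordSolution s a ^ (s * k - 1)) * hcast
    rw [hδ] at h5
    rw [map_neg, map_natCast, map_natCast, Nat.cast_mul]
    linear_combination h5
  · intro n
    have h6 : PowerSeries.map Polynomial.constantCoeff (PowerSeries.mk (headCoeff s a k) *
        chordSolution s a ^ (s * k - 1) - PowerSeries.X ^ k) = 0 := by
      rw [map_sub, map_mul, map_pow, map_pow, map_eval_chordSolution, map_eval_headSeries a hk,
        one_pow, mul_one, PowerSeries.map_X, sub_self]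
    have h7 := congrArg (PowerSeries.coeff n) h6
    rwa [PowerSeries.coeff_map, map_zero, Polynomial.constantCoeff_apply] at h7

lemma headDec_mem_Icc {n : ℕ} {C : DecoratedDiagram} (hC : C ∈ connectedDiagrams n) :
    headDec C.word ∈ Finset.Icc 1 n := by
  obtain ⟨hsize, hconn⟩ := mem_connectedDiagrams.1 hC
  have hmem : ∀ w : List (Bool × ℕ), EndsTerminal w → ∃ b, (b, headDec w) ∈ w := by
    intro w hw
    induction w with
    | nil => exact absurd hw not_endsTerminal_nil
    | cons x w ih =>
      obtain ⟨b, d⟩ := x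
      cases b
      · rcases endsTerminal_cons.1 hw with ⟨-, h⟩ | h
        · exact absurd h (by simp)
        · obtain ⟨b, hb⟩ := ih h
          exact ⟨b, List.mem_cons_of_mem _ hb⟩
      · exact ⟨true, List.mem_cons_self⟩
  obtain ⟨b, hb⟩ := hmem _ (DecoratedDiagram.endsTerminal_word hconn)
  obtain ⟨c, hc, he⟩ := List.mem_map.1 hb
  have hc' := mem_intersectionOrder.1 hc
  rw [← (Prod.mk.inj he).2, Finset.mem_Icc, ← hsize]
  exact ⟨C.dec_pos c hc', Finset.single_le_sum (f := C.dec) (fun _ _ => Nat.zero_le _) hc'⟩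

lemma chordCoeff_eq_sum (n : ℕ) :
    chordCoeff s a n = ∑ k ∈ Finset.Icc 1 n, insertion a k (headCoeff s a k n) := by
  have h : ∀ k, insertion a k (headCoeff s a k n) = ∑ C ∈ connectedDiagrams n,
      if headDec C.word = k then ((C.weight s : K) * headAmplitude a C.word) •
        insertion a (headDec C.word) (dividedPower K (headIdx C.word)) else 0 := by
    intro k
    change insertionMap a k _ = _
    rw [headCoeff, map_sum]
    refine Finset.sum_congr rfl fun C _ => ?_
    rw [map_smul]
    split_ifs with hk
    · rw [← hk]
      rfl
    · rw [map_zero, smul_zero]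
  rw [Finset.sum_congr rfl fun k _ => h k, Finset.sum_comm, chordCoeff]
  refine Finset.sum_congr rfl fun C hC => ?_
  rw [Finset.sum_ite_eq, if_pos (headDec_mem_Icc hC)]

lemma constantCoeff_chordSolution : PowerSeries.constantCoeff (chordSolution s a) = 1 := by
  rw [chordSolution, map_sub, map_one, ← PowerSeries.coeff_zero_eq_constantCoeff_apply,
    PowerSeries.coeff_mk, chordCoeff, connectedDiagrams_zero, Finset.sum_empty, sub_zero]

lemma isDysonSchwingerSolution_chordSolution [CharZero K] (hs : 1 ≤ s) :
    IsDysonSchwingerSolution s a (chordSolution s a) := by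
  have hinv := PowerSeries.mul_invOfUnit (chordSolution s a) 1 (constantCoeff_chordSolution a)
  unfold IsDysonSchwingerSolution
  conv_lhs => rw [chordSolution]
  congr 2
  funext n
  rw [chordCoeff_eq_sum]
  refine Finset.sum_congr rfl fun k hk => ?_
  rw [Finset.mem_Icc] at hk
  congr 1
  have h := headSeries_mul_pow a hs hk.1
  have h2 : PowerSeries.mk (headCoeff s a k) =
      PowerSeries.X ^ k * PowerSeries.invOfUnit (chordSolution s a) 1 ^ (s * k - 1) := by
    rw [← h, mul_assoc, ← mul_pow, hinv, one_pow, mul_one]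
  have h3 := congrArg (PowerSeries.coeff n) h2
  rwa [PowerSeries.coeff_mk, PowerSeries.coeff_X_pow_mul', if_pos hk.2] at h3

variable {a}

lemma IsDysonSchwingerSolution.constantCoeff_eq {G : K[X]⟦X⟧}
    (h : IsDysonSchwingerSolution s a G) : PowerSeries.constantCoeff G = 1 := by
  have h1 := congrArg (PowerSeries.coeff 0) h
  rw [PowerSeries.coeff_zero_eq_constantCoeff_apply] at h1
  simpa using h1

lemma IsDysonSchwingerSolution.eq {G G' : K[X]⟦X⟧} (h : IsDysonSchwingerSolution s a G)
    (h' : IsDysonSchwingerSolution s a G') : G = G' := by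
  have i := PowerSeries.mul_invOfUnit G 1 h.constantCoeff_eq
  have i' := PowerSeries.mul_invOfUnit G' 1 h'.constantCoeff_eq
  set I := PowerSeries.invOfUnit G 1
  set I' := PowerSeries.invOfUnit G' 1
  ext1 n
  induction n using Nat.strong_induction_on with
  | _ n ih =>
    have hdvd : (PowerSeries.X : K[X]⟦X⟧) ^ n ∣ G' - G := by
      rw [PowerSeries.X_pow_dvd_iff]
      intro m hm
      rw [map_sub, ih m hm, sub_self]
    have hI : (PowerSeries.X : K[X]⟦X⟧) ^ n ∣ I - I' := by
      have e : I - I' = I * I' * (G' - G) := by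
        linear_combination I' * i - I * i'
      rw [e]
      exact hdvd.mul_left _
    have hpow : ∀ m j, j < n → PowerSeries.coeff j (I ^ m) = PowerSeries.coeff j (I' ^ m) := by
      intro m j hj
      have h2 := PowerSeries.X_pow_dvd_iff.1 (hI.trans (sub_dvd_pow_sub_pow I I' m)) j hj
      rwa [map_sub, sub_eq_zero] at h2
    rw [show G = _ from h, show G' = _ from h', map_sub, map_sub, PowerSeries.coeff_mk,
      PowerSeries.coeff_mk]
    congr 1
    refine Finset.sum_congr rfl fun k hk => ?_
    rw [Finset.mem_Icc] at hk
    rw [hpow _ _ (by omega)]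

/-- The solution of the Dyson-Schwinger equation in terms of diagrams. -/
lemma IsDysonSchwingerSolution.coeff_sub_one [CharZero K] (hs : 1 ≤ s) {G : K[X]⟦X⟧}
    (h : IsDysonSchwingerSolution s a G) (n : ℕ) :
    PowerSeries.coeff n (G - 1) = -chordCoeff s a n := by
  rw [h.eq (isDysonSchwingerSolution_chordSolution a hs), chordSolution, sub_sub_cancel_left,
    map_neg, PowerSeries.coeff_mk]

lemma coeff_insertion_dividedPower [CharZero K] (k n : ℕ) {i : ℕ} (hi : 1 ≤ i) :
    (insertion a k (dividedPower K n)).coeff i =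
      if i ≤ n + 1 then a k (n + 1 - i) * ((-1) ^ i * (i.factorial : K)⁻¹) else 0 := by
  rw [insertion_dividedPower, coeff_kernel, Polynomial.finsetSum_coeff]
  simp only [Polynomial.coeff_smul, coeff_dividedPower, smul_eq_mul, mul_ite, mul_zero]
  split_ifs with h
  · rw [Finset.sum_eq_single (i - 1, n + 1 - i)]
    · rw [if_pos (by simp only; omega), show i - 1 + 1 = i by omega]
    · intro q hq hne
      rw [Finset.HasAntidiagonal.mem_antidiagonal] at hq
      rw [if_neg]
      intro h1
      exact hne (Prod.ext (by simp only; omega) (by simp only; omega))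
    · intro hq
      rw [Finset.HasAntidiagonal.mem_antidiagonal] at hq
      simp only at hq
      omega
  · refine Finset.sum_eq_zero fun q hq => ?_
    rw [Finset.HasAntidiagonal.mem_antidiagonal] at hq
    rw [if_neg (by omega)]

lemma IsDysonSchwingerSolution.coeff_coeff [CharZero K] (hs : 1 ≤ s) {G : K[X]⟦X⟧}
    (h : IsDysonSchwingerSolution s a G) (n : ℕ) {i : ℕ} (hi : 1 ≤ i) :
    (PowerSeries.coeff n (G - 1)).coeff i = -∑ C ∈ connectedDiagrams n,
      (C.weight s : K) * headAmplitude a C.word * if i ≤ headIdx C.word + 1 then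
        a (headDec C.word) (headIdx C.word + 1 - i) * ((-1) ^ i * (i.factorial : K)⁻¹) else 0 := by
  rw [h.coeff_sub_one hs, Polynomial.coeff_neg, chordCoeff, Polynomial.finsetSum_coeff]
  congr 1
  refine Finset.sum_congr rfl fun C _ => ?_
  rw [Polynomial.coeff_smul, coeff_insertion_dividedPower _ _ hi, smul_eq_mul]

lemma IsDysonSchwingerSolution.coeff_coeff_zero [CharZero K] (hs : 1 ≤ s) {G : K[X]⟦X⟧}
    (h : IsDysonSchwingerSolution s a G) (n : ℕ) :
    (PowerSeries.coeff n (G - 1)).coeff 0 = 0 := by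
  rw [h.coeff_sub_one hs, Polynomial.coeff_neg, chordCoeff, Polynomial.finsetSum_coeff,
    neg_eq_zero]
  refine Finset.sum_eq_zero fun C _ => ?_
  rw [Polynomial.coeff_smul, coeff_zero_insertion, smul_zero]

end analysis

/-! ### Types and words -/

/-- The pairs (decoration, distance from the previous terminal letter) of the terminal letters of
a word, where `g` is the distance from the last terminal letter to the first letter. -/
def gaps : ℕ → List (Bool × ℕ) → List (ℕ × ℕ)
  | _, [] => []
  | g, (false, _) :: w => gaps (g + 1) w
  | g, (true, d) :: w => (d, g) :: gaps 1 w

/-- The same list for the terminal letters after the first one. -/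
def headGaps : List (Bool × ℕ) → List (ℕ × ℕ)
  | [] => []
  | (false, _) :: w => headGaps w
  | (true, _) :: w => gaps 1 w

/-- The decorations of the letters that are not terminal. -/
def nonterminalDecs (w : List (Bool × ℕ)) : List ℕ := (w.filter fun x => !x.1).map Prod.snd

@[simp] lemma nonterminalDecs_nil : nonterminalDecs [] = [] := rfl

@[simp] lemma nonterminalDecs_false (d : ℕ) (w : List (Bool × ℕ)) :
    nonterminalDecs ((false, d) :: w) = d :: nonterminalDecs w := rfl

@[simp] lemma nonterminalDecs_true (d : ℕ) (w : List (Bool × ℕ)) :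
    nonterminalDecs ((true, d) :: w) = nonterminalDecs w := rfl

section words

variable {K : Type*} [CommRing K] (a : ℕ → ℕ → K)

lemma amplitude_eq_prod (w : List (Bool × ℕ)) (g : ℕ) : amplitude a g w =
    ((nonterminalDecs w).map fun d => a d 0).prod * ((gaps g w).map fun p => a p.1 p.2).prod := by
  induction w generalizing g with
  | nil => simp [amplitude, gaps]
  | cons x w ih =>
    obtain ⟨b, d⟩ := x
    cases b
    · simp only [amplitude, gaps, ih, nonterminalDecs_false, List.map_cons, List.prod_cons]
      ring
    · simp only [amplitude, gaps, ih, nonterminalDecs_true, List.map_cons, List.prod_cons]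
      ring

lemma headAmplitude_eq_prod (w : List (Bool × ℕ)) : headAmplitude a w =
    ((nonterminalDecs w).map fun d => a d 0).prod *
      ((headGaps w).map fun p => a p.1 p.2).prod := by
  induction w with
  | nil => simp [headAmplitude, headGaps]
  | cons x w ih =>
    obtain ⟨b, d⟩ := x
    cases b
    · simp only [headAmplitude, headGaps, ih, nonterminalDecs_false, List.map_cons, List.prod_cons]
      ring
    · simp only [headAmplitude, headGaps, amplitude_eq_prod, nonterminalDecs_true]

lemma prod_map_eq_mul_pow (l : List ℕ) : (l.map fun d => a d 0).prod =
    ((l.filter (· ≠ 1)).map fun d => a d 0).prod * a 1 0 ^ (l.sum - (l.filter (· ≠ 1)).sum) ∧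
      (l.filter (· ≠ 1)).sum ≤ l.sum := by
  induction l with
  | nil => simp
  | cons d l ih =>
    obtain ⟨ih1, ih2⟩ := ih
    by_cases h : d = 1
    · subst h
      rw [List.filter_cons_of_neg (by simp), List.map_cons, List.prod_cons, List.sum_cons, ih1]
      refine ⟨?_, by omega⟩
      rw [show 1 + l.sum - (l.filter (· ≠ 1)).sum = (l.sum - (l.filter (· ≠ 1)).sum) + 1 by omega]
      ring
    · rw [List.filter_cons_of_pos (by simpa using h), List.map_cons, List.prod_cons,
        List.sum_cons, List.sum_cons, List.map_cons, List.prod_cons, ih1, Nat.add_sub_add_left]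
      exact ⟨by ring, by omega⟩

end words

lemma sum_snd_eq_gaps (w : List (Bool × ℕ)) (g : ℕ) : (w.map Prod.snd).sum =
    (nonterminalDecs w).sum + ((gaps g w).map Prod.fst).sum := by
  induction w generalizing g with
  | nil => simp [gaps]
  | cons x w ih =>
    obtain ⟨b, d⟩ := x
    cases b
    · simp only [gaps, ih (g + 1), nonterminalDecs_false, List.map_cons, List.sum_cons]
      ring
    · simp only [gaps, ih 1, nonterminalDecs_true, List.map_cons, List.sum_cons]
      ring

lemma sum_snd_eq_headGaps (w : List (Bool × ℕ)) : (w.map Prod.snd).sum =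
    (nonterminalDecs w).sum + ((headGaps w).map Prod.fst).sum + headDec w := by
  induction w with
  | nil => simp [headGaps, headDec]
  | cons x w ih =>
    obtain ⟨b, d⟩ := x
    cases b
    · simp only [headGaps, headDec, ih, nonterminalDecs_false, List.map_cons, List.sum_cons]
      ring
    · simp only [headGaps, headDec, sum_snd_eq_gaps w 1, nonterminalDecs_true, List.map_cons,
        List.sum_cons]
      ring

lemma sum_snd_add_gap {w : List (Bool × ℕ)} {g : ℕ} (hw : EndsTerminal w ∨ (w = [] ∧ g = 1))
    (hpos : ∀ x ∈ w, 0 < x.2) : (w.map Prod.snd).sum + g =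
    1 + ((gaps g w).map fun p => p.1 + p.2 - 1).sum +
      ((nonterminalDecs w).map fun d => d - 1).sum := by
  induction w generalizing g with
  | nil =>
    rcases hw with hw | ⟨-, rfl⟩
    · exact absurd hw not_endsTerminal_nil
    · simp [gaps]
  | cons x w ih =>
    obtain ⟨b, d⟩ := x
    have hd : 0 < d := hpos _ List.mem_cons_self
    have hpos' : ∀ x ∈ w, 0 < x.2 := fun x hx => hpos x (List.mem_cons_of_mem _ hx)
    have hw := endsTerminal_cons.1 (hw.resolve_right (by simp))
    cases b
    · have h := ih (g := g + 1) (Or.inl (hw.resolve_left (by simp))) hpos'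
      simp only [gaps, nonterminalDecs_false, List.map_cons, List.sum_cons]
      omega
    · have h := ih (g := 1) (hw.symm.imp_right fun h => ⟨h.1, rfl⟩) hpos'
      simp only [gaps, nonterminalDecs_true, List.map_cons, List.sum_cons]
      omega

lemma sum_snd_eq_headIdx {w : List (Bool × ℕ)} (hw : EndsTerminal w) (hpos : ∀ x ∈ w, 0 < x.2) :
    (w.map Prod.snd).sum = headIdx w + 1 + (((headGaps w).map fun p => p.1 + p.2 - 1).sum +
      ((nonterminalDecs w).map fun d => d - 1).sum + (headDec w - 1)) := by
  induction w with
  | nil => exact absurd hw not_endsTerminal_nil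
  | cons x w ih =>
    obtain ⟨b, d⟩ := x
    have hd : 0 < d := hpos _ List.mem_cons_self
    have hpos' : ∀ x ∈ w, 0 < x.2 := fun x hx => hpos x (List.mem_cons_of_mem _ hx)
    have hw := endsTerminal_cons.1 hw
    cases b
    · have h := ih (hw.resolve_left (by simp)) hpos'
      simp only [headGaps, headDec, headIdx, nonterminalDecs_false, List.map_cons, List.sum_cons]
      omega
    · have h := sum_snd_add_gap (g := 1) (hw.symm.imp_right fun h => ⟨h.1, rfl⟩) hpos'
      simp only [headGaps, headDec, headIdx, nonterminalDecs_true, List.map_cons, List.sum_cons]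
      omega

lemma pos_of_mem_gaps {w : List (Bool × ℕ)} {g : ℕ} (hg : 0 < g) (hpos : ∀ x ∈ w, 0 < x.2) :
    ∀ p ∈ gaps g w, 0 < p.1 ∧ 0 < p.2 := by
  induction w generalizing g with
  | nil => simp [gaps]
  | cons x w ih =>
    obtain ⟨b, d⟩ := x
    have hd : 0 < d := hpos _ List.mem_cons_self
    have hpos' : ∀ x ∈ w, 0 < x.2 := fun x hx => hpos x (List.mem_cons_of_mem _ hx)
    cases b
    · exact ih g.succ_pos hpos'
    · intro p hp
      rcases List.mem_cons.1 hp with rfl | hp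
      · exact ⟨hd, hg⟩
      · exact ih one_pos hpos' p hp

lemma pos_of_mem_headGaps {w : List (Bool × ℕ)} (hpos : ∀ x ∈ w, 0 < x.2) :
    ∀ p ∈ headGaps w, 0 < p.1 ∧ 0 < p.2 := by
  induction w with
  | nil => simp [headGaps]
  | cons x w ih =>
    obtain ⟨b, d⟩ := x
    have hpos' : ∀ x ∈ w, 0 < x.2 := fun x hx => hpos x (List.mem_cons_of_mem _ hx)
    cases b
    · exact ih hpos'
    · exact pos_of_mem_gaps one_pos hpos'

section lists

variable {α : Type*} [BEq α] [LawfulBEq α] {T : α → Prop} [DecidablePred T] {d : α → ℕ}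

lemma zip_filter_eq_gaps {o l₀ l : List α} (ho : o.Nodup) (h : o = l₀ ++ l) {c₀ : α}
    (hc₀ : c₀ ∈ l₀) :
    ((c₀ :: l.filter (fun c => T c)).zip (l.filter fun c => T c)).map
      (fun q => (d q.2, o.idxOf q.2 + 1 - (o.idxOf q.1 + 1))) =
    gaps (l₀.length - o.idxOf c₀) (l.map fun c => (decide (T c), d c)) := by
  induction l generalizing l₀ c₀ with
  | nil => rfl
  | cons c l ih =>
    have h' : o = (l₀ ++ [c]) ++ l := by rw [h]; simp
    have hlt : o.idxOf c₀ < l₀.length := by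
      rw [h, List.idxOf_append_of_mem hc₀]
      exact List.idxOf_lt_length_iff.2 hc₀
    have hidx : o.idxOf c = l₀.length := by
      have hn : c ∉ l₀ := by
        rw [h] at ho
        exact fun hc => (List.nodup_append.1 ho).2.2 c hc c List.mem_cons_self rfl
      rw [h, List.idxOf_append_of_notMem hn, List.idxOf_cons_self, add_zero]
    by_cases hT : T c
    · rw [List.filter_cons_of_pos (by simpa using hT), List.zip_cons_cons, List.map_cons,
        ih h' (by simp), List.map_cons, decide_eq_true hT, gaps, hidx]
      congr 2
      · rw [Nat.add_sub_add_right]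
      · rw [List.length_append, List.length_singleton, Nat.add_sub_cancel_left]
    · rw [List.filter_cons_of_neg (by simpa using hT), ih h' (by simp [hc₀]), List.map_cons,
        decide_eq_false hT, gaps]
      congr 1
      rw [List.length_append, List.length_singleton]
      omega

lemma zip_filter_tail_eq_headGaps {o l₀ l : List α} (ho : o.Nodup) (h : o = l₀ ++ l) :
    ((l.filter (fun c => T c)).zip (l.filter fun c => T c).tail).map
      (fun q => (d q.2, o.idxOf q.2 + 1 - (o.idxOf q.1 + 1))) =
    headGaps (l.map fun c => (decide (T c), d c)) := by
  induction l generalizing l₀ with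
  | nil => rfl
  | cons c l ih =>
    have h' : o = (l₀ ++ [c]) ++ l := by rw [h]; simp
    have hidx : o.idxOf c = l₀.length := by
      have hn : c ∉ l₀ := by
        rw [h] at ho
        exact fun hc => (List.nodup_append.1 ho).2.2 c hc c List.mem_cons_self rfl
      rw [h, List.idxOf_append_of_notMem hn, List.idxOf_cons_self, add_zero]
    by_cases hT : T c
    · rw [List.filter_cons_of_pos (by simpa using hT), List.tail_cons,
        zip_filter_eq_gaps ho h' (by simp), List.map_cons, decide_eq_true hT, headGaps, hidx,
        List.length_append, List.length_singleton, Nat.add_sub_cancel_left]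
    · rw [List.filter_cons_of_neg (by simpa using hT), ih h', List.map_cons,
        decide_eq_false hT, headGaps]

omit [BEq α] [LawfulBEq α] in
lemma headD_filter_eq_headDec (l : List α) {x : α} (hx : d x = 0) :
    d ((l.filter fun c => T c).headD x) = headDec (l.map fun c => (decide (T c), d c)) := by
  induction l with
  | nil => exact hx
  | cons c l ih =>
    by_cases hT : T c
    · rw [List.filter_cons_of_pos (by simpa using hT), List.map_cons, decide_eq_true hT]
      rfl
    · rw [List.filter_cons_of_neg (by simpa using hT), ih, List.map_cons, decide_eq_false hT]
      rfl

omit [BEq α] [LawfulBEq α] in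
lemma map_filter_eq_nonterminalDecs (l : List α) :
    (l.filter fun c => ¬ T c ∧ d c ≠ 1).map d =
      (nonterminalDecs (l.map fun c => (decide (T c), d c))).filter (· ≠ 1) := by
  induction l with
  | nil => rfl
  | cons c l ih =>
    by_cases hT : T c
    · rw [List.filter_cons_of_neg (by simp [hT]), ih, List.map_cons, decide_eq_true hT,
        nonterminalDecs_true]
    · rw [List.map_cons, decide_eq_false hT, nonterminalDecs_false]
      by_cases hd : d c = 1
      · rw [List.filter_cons_of_neg (by simp [hd]), ih, List.filter_cons_of_neg (by simp [hd])]
      · rw [List.filter_cons_of_pos (by simp [hd, hT]), List.map_cons, ih,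
          List.filter_cons_of_pos (by simp [hd])]

end lists

namespace DecoratedDiagram

variable (C : DecoratedDiagram)

lemma type_delta : C.type.delta = headDec C.word := by
  classical
  refine Eq.trans ?_ (headD_filter_eq_headDec (T := fun c => C.IsTerminal c) _
    (C.dec_eq_zero (0, 0) fun h => lt_irrefl _ (C.fst_lt_snd _ h)))
  rfl

lemma type_G : C.type.G = ↑(headGaps C.word) := by
  classical
  refine congrArg _ (Eq.trans ?_ (zip_filter_tail_eq_headGaps
    (T := fun c => C.IsTerminal c) (d := C.dec) (l₀ := [])
    (nodup_intersectionOrder C.chords) rfl))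
  rfl

lemma type_D : C.type.D = ↑((nonterminalDecs C.word).filter (· ≠ 1)) := by
  classical
  rw [word, ← map_filter_eq_nonterminalDecs, ← Multiset.map_coe, ← Multiset.filter_coe]
  have h : (↑(intersectionOrder C.chords) : Multiset (ℕ × ℕ)) = C.chords.val := by
    rw [Multiset.coe_eq_coe.2 (perm_intersectionOrder C.chords), Finset.coe_toList]
  rw [h]
  simp only [type, Finset.filter_val]

lemma pos_of_mem_word : ∀ x ∈ C.word, 0 < x.2 := by
  intro x hx
  obtain ⟨c, hc, rfl⟩ := List.mem_map.1 hx
  exact C.dec_pos c (mem_intersectionOrder.1 hc)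

lemma size_eq_sum_word : C.size = (C.word.map Prod.snd).sum := by
  classical
  rw [word, List.map_map, size, Finset.sum_eq_multiset_sum, ← Finset.coe_toList,
    ← Multiset.coe_eq_coe.2 (perm_intersectionOrder C.chords), Multiset.map_coe, Multiset.sum_coe]
  rfl

lemma sum_sub_one_filter (l : List ℕ) :
    ((l.filter (· ≠ 1)).map fun d => d - 1).sum = (l.map fun d => d - 1).sum := by
  induction l with
  | nil => rfl
  | cons d l ih =>
    by_cases h : d = 1
    · rw [List.filter_cons_of_neg (by simp [h]), ih, List.map_cons, List.sum_cons, h]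
      simp
    · rw [List.filter_cons_of_pos (by simp [h]), List.map_cons, List.sum_cons, ih, List.map_cons,
        List.sum_cons]

variable {C}

lemma size_eq_headIdx_add_t (hC : C.Connected) : C.size = headIdx C.word + 1 + C.type.t := by
  rw [size_eq_sum_word, sum_snd_eq_headIdx (endsTerminal_word hC) C.pos_of_mem_word,
    DiagramType.t, type_delta, type_G, type_D, Multiset.map_coe, Multiset.map_coe,
    Multiset.sum_coe, Multiset.sum_coe, sum_sub_one_filter]

variable (C)

lemma decorationSum_le_size : C.type.decorationSum ≤ C.size := by
  have h := (prod_map_eq_mul_pow (K := ℤ) (fun _ _ => 1) (nonterminalDecs C.word)).2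
  rw [DiagramType.decorationSum, type_delta, type_G, type_D, Multiset.map_coe, Multiset.sum_coe,
    Multiset.sum_coe, size_eq_sum_word, sum_snd_eq_headGaps]
  omega

lemma headAmplitude_word {K : Type*} [CommRing K] (a : ℕ → ℕ → K) : headAmplitude a C.word =
    (C.type.D.map fun d => a d 0).prod * (C.type.G.map fun p => a p.1 p.2).prod *
      a 1 0 ^ (C.size - C.type.decorationSum) := by
  rw [headAmplitude_eq_prod, (prod_map_eq_mul_pow a _).1, DiagramType.decorationSum, type_delta,
    type_G, type_D, Multiset.map_coe, Multiset.map_coe, Multiset.map_coe, Multiset.sum_coe,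
    Multiset.sum_coe, Multiset.prod_coe, Multiset.prod_coe, size_eq_sum_word,
    sum_snd_eq_headGaps, mul_right_comm]
  congr 2
  omega

variable {C}

lemma valid_type (hC : C.Connected) : C.type.Valid := by
  refine ⟨?_, ?_, ?_⟩
  · rw [type_delta]
    have := headDec_mem_Icc (mem_connectedDiagrams.2 ⟨rfl, hC⟩)
    exact (Finset.mem_Icc.1 this).1
  · rw [type_G]
    intro p hp
    exact pos_of_mem_headGaps C.pos_of_mem_word p (Multiset.mem_coe.1 hp)
  · rw [type_D]
    intro d hd
    obtain ⟨h1, h2⟩ := List.mem_filter.1 (Multiset.mem_coe.1 hd)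
    obtain ⟨x, hx, rfl⟩ := List.mem_map.1 h1
    have := C.pos_of_mem_word x (List.mem_filter.1 hx).1
    have h3 : x.2 ≠ 1 := by simpa using h2
    omega

end DecoratedDiagram

/-! ### Finiteness of the number of types -/

lemma finite_multiset_of_card_le {α : Type*} [DecidableEq α] (S : Finset α) (k : ℕ) :
    {M : Multiset α | Multiset.card M ≤ k ∧ ∀ x ∈ M, x ∈ S}.Finite := by
  refine (Set.finite_Iic (k • S.val)).subset ?_
  rintro M ⟨h1, h2⟩
  rw [Set.mem_Iic, Multiset.le_iff_count]
  intro x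
  by_cases hx : x ∈ M
  · rw [Multiset.count_nsmul, Multiset.count_eq_one_of_mem S.nodup (h2 x hx), mul_one]
    exact (Multiset.count_le_card x M).trans h1
  · rw [Multiset.count_eq_zero_of_notMem hx]
    exact Nat.zero_le _

lemma le_sum_map {α : Type*} (M : Multiset α) (f : α → ℕ) {x : α} (hx : x ∈ M) :
    f x ≤ (M.map f).sum :=
  Multiset.single_le_sum (fun _ _ => Nat.zero_le _) _ (Multiset.mem_map_of_mem f hx)

lemma card_le_sum_map {α : Type*} (M : Multiset α) (f : α → ℕ) (h : ∀ x ∈ M, 0 < f x) :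
    Multiset.card M ≤ (M.map f).sum := by
  have := Multiset.card_nsmul_le_sum (s := M.map f) (a := 1) (by
    intro y hy
    obtain ⟨x, hx, rfl⟩ := Multiset.mem_map.1 hy
    exact h x hx)
  simpa using this

lemma finite_types (k : ℕ) : {T : DiagramType | T.Valid ∧ T.t ≤ k}.Finite := by
  have h1 := finite_multiset_of_card_le (Finset.range (k + 2) ×ˢ Finset.range (k + 2)) k
  have h2 := finite_multiset_of_card_le (Finset.range (k + 2)) k
  refine Set.Finite.of_finite_image (f := fun T : DiagramType => (T.delta, T.G, T.D))
    (((Set.finite_Iic (k + 1)).prod (h1.prod h2)).subset ?_) ?_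
  · rintro _ ⟨T, ⟨⟨v1, v2, v3⟩, ht⟩, rfl⟩
    rw [DiagramType.t] at ht
    refine ⟨?_, ⟨?_, ?_⟩, ?_, ?_⟩
    · simp only [Set.mem_Iic]
      omega
    · have := card_le_sum_map T.G (fun p => p.1 + p.2 - 1) fun p hp => by
        have := v2 p hp
        omega
      simp only
      omega
    · intro p hp
      have h3 := v2 p hp
      have h4 := le_sum_map T.G (fun p => p.1 + p.2 - 1) hp
      simp only [Finset.mem_product, Finset.mem_range] at h4 ⊢
      omega
    · have := card_le_sum_map T.D (fun d => d - 1) fun d hd => by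
        have := v3 d hd
        omega
      simp only
      omega
    · intro d hd
      have h3 := v3 d hd
      have h4 := le_sum_map T.D (fun d => d - 1) hd
      simp only [Finset.mem_range] at h4 ⊢
      omega
  · intro T _ T' _ h
    simp only [Prod.mk.injEq] at h
    exact DiagramType.ext h.1 h.2.1 h.2.2

/-! ### The log expansions -/

section expansion

variable {K : Type*} [Field K]

lemma factorial_mul_coeff_derivative_iterate {R : Type*} [CommRing R] (f : R⟦X⟧) (n m : ℕ) :
    (m.factorial : R) * PowerSeries.coeff m ((PowerSeries.derivative R)^[n] f) =
      ((m + n).factorial : R) * PowerSeries.coeff (m + n) f := by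
  induction n generalizing m with
  | zero => simp
  | succ n ih =>
    rw [Function.iterate_succ_apply', PowerSeries.coeff_derivative]
    have h := ih (m + 1)
    rw [Nat.factorial_succ, Nat.cast_mul, Nat.cast_add, Nat.cast_one,
      show m + 1 + n = m + (n + 1) by omega] at h
    linear_combination h

open Classical in
lemma coeff_derivative_typeGF [CharZero K] (s : ℕ) (T : DiagramType) (k m : ℕ) :
    PowerSeries.coeff m ((PowerSeries.derivative K)^[k] (typeGF K s T)) =
      (m.factorial : K)⁻¹ *
        ∑ C ∈ connectedDiagrams (m + k) with C.type = T, (C.weight s : K) := by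
  have h := factorial_mul_coeff_derivative_iterate (typeGF K s T) k m
  have hm : (m.factorial : K) ≠ 0 := Nat.cast_ne_zero.2 m.factorial_ne_zero
  have hmk : ((m + k).factorial : K) ≠ 0 := Nat.cast_ne_zero.2 (m + k).factorial_ne_zero
  rw [typeGF, weightedGF, PowerSeries.coeff_mk, mul_div_cancel₀ _ hmk] at h
  rw [eq_inv_mul_iff_mul_eq₀ hm]
  refine h.trans (Finset.sum_congr ?_ fun _ _ => rfl)
  ext C
  simp [connectedDiagrams, and_assoc]

lemma prod_map_div_pow {α : Type*} (M : Multiset α) (f : α → K) (c : K) (g : α → ℕ) :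
    (M.map fun x => f x / c ^ g x).prod = (M.map f).prod / c ^ (M.map g).sum := by
  rw [Multiset.prod_map_div]
  congr 1
  induction M using Multiset.induction_on with
  | empty => simp
  | cons x M ih => simp [ih, pow_add]

lemma typeTerm_eq_collectedTypeTerm [CharZero K] (s : ℕ) (a : ℕ → ℕ → K) (ha : a 1 0 ≠ 0) (k : ℕ)
    (T : DiagramType) : typeTerm s a k T = collectedTypeTerm s a k T := by
  classical
  ext m
  rw [typeTerm, collectedTypeTerm, PowerSeries.coeff_C_mul, PowerSeries.coeff_rescale,
    PowerSeries.coeff_mk]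
  by_cases h0 : PowerSeries.coeff m ((PowerSeries.derivative K)^[k] (typeGF K s T)) = 0
  · rw [h0]
    simp
  have hle : T.decorationSum ≤ m + k := by
    rw [coeff_derivative_typeGF] at h0
    obtain ⟨C, hC, -⟩ := Finset.exists_ne_zero_of_sum_ne_zero (right_ne_zero_of_mul h0)
    obtain ⟨hC', rfl⟩ := Finset.mem_filter.1 hC
    rw [← (mem_connectedDiagrams.1 hC').1]
    exact C.decorationSum_le_size
  have hD := prod_map_div_pow T.D (fun d => a d 0) (a 1 0) (fun d => d)
  rw [Multiset.map_id'] at hD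
  rw [hD, prod_map_div_pow T.G (fun p => a p.1 p.2) (a 1 0) Prod.fst]
  have hpow : a 1 0 ^ ((k : ℤ) - (T.delta : ℤ)) * a 1 0 ^ m =
      a 1 0 ^ (m + k - T.decorationSum) * (a 1 0 ^ T.D.sum * a 1 0 ^ (T.G.map Prod.fst).sum) := by
    rw [← zpow_natCast, ← zpow_natCast, ← zpow_natCast, ← zpow_natCast, ← zpow_add₀ ha,
      ← zpow_add₀ ha, ← zpow_add₀ ha]
    congr 1
    rw [DiagramType.decorationSum] at hle ⊢
    omega
  have h1 := pow_ne_zero T.D.sum ha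
  have h2 := pow_ne_zero (T.G.map Prod.fst).sum ha
  rw [neg_pow]
  field_simp
  linear_combination (a T.delta (k - T.t) * (T.D.map fun d => a d 0).prod *
    (T.G.map fun p => a p.1 p.2).prod) * hpow

open Classical in
lemma coeff_logExpansion [CharZero K] {s : ℕ} (hs : 1 ≤ s) {a : ℕ → ℕ → K} {G : K[X]⟦X⟧}
    (hG : IsDysonSchwingerSolution s a G) (k : ℕ) {m : ℕ} (hm : 1 ≤ m) :
    PowerSeries.coeff m (logExpansion G k) =
      -∑ T ∈ (finite_types k).toFinset, PowerSeries.coeff m (collectedTypeTerm s a k T) := by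
  rw [logExpansion, PowerSeries.coeff_mk, hG.coeff_coeff hs _ hm]
  congr 1
  have hT : ∀ C ∈ connectedDiagrams (m + k), (m ≤ headIdx C.word + 1 ↔
      C.type ∈ (finite_types k).toFinset) ∧ (m ≤ headIdx C.word + 1 →
        headIdx C.word + 1 - m = k - C.type.t) := by
    intro C hC
    obtain ⟨h1, h2⟩ := mem_connectedDiagrams.1 hC
    have h3 := DecoratedDiagram.size_eq_headIdx_add_t h2
    rw [Set.Finite.mem_toFinset, Set.mem_ofPred_eq, and_iff_right (DecoratedDiagram.valid_type h2)]
    omega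
  have e : ∀ C ∈ connectedDiagrams (m + k), (C.weight s : K) * headAmplitude a C.word *
      (if m ≤ headIdx C.word + 1 then a (headDec C.word) (headIdx C.word + 1 - m) *
        ((-1) ^ m * (m.factorial : K)⁻¹) else 0) =
      if C.type ∈ (finite_types k).toFinset then (C.weight s : K) * headAmplitude a C.word *
        (a C.type.delta (k - C.type.t) * ((-1) ^ m * (m.factorial : K)⁻¹)) else 0 := by
    intro C hC
    obtain ⟨h1, h2⟩ := hT C hC
    split_ifs with h3 h4 h4
    · rw [h2 h3, C.type_delta]
    · exact absurd (h1.1 h3) h4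
    · exact absurd (h1.2 h4) h3
    · rw [mul_zero]
  rw [Finset.sum_congr rfl e, ← Finset.sum_filter,
    ← Finset.sum_fiberwise_of_maps_to (t := (finite_types k).toFinset)
      (g := DecoratedDiagram.type) fun C hC => (Finset.mem_filter.1 hC).2]
  refine Finset.sum_congr rfl fun T hTm => ?_
  rw [collectedTypeTerm, PowerSeries.coeff_mk, coeff_derivative_typeGF, Finset.filter_filter,
    Finset.mul_sum, Finset.mul_sum, Finset.mul_sum]
  refine Finset.sum_congr ?_ fun C hC => ?_
  · ext C
    simp only [Finset.mem_filter]
    refine and_congr_right fun _ => ⟨fun h => h.2, ?_⟩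
    rintro rfl
    exact ⟨hTm, rfl⟩
  · obtain ⟨hC', rfl⟩ := Finset.mem_filter.1 hC
    rw [C.headAmplitude_word, (mem_connectedDiagrams.1 hC').1]
    ring

/-- The expansion of `H_k` in terms of the types of diagrams, with the powers of `a_{1,0}` collected. -/
lemma exists_logExpansion_eq [CharZero K] {s : ℕ} (hs : 1 ≤ s) {a : ℕ → ℕ → K} {G : K[X]⟦X⟧}
    (hG : IsDysonSchwingerSolution s a G) (k : ℕ) : ∃ κ : K,
    PowerSeries.constantCoeff
      (PowerSeries.C κ - ∑ T ∈ (finite_types k).toFinset, collectedTypeTerm s a k T) = 0 ∧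
    logExpansion G k =
      PowerSeries.C κ - ∑ T ∈ (finite_types k).toFinset, collectedTypeTerm s a k T := by
  set F := ∑ T ∈ (finite_types k).toFinset, collectedTypeTerm s a k T with hF
  have h0 : PowerSeries.constantCoeff
      (PowerSeries.C (PowerSeries.constantCoeff F) - F) = 0 := by
    rw [map_sub, PowerSeries.constantCoeff_C, sub_self]
  refine ⟨PowerSeries.constantCoeff F, h0, ?_⟩
  ext m
  rcases Nat.eq_zero_or_pos m with rfl | hm
  · rw [PowerSeries.coeff_zero_eq_constantCoeff_apply,
      PowerSeries.coeff_zero_eq_constantCoeff_apply, h0, logExpansion,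
      ← PowerSeries.coeff_zero_eq_constantCoeff_apply, PowerSeries.coeff_mk,
      hG.coeff_coeff_zero hs]
  · rw [coeff_logExpansion hs hG k hm, map_sub, PowerSeries.coeff_C, if_neg (by omega), zero_sub,
      hF, map_sum]

end expansion

end ChordLog

end

theorem theorem2p10 {K : Type*} [Field K] [CharZero K] (s : ℕ) (hs : 1 ≤ s)
    (a : ℕ → ℕ → K) (G : PowerSeries (Polynomial K))
    (hG : ChordLog.IsDysonSchwingerSolution s a G) (k : ℕ) :
    ∃ hfin : {T : ChordLog.DiagramType | T.Valid ∧ T.t ≤ k}.Finite,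
      (a 1 0 ≠ 0 → ∃ κ : K,
        PowerSeries.constantCoeff
          (PowerSeries.C κ - ∑ T ∈ hfin.toFinset, ChordLog.typeTerm s a k T) = 0 ∧
        ChordLog.logExpansion G k =
          PowerSeries.C κ - ∑ T ∈ hfin.toFinset, ChordLog.typeTerm s a k T) ∧
      ∃ κ : K,
        PowerSeries.constantCoeff
          (PowerSeries.C κ - ∑ T ∈ hfin.toFinset, ChordLog.collectedTypeTerm s a k T) = 0 ∧
        ChordLog.logExpansion G k =
          PowerSeries.C κ - ∑ T ∈ hfin.toFinset, ChordLog.collectedTypeTerm s a k T := by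
  refine ⟨ChordLog.finite_types k, fun ha => ?_, ChordLog.exists_logExpansion_eq hs hG k⟩
  simp only [ChordLog.typeTerm_eq_collectedTypeTerm s a ha k]
  exact ChordLog.exists_logExpansion_eq hs hG k
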